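/- **Setting.** Fix integers $N,\mathfrak g\ge 1$ and $d\ge 0$, a real $t>0$, real numbers $\alpha_3,\dots,\alpha_d$, and, for $1\le s\le\mathfrak g$, finitely many nonzero reals $\hat\alpha_{n_I}$ indexed by nondecreasing $s$-tuples $n_I=(n_1,\dots,n_s)$ of positive integers. For a Hermitian $N\times N$ matrix $H$ let $D=\{H,\cdot\}$, i.e. $D(B)=HB+BH$ on $M_N(\mathbb C)$, and $$\mathcal S(D)=\frac1{2t}\,\mathrm{Tr}\Big(\frac{D^2}{2}-\sum_{n=3}^d\alpha_n\frac{D^n}{n}\Big)-\sum_{s=1}^{\mathfrak g}(N/t)^{-4s}\sum_{n_I}\hat\alpha_{n_I}\prod_{i=1}^s\mathrm{Tr}(D^{n_i}).$$ Since $\mathrm{Tr}(D^n)=\sum_{r}\binom nr\mathrm{Tr}(H^{n-r})\mathrm{Tr}(H^r)$, expanding $\mathcal S(D)$ in the $P_\ell(H)=\mathrm{Tr}(H^\ell)/\ell$, $\ell\ge1$, gives $$\mathcal S(D)=\frac N{2t}\mathrm{Tr}(H^2)-\sum_{(g;\vec\ell)}\frac{(N/t)^{2-2g-k}}{k!}\,\mathrm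 t^{(g)}_{\vec\ell}\prod_{i=1}^k P_{\ell_i}(H),\qquad \vec\ell=(\ell_1\le\dots\le\ell_k),$$ a finite sum over genera $g\ge0$ and nondecreasing tuples of positive integers. The Boltzmann weights $\mathrm t^{(g)}_{\vec\ell}$ are as follows: $\mathrm t^{(0)}_{\vec\ell}$ collects the terms of the first summand of $\mathcal S(D)$, and $\mathrm t^{(s+1)}_{\vec\ell}$ those coming from the products of $s$ traces. For $1\le k\le 2\mathfrak g$ let $T_k(s_1,\dots,s_k)$ be the symmetrization of $$-\delta_{k,1}\frac N{2t}s_1^2+\sum_{(g;\vec\ell),\ \vec\ell=(\ell_1,\dots,\ell_k)}(N/t)^{2-2g-k}\,\mathrm t^{(g)}_{\vec\ell}\prod_{j=1}^k\frac{s_j^{\ell_j}}{\ell_j}.$$ Let $\hat\Gamma=[a,b]\subset\mathbb R$ with $a<b$, $\Omega=\hat\Gamma^N$, and let $\mathrm P$ be the probability measure on $\Omega$ with density proportional to $$\Psi(\lambda)=\prod_{i<j}(\lambda_j-\lambda_i)^2\,e^{-\mathcal S(D)},$$ where $\mathcal S(D)$ is evaluated at $H=\mathrm{diag}(\lambda_1,\dots,\lambda_N)$.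 For $y\in\mathbb C\setminus\hat\Gamma$ put $X_y=\sum_{i=1}^N\frac1{y-\lambda_i}$. Let $W_r(y_1,\dots,y_r)$ be the joint cumulant of $X_{y_1},\dots,X_{y_r}$ under $\mathrm P$: $$W_r(y_1,\dots,y_r)=\sum_{K\vdash\{1,\dots,r\}}(-1)^{[K]-1}([K]-1)!\prod_{i=1}^{[K]}\mathbb E_{\mathrm P}\Big[\prod_{j\in K_i}X_{y_j}\Big],$$ where $K=\{K_1,\dots,K_{[K]}\}$ runs over set partitions. **Theorem (rank $n$ Schwinger–Dyson equation).** Let $n\ge1$, $I=\{1,\dots,n-1\}$, and let $x,(x_i)_{i\in I}\in\mathbb C\setminus\hat\Gamma$. Let $\epsilon>0$ be such that none of these points lies in the open $\epsilon$-neighbourhood $U_\epsilon$ of $\hat\Gamma$ in $\mathbb C$. Let $C$ be a closed piecewise $C^1$ contour in $U_\epsilon\setminus\hat\Gamma$ that winds once counter-clockwise around every point of $\hat\Gamma$. Then $$\begin{aligned} &W_{n+1}(x,x,x_I)+\sum_{J\subseteq I}W_{|J|+1}(x,x_J)\,W_{n-|J|}(x,x_{I\setminus J}) +\sum_{i\in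 I}\oint_{C}\frac{d\xi}{2\pi\mathrm i}\,\frac{W_{n-1}(\xi,x_{I\setminus\{i\}})}{(x-\xi)(x_i-\xi)^2}\\ &+\sum_{k=1}^{2\mathfrak g}\ \sum_{\substack{K\vdash\{1,\dots,k\}\\ J_1\sqcup\dots\sqcup J_{[K]}=I}}\oint_C\cdots\oint_{C}\Big[\prod_{r=1}^k\frac{d\xi_r}{2\pi\mathrm i}\Big]\frac{\partial_{\xi_1}T_k(\xi_1,\dots,\xi_k)}{(k-1)!\,(x-\xi_1)}\prod_{i=1}^{[K]}W_{|K_i|+|J_i|}(\xi_{K_i},x_{J_i}) \;=\;\mathcal B_n(x;x_I), \end{aligned}$$ where the $J_i$ may be empty. The boundary term is $$\mathcal B_n(x;x_I)=\partial_{\tau_1}\cdots\partial_{\tau_{n-1}}\Big|_{\tau=0}\ \frac{\int_{\partial\Omega}\Psi^\tau\,\iota_V\,d\lambda}{\int_\Omega\Psi^\tau\,d\lambda},\qquad \Psi^\tau=\Psi\,\exp\Big(\sum_{j\in I}\tau_jX_{x_j}\Big),\quad V=\sum_{i=1}^N\frac1{x-\lambda_i}\,\vec e_i ,$$ that is, $$\int_{\partial\Omega}\Psi^\tau\iota_V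 d\lambda=\sum_{i=1}^N\int_{[a,b]^{N-1}}\Big[\frac{\Psi^\tau(\lambda)}{x-\lambda_i}\Big]_{\lambda_i=a}^{\lambda_i=b}\prod_{j\ne i}d\lambda_j .$$ -/

import Mathlib

noncomputable section

open MeasureTheory Set
open scoped Nat

namespace DiracEnsemble

/-- The set `ℕ^s_↑` of nondecreasing `s`-tuples of positive integers. -/
def NUp (s : ℕ) : Type := {l : Fin s → ℕ // Monotone l ∧ ∀ i, 1 ≤ l i}

/-- The parameters of the type `(1,0)` random matrix geometry: the matrix size `N`, the temperature
`t`, the degree `d` and coefficients `α 3, …, α d` of the single trace potential, and the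
coefficients `αhat s n_I` of the products of `s` traces, `1 ≤ s ≤ 𝔤` (finitely many nonzero). -/
structure Params where
  N : ℕ
  t : ℝ
  d : ℕ
  α : ℕ → ℝ
  𝔤 : ℕ
  αhat : (s : ℕ) → NUp s →₀ ℝ
  N_pos : 1 ≤ N
  t_pos : 0 < t
  𝔤_pos : 1 ≤ 𝔤

/-! ### The Dirac operator and the action functional -/

/-- The Dirac operator `D = {H, ·}`, `B ↦ H B + B H`, on `M_N(ℂ)`. -/
def diracOp {N : ℕ} (H : Matrix (Fin N) (Fin N) ℂ) :
    Module.End ℂ (Matrix (Fin N) (Fin N) ℂ) :=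
  LinearMap.mulLeft ℂ H + LinearMap.mulRight ℂ H

/-- `Tr (D ^ n)`, the trace being taken over the Hilbert space `M_N(ℂ)`; it is a real number when
`H` is Hermitian. -/
def trDirac {N : ℕ} (H : Matrix (Fin N) (Fin N) ℂ) (n : ℕ) : ℝ :=
  (LinearMap.trace ℂ (Matrix (Fin N) (Fin N) ℂ) (diracOp H ^ n)).re

/-- `S_unstable(D) = Tr V(D)`, `V(x) = (1/2t) (x²/2 - ∑_{n=3}^d α_n xⁿ/n)`. -/
def actionUnstable (p : Params) (H : Matrix (Fin p.N) (Fin p.N) ℂ) : ℝ :=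
  1 / (2 * p.t) * (trDirac H 2 / 2 - ∑ n ∈ Finset.Icc 3 p.d, p.α n * (trDirac H n / n))

/-- `S_stable(D) = - ∑_{s=1}^𝔤 (N/t)^{-4s} ∑_{n_I} αhat_{n_I} ∏_i Tr(D^{n_i})`. -/
def actionStable (p : Params) (H : Matrix (Fin p.N) (Fin p.N) ℂ) : ℝ :=
  - ∑ s ∈ Finset.Icc 1 p.𝔤, ((p.N : ℝ) / p.t) ^ (-4 * (s : ℤ)) *
      (p.αhat s).sum fun nI c => c * ∏ i, trDirac H (nI.1 i)

/-- The action functional `S(D)`. -/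
def action (p : Params) (H : Matrix (Fin p.N) (Fin p.N) ℂ) : ℝ :=
  actionUnstable p H + actionStable p H

/-! ### Elementary 2-cells, Boltzmann weights and `k`-point interactions -/

/-- The type `(g; ℓ)` of an elementary 2-cell: its genus, and the perimeters of its boundary
components (a nondecreasing tuple of positive integers being recorded as a multiset). -/
abbrev Cell : Type := ℕ × Multiset ℕ

/-- The perimeters `(r_J, n_J - r_J, n_{I \ J})`. -/
def stablePerimeters {s : ℕ} (nI : Fin s → ℕ) (J : Finset (Fin s)) (r : Fin s → ℕ) :
    Multiset ℕ :=
  ∑ i, if i ∈ J then {r i, nI i - r i} else {nI i}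

/-- The choices of `1 ≤ r_j ≤ n_j - 1` for `j ∈ J` (the irrelevant values off `J` are set to
`0`). -/
def splittings {s : ℕ} (nI : Fin s → ℕ) (J : Finset (Fin s)) : Finset (Fin s → ℕ) :=
  Fintype.piFinset fun i => if i ∈ J then Finset.Icc 1 (nI i - 1) else {0}

/-- The Boltzmann weights `t^{(g)}_ℓ` of the elementary 2-cells: `t^{(0)}_ℓ = α_ℓ` for the disks,
those of the cylinders (with `t^{(0)}_{1,1} = -1/t`), and
`t^{(s+1)}_ℓ = t^{s-m} α̃_ℓ` for the stable cells with `s + m` boundary components. They are the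
coefficients obtained by expanding `S(D)` in the `P_ℓ(H) = Tr(H^ℓ)/ℓ`, with
`(N/t)^{χ(C)} / β₀(∂C)!` taken out. -/
def boltzmann (p : Params) : Cell →₀ ℝ :=
  (∑ l ∈ Finset.Icc 3 p.d, Finsupp.single (0, {l}) (p.α l))
  + Finsupp.single (0, {1, 1}) (-1 / p.t)
  + (∑ n ∈ Finset.Icc 3 p.d, ∑ r ∈ Finset.Icc 1 (n - 1),
      Finsupp.single (0, {n - r, r})
        (p.α n / (n * p.t) * n.choose r * (((n - r : ℕ) : ℝ) * r)))
  + ∑ s ∈ Finset.Icc 1 p.𝔤, (p.αhat s).sum fun nI c =>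
      ∑ J : Finset (Fin s), ∑ r ∈ splittings nI.1 J,
        Finsupp.single (s + 1, stablePerimeters nI.1 J r)
          (p.t ^ (s - J.card) * 2 ^ (s - J.card) * (s + J.card)! * c *
            (∏ j ∈ J, ((nI.1 j).choose (r j) : ℝ)) *
            ((stablePerimeters nI.1 J r).prod : ℝ))

/-- The monomial `s_1^{ℓ_1} ⋯ s_k^{ℓ_k}`, for `ℓ_1 ≤ ⋯ ≤ ℓ_k`. -/
def monomialOf (k : ℕ) (l : Multiset ℕ) : MvPolynomial (Fin k) ℝ :=
  ∏ j : Fin k, MvPolynomial.X j ^ ((l.sort (· ≤ ·)).getD j 0)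

/-- The polynomial `T̃_k(s_1, …, s_k)`: minus the Gaussian part, plus the sum over the 2-cells `C`
of genus `g` with `k` boundary components, whose Euler characteristic is `2 - 2g - k`. -/
def interactionPre (p : Params) (k : ℕ) : MvPolynomial (Fin k) ℝ :=
  (if k = 1 then - (MvPolynomial.C ((p.N : ℝ) / (2 * p.t)) * ∑ j, MvPolynomial.X j ^ 2) else 0)
  + ∑ c ∈ (boltzmann p).support with c.2.card = k,
      MvPolynomial.C (((p.N : ℝ) / p.t) ^ (2 - 2 * (c.1 : ℤ) - (k : ℤ)) *
        boltzmann p c / (c.2.prod : ℝ)) * monomialOf k c.2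

/-- The `k`-point interaction `T_k(s_1, …, s_k)`, the symmetrization of `T̃_k`. -/
def interaction (p : Params) (k : ℕ) : MvPolynomial (Fin k) ℝ :=
  MvPolynomial.C (1 / (k ! : ℝ)) *
    ∑ σ : Equiv.Perm (Fin k), MvPolynomial.rename σ (interactionPre p k)

/-! ### The eigenvalue measure on `Ω = Γ̂^N`, `Γ̂ = [a, b]` -/

/-- The eigenvalue density `Δ(λ)² e^{-S(D)}`, `D` being the Dirac operator of a Hermitian matrix
with eigenvalues `λ` (constant prefactors cancel in all normalized quantities). -/
def density (p : Params) (lam : Fin p.N → ℝ) : ℝ :=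
  (∏ i, ∏ j ∈ Finset.Ioi i, |lam j - lam i|) ^ 2 *
    Real.exp (- action p (Matrix.diagonal fun i => (lam i : ℂ)))

/-- `Ω = [a, b]^N`. -/
def box (N : ℕ) (a b : ℝ) : Set (Fin N → ℝ) := Icc (fun _ => a) (fun _ => b)

/-- The measure `ϱ` on `ℝ^N`, restricted to `Ω`. -/
def rhoMeasure (p : Params) (a b : ℝ) : Measure (Fin p.N → ℝ) :=
  (volume.restrict (box p.N a b)).withDensity fun lam => ENNReal.ofReal (density p lam)

/-- The probability measure `P = ϱ / ϱ[1]`. -/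
def probMeasure (p : Params) (a b : ℝ) : Measure (Fin p.N → ℝ) :=
  (rhoMeasure p a b univ)⁻¹ • rhoMeasure p a b

/-! ### Correlators -/

/-- The random variable `X = Tr (x - H)⁻¹ = ∑_i 1 / (x - λ_i)`. -/
def resolventTrace {N : ℕ} (x : ℂ) (lam : Fin N → ℝ) : ℂ := ∑ i, 1 / (x - (lam i : ℂ))

/-- The disconnected correlator `Ŵ_{|B|}((z_j)_{j ∈ B})`: the joint moment of the
`Tr (z_j - H)⁻¹`, `j ∈ B`. -/
def disconnected (p : Params) (a b : ℝ) {ι : Type} (z : ι → ℂ) (B : Finset ι) : ℂ :=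
  ∫ lam, ∏ j ∈ B, resolventTrace (z j) lam ∂(probMeasure p a b)

/-- The connected correlator `W_{|ι|}((z_j)_{j ∈ ι})`: the joint cumulant of the
`Tr (z_j - H)⁻¹`. -/
def W (p : Params) (a b : ℝ) {ι : Type} [Fintype ι] [DecidableEq ι] (z : ι → ℂ) : ℂ :=
  ∑ K : Finpartition (Finset.univ : Finset ι),
    (-1) ^ (K.parts.card - 1) * ((K.parts.card - 1)! : ℂ) *
      ∏ B ∈ K.parts, disconnected p a b z B

/-! ### Contours -/

/-- The interval `Γ̂ = [a, b]` as a subset of `ℂ`. -/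
def cut (a b : ℝ) : Set ℂ := (fun r : ℝ => (r : ℂ)) '' Icc a b

/-- Continuous and piecewise `C¹` on `[0, 1]`. -/
def PiecewiseC1 (γ : ℝ → ℂ) : Prop :=
  ∃ (m : ℕ) (s : Fin (m + 1) → ℝ), StrictMono s ∧ s 0 = 0 ∧ s (Fin.last m) = 1 ∧
    ∀ i : Fin m, ContDiffOn ℝ 1 γ (Icc (s i.castSucc) (s i.succ))

/-- The normalized contour integral `∮_γ f(ξ) dξ / (2πi)` along `γ : [0, 1] → ℂ`. -/
def contour (γ : ℝ → ℂ) (f : ℂ → ℂ) : ℂ :=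
  (∫ s in (0 : ℝ)..1, f (γ s) * deriv γ s) / (2 * Real.pi * Complex.I)

/-- The `k`-times iterated integral `∮_γ ∏_r dξ_r / (2πi) F(ξ_1, …, ξ_k)`. -/
def iterContour (γ : ℝ → ℂ) : (k : ℕ) → ((Fin k → ℂ) → ℂ) → ℂ
  | 0, F => F Fin.elim0
  | k + 1, F => contour γ fun ξ => iterContour γ k fun η => F (Fin.cons ξ η)

/-- `γ` is a closed contour in the `ε`-tubular neighbourhood of `[a, b]` which goes around every
point of `[a, b]` once counter-clockwise. -/
structure IsContourAround (a b ε : ℝ) (γ : ℝ → ℂ) : Prop where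
  piecewiseC1 : PiecewiseC1 γ
  closed : γ 0 = γ 1
  mem_tube : ∀ s ∈ Icc (0 : ℝ) 1, γ s ∈ Metric.thickening ε (cut a b)
  notMem_cut : ∀ s ∈ Icc (0 : ℝ) 1, γ s ∉ cut a b
  winding : ∀ c ∈ cut a b, contour γ (fun ξ => 1 / (ξ - c)) = 1

/-! ### The boundary term -/

/-- The point of the face `{λ_i = c}` with the other coordinates given by `y`. -/
def facePoint {N : ℕ} (i : Fin N) (c : ℝ) (y : {j : Fin N // j ≠ i} → ℝ) : Fin N → ℝ :=
  fun j => if h : j = i then c else y ⟨j, h⟩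

/-- The integral of `Ψ / (x - λ_i)` over the face `{λ_i = c}` of `[a, b]^N`. -/
def faceIntegral {N : ℕ} (a b : ℝ) (x : ℂ) (Ψ : (Fin N → ℝ) → ℂ) (i : Fin N) (c : ℝ) : ℂ :=
  ∫ y in Icc (fun _ : {j : Fin N // j ≠ i} => a) (fun _ => b),
    Ψ (facePoint i c y) / (x - (c : ℂ))

/-- The flux `∫_{∂Ω} Ψ (ι_V dλ)` through the boundary of `Ω = [a, b]^N`, where
`V = ∑_i (x - λ_i)⁻¹ e_i`. -/
def boundaryFlux {N : ℕ} (a b : ℝ) (x : ℂ) (Ψ : (Fin N → ℝ) → ℂ) : ℂ :=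
  ∑ i, (faceIntegral a b x Ψ i b - faceIntegral a b x Ψ i a)

/-- `Ψ^τ = exp(∑_j τ_j X_j) Δ(λ)² e^{-S(D)}`. -/
def tiltedDensity (p : Params) {m : ℕ} (z : Fin m → ℂ) (τ : Fin m → ℝ) (lam : Fin p.N → ℝ) : ℂ :=
  Complex.exp (∑ j, (τ j : ℂ) * resolventTrace (z j) lam) * (density p lam : ℂ)

/-- The boundary term: `∂_{τ_1} ⋯ ∂_{τ_m}` at `τ = 0` of
`(∫_Ω Ψ^τ dλ)⁻¹ ∫_{∂Ω} Ψ^τ (ι_V dλ)`. -/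
def boundaryTerm (p : Params) (a b : ℝ) {m : ℕ} (x : ℂ) (z : Fin m → ℂ) : ℂ :=
  iteratedFDeriv ℝ m
    (fun τ : Fin m → ℝ =>
      boundaryFlux a b x (tiltedDensity p z τ) / ∫ lam in box p.N a b, tiltedDensity p z τ lam)
    0 (fun j => Pi.single j 1)

end DiracEnsemble

end

/-!
The equation is the divergence theorem on the box `[a, b] ^ N`, rewritten in terms of cumulants.

For a set `T` of marked points the vector field with components `Ψ ∏_{j ∈ T} X_{z_j} / (x - λ_i)`
has divergence `Ψ` times a sum of linear statistics of the eigenvalues. The derivative of the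
squared Vandermonde determinant combines with that of `1 / (x - λ_i)` into `X_x ^ 2`
(`sum_vandermondeDeriv`), the derivative of the action gives the statistic
`∑ ∂_1 T_k(λ_{i_1}, …, λ_{i_k}) / ((k - 1)! (x - λ_{i_1}))`
(`neg_action_diagonal`, `sum_driftDeriv`), and the derivative of `X_{z_j}` gives
`∑ 1 / ((x - λ_i) (z_j - λ_i) ^ 2)`. This is the loop equation for moments,
`boundaryFlux_moment`. Cauchy's formula expresses each linear statistic as an iterated contour
integral against the resolvent traces `X_{ξ_r}`
(`IsContourAround.iterContour_aeval_mul_resolventTrace`).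

To pass from moments to cumulants, the set functions `T ↦ f T` are viewed as an algebra under
the convolution `(f * m) T = ∑_{V ⊆ T} f V * m (T \ V)`. Let `m T` be the unnormalized moment of
`∏_{j ∈ T} X_{z_j}`.
* The sum over set partitions `K` and distributions of `T` among the blocks of `K` of products of
  cumulants (`blockSum`) convolves with `m` to the mixed moment of `∏_r X_{ξ_r} ∏_{j ∈ T} X_{z_j}`
  (`blockSum_convolution`). Hence the left hand side of the equation, taken for every subset `T`
  of the marked points (`loopSum`), convolves with `m` to the flux of the field above
  (`loopSum_convolution`).
* The boundary term is a mixed derivative at `0` of the quotient of the tilted flux by the tilted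
  partition function. Both are smooth in `τ`, their mixed derivatives at `0` are the flux and `m`,
  and by the Leibniz rule the mixed derivatives of the quotient convolve with `m` to the flux
  (`IsDerivTower.deconvolution`, `boundaryTerm_eq`).

Since `m ∅` is the partition function, which is positive, convolution with `m` is injective
(`eq_of_convolution_eq`), and the two sides agree.
-/

noncomputable section

open MeasureTheory Set

namespace DiracEnsemble

/-! ### Set partitions and cumulants -/

section Combinatorics

variable {ι : Type*} [DecidableEq ι]

/-- The set partitions of a finite set `S`, each recorded as the finite set of its blocks. -/
def partitions (S : Finset ι) : Finset (Finset (Finset ι)) :=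
  (Finset.univ : Finset (Finpartition S)).image Finpartition.parts

lemma mem_partitions {S : Finset ι} {P : Finset (Finset ι)} :
    P ∈ partitions S ↔ (∀ B ∈ P, B.Nonempty ∧ B ⊆ S) ∧ (∀ x ∈ S, ∃ B ∈ P, x ∈ B) ∧
      ∀ A ∈ P, ∀ B ∈ P, ∀ x, x ∈ A → x ∈ B → A = B := by
  simp only [partitions, Finset.mem_image, Finset.mem_univ, true_and]
  constructor
  · rintro ⟨K, rfl⟩
    exact ⟨fun B hB => ⟨K.nonempty_of_mem_parts hB, K.subset hB⟩, fun x hx => K.exists_mem hx,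
      fun A hA B hB x h1 h2 => K.eq_of_mem_parts hA hB h1 h2⟩
  · rintro ⟨h1, h2, h3⟩
    refine ⟨Finpartition.ofExistsUnique P (fun p hp => (h1 p hp).2) (fun x hx => ?_) ?_, rfl⟩
    · obtain ⟨B, hB, hx'⟩ := h2 x hx
      exact ⟨B, ⟨hB, hx'⟩, fun C hC => h3 C hC.1 B hB x hC.2 hx'⟩
    · intro h
      exact absurd (h1 ∅ h).1 (by simp)

lemma sum_finpartition_eq {M : Type*} [AddCommMonoid M] (S : Finset ι)
    [inst : Fintype (Finpartition S)] (F : Finset (Finset ι) → M) :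
    ∑ K : Finpartition S, F K.parts = ∑ P ∈ partitions S, F P := by
  rw [partitions, Finset.sum_image (fun K _ L _ h => Finpartition.ext h)]
  congr!

/-- Removing a marked block of a partition. -/
lemma sum_partitions_mark {M : Type*} [AddCommMonoid M] (S : Finset ι)
    (F : Finset ι → Finset (Finset ι) → M) :
    ∑ P ∈ partitions S, ∑ B ∈ P, F B (P.erase B) =
      ∑ B ∈ S.powerset with B.Nonempty, ∑ L ∈ partitions (S \ B), F B L := by
  rw [Finset.sum_sigma', Finset.sum_sigma']
  refine Finset.sum_bij' (fun x _ => ⟨x.2, x.1.erase x.2⟩) (fun y _ => ⟨insert y.1 y.2, y.1⟩)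
    ?_ ?_ ?_ ?_ ?_
  · rintro ⟨P, B⟩ h
    simp only [Finset.mem_sigma, mem_partitions] at h
    obtain ⟨⟨h1, h2, h3⟩, hB⟩ := h
    simp only [Finset.mem_sigma, mem_partitions, Finset.mem_filter, Finset.mem_powerset,
      Finset.mem_erase, Finset.mem_sdiff]
    refine ⟨⟨(h1 B hB).2, (h1 B hB).1⟩, fun A hA => ⟨(h1 A hA.2).1, fun x hx => ?_⟩,
      fun x hx => ?_, fun A hA C hC x hxA hxC => h3 A hA.2 C hC.2 x hxA hxC⟩
    · rw [Finset.mem_sdiff]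
      exact ⟨(h1 A hA.2).2 hx, fun hxB => hA.1 (h3 A hA.2 B hB x hx hxB)⟩
    · obtain ⟨A, hA, hxA⟩ := h2 x hx.1
      exact ⟨A, ⟨fun hAB => hx.2 (hAB ▸ hxA), hA⟩, hxA⟩
  · rintro ⟨B, L⟩ h
    simp only [Finset.mem_sigma, mem_partitions, Finset.mem_filter, Finset.mem_powerset] at h
    obtain ⟨⟨hBS, hB⟩, h1, h2, h3⟩ := h
    have key : ∀ A ∈ L, ∀ x ∈ A, x ∉ B := fun A hA x hx =>
      (Finset.mem_sdiff.1 ((h1 A hA).2 hx)).2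
    simp only [Finset.mem_sigma, mem_partitions, Finset.mem_insert]
    refine ⟨⟨?_, fun x hx => ?_, ?_⟩, Or.inl trivial⟩
    · rintro A (rfl | hA)
      · exact ⟨hB, hBS⟩
      · exact ⟨(h1 A hA).1, (h1 A hA).2.trans Finset.sdiff_subset⟩
    · by_cases hxB : x ∈ B
      · exact ⟨B, Or.inl rfl, hxB⟩
      · obtain ⟨A, hA, hxA⟩ := h2 x (Finset.mem_sdiff.2 ⟨hx, hxB⟩)
        exact ⟨A, Or.inr hA, hxA⟩
    · rintro A (rfl | hA) C (rfl | hC) x hxA hxC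
      · rfl
      · exact absurd hxA (key C hC x hxC)
      · exact absurd hxC (key A hA x hxA)
      · exact h3 A hA C hC x hxA hxC
  · rintro ⟨P, B⟩ h
    simp only [Finset.mem_sigma] at h
    simp [Finset.insert_erase h.2]
  · rintro ⟨B, L⟩ h
    simp only [Finset.mem_sigma, mem_partitions, Finset.mem_filter, Finset.mem_powerset] at h
    have : B ∉ L := by
      intro hBL
      obtain ⟨x, hx⟩ := h.1.2
      exact (Finset.mem_sdiff.1 ((h.2.1 B hBL).2 hx)).2 hx
    simp [Finset.erase_insert this]
  · intros; rfl

/-- The joint cumulant over `S` attached to the joint moments `m`. -/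
def cumulant (m : Finset ι → ℂ) (S : Finset ι) : ℂ :=
  ∑ P ∈ partitions S, (-1) ^ (P.card - 1) * ((P.card - 1).factorial : ℂ) * ∏ B ∈ P, m B

lemma card_filter_notMem_of_mem_partitions {S : Finset ι} {P : Finset (Finset ι)}
    (hP : P ∈ partitions S) {a : ι} (ha : a ∈ S) : (P.filter (a ∉ ·)).card = P.card - 1 := by
  obtain ⟨h1, h2, h3⟩ := mem_partitions.1 hP
  obtain ⟨B, hB, haB⟩ := h2 a ha
  rw [← Finset.card_erase_of_mem hB]
  congr 1
  ext A
  simp only [Finset.mem_filter, Finset.mem_erase]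
  constructor
  · rintro ⟨hA, haA⟩
    exact ⟨fun h => haA (h ▸ haB), hA⟩
  · rintro ⟨hne, hA⟩
    exact ⟨hA, fun haA => hne (h3 A hA B hB a haA haB)⟩

/-- The moment-cumulant recursion: in the sum over the block containing `a`, the contributions of
partitions with at least two blocks cancel, since `c_k + (k - 1) c_{k-1} = 0` for
`c_k = (-1)^{k-1} (k-1)!`. -/
lemma sum_cumulant_mul (m : Finset ι → ℂ) (hm : m ∅ = 1) (S : Finset ι) (a : ι) (ha : a ∈ S) :
    ∑ A ∈ S.powerset with a ∈ A, cumulant m A * m (S \ A) = m S := by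
  have hS : S ∈ S.powerset.filter (a ∈ ·) := by simp [ha]
  rw [← Finset.add_sum_erase _ _ hS, Finset.sdiff_self, hm, mul_one]
  let F : Finset ι → Finset (Finset ι) → ℂ := fun B L =>
    if a ∈ B then 0 else ((-1) ^ (L.card - 1) * ((L.card - 1).factorial : ℂ) * ∏ C ∈ L, m C) * m B
  have e1 : ∑ A ∈ (S.powerset.filter (a ∈ ·)).erase S, cumulant m A * m (S \ A) =
      ∑ B ∈ S.powerset with B.Nonempty, ∑ L ∈ partitions (S \ B), F B L := by
    have : ∀ B, ∑ L ∈ partitions (S \ B), F B L =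
        if a ∉ B then cumulant m (S \ B) * m B else 0 := by
      intro B
      by_cases haB : a ∈ B
      · simp [F, haB]
      · simp [F, haB, cumulant, Finset.sum_mul]
    rw [Finset.sum_congr rfl fun B _ => this B, ← Finset.sum_filter]
    refine Finset.sum_bij' (fun A _ => S \ A) (fun B _ => S \ B) ?_ ?_ ?_ ?_ ?_
    · intro A hA
      simp only [Finset.mem_erase, Finset.mem_filter, Finset.mem_powerset] at hA
      simp only [Finset.mem_filter, Finset.mem_powerset, Finset.sdiff_subset, true_and,
        Finset.mem_sdiff, hA.2.2, not_true_eq_false, and_false, not_false_eq_true, and_true]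
      rw [Finset.sdiff_nonempty]
      exact fun h => hA.1 (Finset.Subset.antisymm hA.2.1 h)
    · intro B hB
      simp only [Finset.mem_filter, Finset.mem_powerset] at hB
      simp only [Finset.mem_erase, Finset.mem_filter, Finset.mem_powerset, Finset.sdiff_subset,
        Finset.mem_sdiff, ha, hB.2, not_false_eq_true, and_true]
      intro h
      obtain ⟨x, hx⟩ := hB.1.2
      have := hB.1.1 hx
      rw [← h] at this
      exact (Finset.mem_sdiff.1 this).2 hx
    · intro A hA
      simp only [Finset.mem_erase, Finset.mem_filter, Finset.mem_powerset] at hA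
      simp [hA.2.1]
    · intro B hB
      simp only [Finset.mem_filter, Finset.mem_powerset] at hB
      simp [hB.1.1]
    · intro A hA
      simp only [Finset.mem_erase, Finset.mem_filter, Finset.mem_powerset] at hA
      simp [hA.2.1]
  have e2 : ∀ P ∈ partitions S, ∑ B ∈ P, F B (P.erase B) =
      ((P.card - 1 : ℕ) : ℂ) * ((-1) ^ (P.card - 1 - 1) * ((P.card - 1 - 1).factorial : ℂ)) *
        ∏ B ∈ P, m B := by
    intro P hP
    have : ∀ B ∈ P, F B (P.erase B) = if a ∉ B then
        ((-1) ^ (P.card - 1 - 1) * ((P.card - 1 - 1).factorial : ℂ)) * ∏ B ∈ P, m B else 0 := by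
      intro B hB
      by_cases haB : a ∈ B
      · simp [F, haB]
      · simp only [F, haB, if_false, not_false_eq_true, if_true, Finset.card_erase_of_mem hB]
        rw [mul_assoc, Finset.prod_erase_mul _ _ hB]
    rw [Finset.sum_congr rfl this, ← Finset.sum_filter, Finset.sum_const,
      card_filter_notMem_of_mem_partitions hP ha, nsmul_eq_mul, ← mul_assoc]
  rw [e1, ← sum_partitions_mark, Finset.sum_congr rfl e2, cumulant, ← Finset.sum_add_distrib]
  have hSP : ({S} : Finset (Finset ι)) ∈ partitions S := by
    rw [mem_partitions]
    simp only [Finset.mem_singleton, forall_eq, exists_eq_left]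
    exact ⟨⟨⟨a, ha⟩, subset_rfl⟩, fun x hx => hx, fun _ _ _ => trivial⟩
  rw [Finset.sum_eq_single_of_mem _ hSP]
  · simp
  · intro P hP hne
    rw [← add_mul]
    obtain ⟨h1, h2, h3⟩ := mem_partitions.1 hP
    have hcard : 2 ≤ P.card := by
      by_contra! hlt
      obtain ⟨B, hB, haB⟩ := h2 a ha
      have hB1 : P = {B} := by
        refine Finset.eq_singleton_iff_unique_mem.2 ⟨hB, fun A hA => ?_⟩
        exact Finset.card_le_one.1 (by omega) A hA B hB
      apply hne
      rw [hB1]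
      congr 1
      refine Finset.Subset.antisymm (h1 B hB).2 fun x hx => ?_
      obtain ⟨A, hA, hxA⟩ := h2 x hx
      rw [hB1, Finset.mem_singleton] at hA
      exact hA ▸ hxA
    obtain ⟨k, hk⟩ := Nat.exists_eq_add_of_le' hcard
    rw [hk]
    simp only [Nat.add_succ_sub_one, Nat.factorial_succ, pow_succ]
    push_cast
    ring_nf

lemma partitions_map {κ : Type*} [DecidableEq κ] (f : κ ↪ ι) (S : Finset κ) :
    partitions (S.map f) = (partitions S).map (Finset.mapEmbedding
      (Finset.mapEmbedding f).toEmbedding).toEmbedding := by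
  ext P
  simp only [Finset.mem_map, mem_partitions, RelEmbedding.coe_toEmbedding,
    Finset.mapEmbedding_apply]
  constructor
  · rintro ⟨h1, h2, h3⟩
    have hpre : ∀ B ∈ P, (S.filter (f · ∈ B)).map f = B := by
      intro B hB
      ext x
      simp only [Finset.mem_map, Finset.mem_filter]
      constructor
      · rintro ⟨y, hy, rfl⟩
        exact hy.2
      · intro hx
        obtain ⟨y, hy, rfl⟩ := Finset.mem_map.1 ((h1 B hB).2 hx)
        exact ⟨y, ⟨hy, hx⟩, rfl⟩
    refine ⟨P.image fun B => S.filter (f · ∈ B), ⟨?_, ?_, ?_⟩, ?_⟩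
    · simp only [Finset.mem_image, forall_exists_index, and_imp, forall_apply_eq_imp_iff₂]
      intro B hB
      refine ⟨?_, Finset.filter_subset _ _⟩
      have := (h1 B hB).1
      rw [← hpre B hB] at this
      simpa using this
    · intro x hx
      obtain ⟨B, hB, hxB⟩ := h2 (f x) ⟨x, hx, rfl⟩
      exact ⟨_, Finset.mem_image_of_mem _ hB, by simp [hx, hxB]⟩
    · simp only [Finset.mem_image, forall_exists_index, and_imp, forall_apply_eq_imp_iff₂,
        Finset.mem_filter]
      intro A hA B hB x _ hxA _ hxB
      rw [h3 A hA B hB (f x) hxA hxB]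
    · ext B
      simp only [Finset.mem_map, Finset.mem_image, RelEmbedding.coe_toEmbedding,
        Finset.mapEmbedding_apply]
      constructor
      · rintro ⟨_, ⟨A, hA, rfl⟩, rfl⟩
        rwa [hpre A hA]
      · intro hB
        exact ⟨_, ⟨B, hB, rfl⟩, hpre B hB⟩
  · rintro ⟨Q, ⟨h1, h2, h3⟩, rfl⟩
    simp only [Finset.mem_map, RelEmbedding.coe_toEmbedding, Finset.mapEmbedding_apply,
      forall_exists_index, and_imp, forall_apply_eq_imp_iff₂, Finset.map_nonempty,
      Finset.map_subset_map, exists_exists_and_eq_and, Finset.map_inj]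
    refine ⟨h1, fun x hx => ?_, fun A hA B hB x hxA y hyB hxy => ?_⟩
    · obtain ⟨B, hB, hxB⟩ := h2 x hx
      exact ⟨B, hB, x, hxB, rfl⟩
    · obtain rfl := f.injective hxy
      exact h3 A hA B hB _ hxA hyB

lemma cumulant_map {κ : Type*} [DecidableEq κ] (f : κ ↪ ι) (m : Finset ι → ℂ) (S : Finset κ) :
    cumulant m (S.map f) = cumulant (fun B => m (B.map f)) S := by
  simp [cumulant, partitions_map]

/-! ### Convolution of set functions -/

/-- Splitting `T` into three pieces `U`, `V` and the rest, in two ways: the associativity of the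
convolution of set functions. -/
lemma sum_powerset_powerset_sdiff {M : Type*} [AddCommMonoid M] (T : Finset ι)
    (f : Finset ι → Finset ι → Finset ι → M) :
    ∑ V ∈ T.powerset, ∑ U ∈ V.powerset, f U (V \ U) (T \ V) =
      ∑ U ∈ T.powerset, ∑ V ∈ (T \ U).powerset, f U V ((T \ U) \ V) := by
  rw [Finset.sum_sigma', Finset.sum_sigma']
  refine Finset.sum_bij' (fun x _ => ⟨x.2, x.1 \ x.2⟩) (fun y _ => ⟨y.1 ∪ y.2, y.1⟩)
    ?_ ?_ ?_ ?_ ?_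
  · rintro ⟨V, U⟩ h
    simp only [Finset.mem_sigma, Finset.mem_powerset] at h ⊢
    exact ⟨h.2.trans h.1, Finset.sdiff_subset_sdiff h.1 subset_rfl⟩
  · rintro ⟨U, V⟩ h
    simp only [Finset.mem_sigma, Finset.mem_powerset] at h ⊢
    exact ⟨Finset.union_subset h.1 (h.2.trans Finset.sdiff_subset), Finset.subset_union_left⟩
  · rintro ⟨V, U⟩ h
    simp only [Finset.mem_sigma, Finset.mem_powerset] at h
    simp [Finset.union_eq_right.2 h.2]
  · rintro ⟨U, V⟩ h
    simp only [Finset.mem_sigma, Finset.mem_powerset] at h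
    have : Disjoint V U := (Finset.subset_sdiff.1 h.2).2
    simp [Finset.union_sdiff_cancel_left this.symm]
  · rintro ⟨V, U⟩ h
    simp only [Finset.mem_sigma, Finset.mem_powerset] at h
    simp only
    congr 1
    ext i
    have := @h.2 i
    simp only [Finset.mem_sdiff]
    tauto

/-- A set function is determined by its convolution with a set function `m` with `m ∅ ≠ 0`. -/
lemma eq_of_convolution_eq {m f g : Finset ι → ℂ} (hm : m ∅ ≠ 0) (S : Finset ι)
    (h : ∀ R ⊆ S, ∑ T ∈ R.powerset, f T * m (R \ T) = ∑ T ∈ R.powerset, g T * m (R \ T)) :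
    f S = g S := by
  induction S using Finset.strongInduction with
  | H S ih =>
    have := h S subset_rfl
    rw [← Finset.add_sum_erase _ _ (Finset.mem_powerset_self S),
      ← Finset.add_sum_erase _ _ (Finset.mem_powerset_self S)] at this
    rw [Finset.sum_congr rfl (g := fun T => g T * m (S \ T))] at this
    · exact mul_right_cancel₀ (by simpa using hm) (add_right_cancel this)
    · intro T hT
      simp only [Finset.mem_erase, Finset.mem_powerset] at hT
      rw [ih T (Finset.ssubset_iff_subset_ne.2 ⟨hT.2, hT.1⟩) fun R hR => h R (hR.trans hT.2)]

/-- The set function whose convolution with `m` is `f`, if `m ∅ ≠ 0`. -/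
def deconvolution (m f : Finset ι → ℂ) (S : Finset ι) : ℂ :=
  (f S - ∑ T ∈ S.ssubsets.attach, deconvolution m f T.1 * m (S \ T.1)) / m ∅
termination_by S.card
decreasing_by exact Finset.card_lt_card (Finset.mem_ssubsets.1 T.2)

lemma deconvolution_eq (m f : Finset ι → ℂ) (S : Finset ι) :
    deconvolution m f S = (f S - ∑ T ∈ S.ssubsets, deconvolution m f T * m (S \ T)) / m ∅ := by
  rw [deconvolution, Finset.sum_attach S.ssubsets fun T => deconvolution m f T * m (S \ T)]

lemma deconvolution_convolution {m f : Finset ι → ℂ} (hm : m ∅ ≠ 0) (S : Finset ι) :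
    ∑ T ∈ S.powerset, deconvolution m f T * m (S \ T) = f S := by
  rw [← Finset.add_sum_erase _ _ (Finset.mem_powerset_self S), ← Finset.ssubsets,
    Finset.sdiff_self, deconvolution_eq]
  field_simp
  ring

/-! ### Moments in terms of cumulants: distributing marked points over the blocks -/

variable {ρ : Type*}

lemma sum_powerset_disjSum {ι M : Type*} [AddCommMonoid M] (A : Finset ρ) (T : Finset ι)
    (f : Finset (ρ ⊕ ι) → M) :
    ∑ X ∈ (A.disjSum T).powerset, f X =
      ∑ B ∈ A.powerset, ∑ U ∈ T.powerset, f (B.disjSum U) := by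
  rw [← Finset.sum_product']
  refine Finset.sum_bij' (fun X _ => (X.toLeft, X.toRight)) (fun y _ => y.1.disjSum y.2)
    ?_ ?_ ?_ ?_ ?_
  · intro X hX
    rw [Finset.mem_powerset] at hX
    simp only [Finset.mem_product, Finset.mem_powerset]
    constructor
    · intro x hx
      simpa using hX (Finset.mem_toLeft.1 hx)
    · intro x hx
      simpa using hX (Finset.mem_toRight.1 hx)
  · rintro ⟨B, U⟩ h
    simp only [Finset.mem_product, Finset.mem_powerset] at h ⊢
    exact Finset.disjSum_mono h.1 h.2
  · intro X _
    exact Finset.toLeft_disjSum_toRight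
  · rintro ⟨B, U⟩ _
    simp
  · intro X _
    simp [Finset.toLeft_disjSum_toRight]

variable [DecidableEq ρ]

lemma disjSum_sdiff_disjSum (A B : Finset ρ) (T U : Finset ι) :
    A.disjSum T \ B.disjSum U = (A \ B).disjSum (T \ U) := by
  ext (x | x) <;> simp

/-- The moment-cumulant recursion for an index set `ρ ⊕ ι`, relative to an index `a` in the first
summand. -/
lemma cumulant_disjSum_recursion (m : Finset (ρ ⊕ ι) → ℂ) (hm : m ∅ = 1) (A : Finset ρ) (a : ρ)
    (ha : a ∈ A) (T : Finset ι) :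
    ∑ B ∈ A.powerset with a ∈ B, ∑ U ∈ T.powerset,
      cumulant m (B.disjSum U) * m ((A \ B).disjSum (T \ U)) = m (A.disjSum T) := by
  rw [← sum_cumulant_mul m hm (A.disjSum T) (Sum.inl a) (by simpa using ha), Finset.sum_filter,
    Finset.sum_filter, sum_powerset_disjSum]
  refine Finset.sum_congr rfl fun B _ => ?_
  by_cases haB : a ∈ B
  · simp [haB, disjSum_sdiff_disjSum]
  · simp [haB]

variable [Fintype ι]

/-- The sum over all ways of distributing the elements of `T` over the blocks `P`, of the product
of the `k B (elements given to B)`. A distribution is a function on `ι` taking the value `∅`,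
which is no block, off `T`. -/
def distributionSum (k : Finset ρ → Finset ι → ℂ) (P : Finset (Finset ρ)) (T : Finset ι) : ℂ :=
  ∑ c ∈ Fintype.piFinset fun i => if i ∈ T then P else {∅}, ∏ B ∈ P, k B (T.filter (c · = B))

/-- Choosing the set `U` of elements which go to the block `B` first. -/
lemma distributionSum_insert (k : Finset ρ → Finset ι → ℂ) (P : Finset (Finset ρ))
    (B : Finset ρ) (hB : B ∉ P) (hP : ∅ ∉ P) (T : Finset ι) :
    distributionSum k (insert B P) T =
      ∑ U ∈ T.powerset, k B U * distributionSum k P (T \ U) := by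
  have hmaps : ∀ c ∈ Fintype.piFinset fun i => if i ∈ T then insert B P else {∅},
      T.filter (c · = B) ∈ T.powerset := fun c _ => by simp
  rw [distributionSum, ← Finset.sum_fiberwise_of_maps_to hmaps]
  refine Finset.sum_congr rfl fun U hU => ?_
  rw [Finset.mem_powerset] at hU
  rw [distributionSum, Finset.mul_sum]
  refine Finset.sum_bij' (fun c _ i => if i ∈ U then ∅ else c i)
    (fun e _ i => if i ∈ U then B else e i) ?_ ?_ ?_ ?_ ?_
  · intro c hc
    simp only [Finset.mem_filter, Fintype.mem_piFinset] at hc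
    simp only [Fintype.mem_piFinset]
    intro i
    have h1 := hc.1 i
    have h2 : i ∈ T.filter (c · = B) ↔ i ∈ U := by rw [hc.2]
    simp only [Finset.mem_filter] at h2
    by_cases hi : i ∈ U
    · simp [hi]
    · by_cases hT : i ∈ T
      · simp only [hT, if_true, Finset.mem_insert] at h1
        simp only [hi, if_false, Finset.mem_sdiff, hT, not_false_eq_true, and_self, if_true]
        tauto
      · simpa [hi, hT] using h1
  · intro e he
    simp only [Fintype.mem_piFinset] at he
    simp only [Finset.mem_filter, Fintype.mem_piFinset]
    refine ⟨fun i => ?_, ?_⟩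
    · have h1 := he i
      by_cases hi : i ∈ U
      · simp [hi, hU hi]
      · by_cases hT : i ∈ T
        · simp only [Finset.mem_sdiff, hT, hi, not_false_eq_true, and_self, if_true] at h1
          simp [hi, hT, h1]
        · simpa [hi, hT] using h1
    · ext i
      have h1 := he i
      simp only [Finset.mem_filter]
      by_cases hi : i ∈ U
      · simp [hi, hU hi]
      · by_cases hT : i ∈ T
        · simp only [Finset.mem_sdiff, hT, hi, not_false_eq_true, and_self, if_true] at h1
          simp only [hT, hi, if_false, true_and, iff_false]
          exact fun h => hB (h ▸ h1)
        · simp [hi, hT]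
  · intro c hc
    simp only [Finset.mem_filter] at hc
    funext i
    by_cases hi : i ∈ U
    · have : i ∈ T.filter (c · = B) := hc.2 ▸ hi
      simp [hi, (Finset.mem_filter.1 this).2]
    · simp [hi]
  · intro e he
    simp only [Fintype.mem_piFinset] at he
    funext i
    by_cases hi : i ∈ U
    · have := he i
      simp only [Finset.mem_sdiff, hi, not_true_eq_false, and_false, if_false,
        Finset.mem_singleton] at this
      simp [hi, this]
    · simp [hi]
  · intro c hc
    simp only [Finset.mem_filter] at hc
    rw [Finset.prod_insert hB, hc.2]
    congr 1
    refine Finset.prod_congr rfl fun A hA => ?_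
    congr 1
    ext i
    simp only [Finset.mem_filter, Finset.mem_sdiff]
    have hAB : A ≠ B := fun h => hB (h ▸ hA)
    have hA0 : A ≠ ∅ := fun h => hP (h ▸ hA)
    by_cases hi : i ∈ U
    · have : i ∈ T.filter (c · = B) := hc.2 ▸ hi
      rw [Finset.mem_filter] at this
      simp [hi, this.2, hAB.symm]
    · simp [hi]

/-- The sum over the partitions of `A` and the distributions of the elements of `T` over the
blocks. -/
def blockSum (k : Finset ρ → Finset ι → ℂ) (A : Finset ρ) (T : Finset ι) : ℂ :=
  ∑ P ∈ partitions A, distributionSum k P T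

lemma partitions_empty : partitions (∅ : Finset ρ) = {∅} := by
  ext P
  simp only [mem_partitions, Finset.mem_singleton, Finset.subset_empty]
  constructor
  · rintro ⟨h1, -, -⟩
    refine Finset.eq_empty_of_forall_notMem fun B hB => ?_
    exact (h1 B hB).1.ne_empty (h1 B hB).2
  · rintro rfl
    simp

lemma blockSum_empty (k : Finset ρ → Finset ι → ℂ) (T : Finset ι) :
    blockSum k ∅ T = if T = ∅ then 1 else 0 := by
  rw [blockSum, partitions_empty, Finset.sum_singleton, distributionSum]
  split_ifs with h
  · subst h
    simp [Fintype.piFinset_singleton]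
  · obtain ⟨i, hi⟩ := Finset.nonempty_iff_ne_empty.2 h
    rw [Fintype.piFinset_eq_empty.2 ⟨i, by simp [hi]⟩, Finset.sum_empty]

/-- The recursion for `blockSum` over the block `B` containing `a` and the set `U` of elements which
it receives. -/
lemma blockSum_eq (k : Finset ρ → Finset ι → ℂ) (A : Finset ρ) (a : ρ) (ha : a ∈ A)
    (T : Finset ι) :
    blockSum k A T = ∑ B ∈ A.powerset with a ∈ B, ∑ U ∈ T.powerset,
      k B U * blockSum k (A \ B) (T \ U) := by
  have e1 : ∀ P ∈ partitions A, distributionSum k P T =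
      ∑ B ∈ P, if a ∈ B then distributionSum k (insert B (P.erase B)) T else 0 := by
    intro P hP
    obtain ⟨h1, h2, h3⟩ := mem_partitions.1 hP
    obtain ⟨B, hB, haB⟩ := h2 a ha
    rw [Finset.sum_eq_single_of_mem B hB]
    · rw [if_pos haB, Finset.insert_erase hB]
    · intro C hC hne
      rw [if_neg fun haC => hne (h3 C hC B hB a haC haB)]
  rw [blockSum, Finset.sum_congr rfl e1,
    sum_partitions_mark A fun B L => if a ∈ B then distributionSum k (insert B L) T else 0]
  rw [← Finset.sum_subset (s₁ := A.powerset.filter (a ∈ ·))]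
  · refine Finset.sum_congr rfl fun B hB => ?_
    simp only [Finset.mem_filter, Finset.mem_powerset] at hB
    simp only [hB.2, if_true, blockSum, Finset.mul_sum]
    rw [Finset.sum_comm]
    refine Finset.sum_congr rfl fun L hL => ?_
    obtain ⟨h1, -, -⟩ := mem_partitions.1 hL
    refine distributionSum_insert k L B (fun hBL => ?_) (fun h => ?_) T
    · exact (Finset.mem_sdiff.1 ((h1 B hBL).2 hB.2)).2 hB.2
    · simpa using (h1 ∅ h).1
  · intro B hB
    simp only [Finset.mem_filter] at hB ⊢
    exact ⟨hB.1, ⟨a, hB.2⟩⟩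
  · intro B hB hB'
    simp only [Finset.mem_filter] at hB hB'
    have : a ∉ B := fun h => hB' ⟨hB.1, h⟩
    simp [this]

/-- If moments `M A T` and cumulants `k A T` are related by the moment-cumulant recursion, then the
sums over partitions of `A` of products of cumulants are the conditional cumulants: their
convolution with the moments `M ∅` is `M A`. -/
lemma blockSum_convolution (k M : Finset ρ → Finset ι → ℂ)
    (h : ∀ A, ∀ a ∈ A, ∀ T, ∑ B ∈ A.powerset with a ∈ B, ∑ U ∈ T.powerset,
      k B U * M (A \ B) (T \ U) = M A T) (A : Finset ρ) (T : Finset ι) :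
    ∑ V ∈ T.powerset, blockSum k A V * M ∅ (T \ V) = M A T := by
  induction A using Finset.strongInduction generalizing T with
  | H A ih =>
    rcases A.eq_empty_or_nonempty with rfl | ⟨a, ha⟩
    · rw [Finset.sum_eq_single_of_mem ∅ (by simp)]
      · simp [blockSum_empty]
      · intro V _ hV
        simp [blockSum_empty, hV]
    · rw [← h A a ha T]
      simp_rw [blockSum_eq k A a ha, Finset.sum_mul]
      rw [Finset.sum_comm]
      refine Finset.sum_congr rfl fun B hB => ?_
      simp only [Finset.mem_filter, Finset.mem_powerset] at hB
      rw [sum_powerset_powerset_sdiff T fun U V W => k B U * blockSum k (A \ B) V * M ∅ W]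
      refine Finset.sum_congr rfl fun U _ => ?_
      rw [← ih (A \ B) (Finset.sdiff_ssubset hB.1 ⟨a, hB.2⟩), Finset.mul_sum]
      exact Finset.sum_congr rfl fun V _ => mul_assoc _ _ _

end Combinatorics

/-! ### Contour integrals -/

section Contour

/-- The regularity of a piecewise `C¹` curve, and the fundamental theorem of calculus along it. The
derivative at the finitely many break points is irrelevant to the integral. -/
lemma continuousOn_and_intervalIntegrable_deriv {γ : ℝ → ℂ} (hγ : PiecewiseC1 γ) :
    ContinuousOn γ (Icc 0 1) ∧ IntervalIntegrable (deriv γ) volume 0 1 ∧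
      ∀ G g : ℂ → ℂ, (∀ s ∈ Icc (0 : ℝ) 1, HasDerivAt G (g (γ s)) (γ s)) →
        ContinuousOn g (γ '' Icc 0 1) →
        ∫ s in (0 : ℝ)..1, g (γ s) * deriv γ s = G (γ 1) - G (γ 0) := by
  obtain ⟨m, s, hs, h0, h1, hd⟩ := hγ
  have hpiece : ∀ i : Fin m, IntervalIntegrable (deriv γ) volume (s i.castSucc) (s i.succ) := by
    intro i
    have hlt : s i.castSucc < s i.succ := hs i.castSucc_lt_succ
    have hc := (hd i).continuousOn_derivWithin (uniqueDiffOn_Icc hlt) le_rfl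
    have := hc.intervalIntegrable_of_Icc (μ := volume) hlt.le
    refine this.congr_ae ?_
    rw [uIoc_of_le hlt.le, ← restrict_Ioo_eq_restrict_Ioc]
    refine (ae_restrict_mem measurableSet_Ioo).mono fun x hx => ?_
    exact derivWithin_of_mem_nhds (Icc_mem_nhds hx.1 hx.2)
  have hmem : ∀ j, s j ∈ Icc (0 : ℝ) 1 := fun j =>
    ⟨h0 ▸ hs.monotone (Fin.zero_le j), h1 ▸ hs.monotone (Fin.le_last j)⟩
  have hsub : ∀ i : Fin m, Icc (s i.castSucc) (s i.succ) ⊆ Icc 0 1 := fun i =>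
    Icc_subset_Icc (hmem _).1 (hmem _).2
  have hcont : ∀ j : Fin (m + 1), ContinuousOn γ (Icc 0 (s j)) := by
    intro j
    induction j using Fin.induction with
    | zero => rw [h0, Icc_self]; exact continuousOn_singleton _ _
    | succ i ih =>
      rw [← Icc_union_Icc_eq_Icc (hmem i.castSucc).1 (hs i.castSucc_lt_succ).le]
      exact ih.union_of_isClosed (hd i).continuousOn isClosed_Icc isClosed_Icc
  have hint : ∀ j : Fin (m + 1), IntervalIntegrable (deriv γ) volume 0 (s j) := by
    intro j
    induction j using Fin.induction with
    | zero => rw [h0]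
    | succ i ih => exact ih.trans (hpiece i)
  have hcγ : ContinuousOn γ (Icc 0 1) := h1 ▸ hcont (Fin.last m)
  refine ⟨hcγ, h1 ▸ hint (Fin.last m), fun G g hG hg => ?_⟩
  have hgint : ∀ u v, 0 ≤ u → u ≤ v → v ≤ 1 → IntervalIntegrable (deriv γ) volume u v →
      IntervalIntegrable (fun x => g (γ x) * deriv γ x) volume u v := by
    intro u v hu huv hv h
    refine h.continuousOn_mul ?_
    rw [uIcc_of_le huv]
    exact hg.comp (hcγ.mono (Icc_subset_Icc hu hv))
      (fun x hx => mem_image_of_mem _ ⟨hu.trans hx.1, hx.2.trans hv⟩)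
  have key : ∀ j : Fin (m + 1), ∫ x in (0 : ℝ)..(s j), g (γ x) * deriv γ x =
      G (γ (s j)) - G (γ 0) := by
    intro j
    induction j using Fin.induction with
    | zero => rw [h0]; simp
    | succ i ih =>
      have hlt : s i.castSucc < s i.succ := hs i.castSucc_lt_succ
      rw [← intervalIntegral.integral_add_adjacent_intervals
        (hgint _ _ le_rfl (hmem _).1 (hmem _).2 (hint i.castSucc))
        (hgint _ _ (hmem _).1 hlt.le (hmem _).2 (hpiece i)), ih,
        intervalIntegral.integral_eq_sub_of_hasDerivAt_of_le (f := fun x => G (γ x)) hlt.le]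
      · ring
      · intro x hx
        exact (hG x (hsub i hx)).continuousAt.comp_continuousWithinAt
          ((hd i).continuousOn x hx)
      · intro x hx
        have hx' := Icc_mem_nhds hx.1 hx.2
        have hdiff : DifferentiableAt ℝ γ x :=
          ((hd i).differentiableOn one_ne_zero x ⟨hx.1.le, hx.2.le⟩).differentiableAt hx'
        have := (hG x (hsub i ⟨hx.1.le, hx.2.le⟩)).scomp x hdiff.hasDerivAt
        simpa [Function.comp_def, mul_comm] using this
      · exact hgint _ _ (hmem _).1 hlt.le (hmem _).2 (hpiece i)
  rw [← h1]
  exact key (Fin.last m)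

variable {a b ε : ℝ} {γ : ℝ → ℂ}

lemma convex_cut (a b : ℝ) : Convex ℝ (cut a b) :=
  (convex_Icc a b).is_linear_image ⟨by simp, by simp⟩

/-- The image of a contour. -/
abbrev trace (γ : ℝ → ℂ) : Set ℂ := γ '' Icc 0 1

namespace IsContourAround

lemma continuousOn (hγ : IsContourAround a b ε γ) : ContinuousOn γ (Icc 0 1) :=
  (continuousOn_and_intervalIntegrable_deriv hγ.piecewiseC1).1

lemma isCompact_trace (hγ : IsContourAround a b ε γ) : IsCompact (trace γ) :=
  isCompact_Icc.image_of_continuousOn hγ.continuousOn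

lemma notMem_cut_of_mem_trace (hγ : IsContourAround a b ε γ) {ξ : ℂ} (h : ξ ∈ trace γ) :
    ξ ∉ cut a b := by
  obtain ⟨s, hs, rfl⟩ := h
  exact hγ.notMem_cut s hs

lemma mem_thickening_of_mem_trace (hγ : IsContourAround a b ε γ) {ξ : ℂ} (h : ξ ∈ trace γ) :
    ξ ∈ Metric.thickening ε (cut a b) := by
  obtain ⟨s, hs, rfl⟩ := h
  exact hγ.mem_tube s hs

lemma intervalIntegrable (hγ : IsContourAround a b ε γ) {f : ℂ → ℂ}
    (hf : ContinuousOn f (trace γ)) :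
    IntervalIntegrable (fun s => f (γ s) * deriv γ s) volume 0 1 := by
  refine (continuousOn_and_intervalIntegrable_deriv hγ.piecewiseC1).2.1.continuousOn_mul ?_
  rw [uIcc_of_le zero_le_one]
  exact hf.comp hγ.continuousOn fun x hx => mem_image_of_mem _ hx

/-- Cauchy's formula on a convex neighbourhood of `[a, b]`: `(f ξ - f c) / (ξ - c)` extends to a
holomorphic function, which has a primitive there. -/
lemma contour_div (hγ : IsContourAround a b ε γ) (hε : 0 < ε) {f : ℂ → ℂ}
    (hf : DifferentiableOn ℂ f (Metric.thickening ε (cut a b))) {c : ℂ} (hc : c ∈ cut a b) :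
    contour γ (fun ξ => f ξ * (1 / (ξ - c))) = f c := by
  set U := Metric.thickening ε (cut a b)
  have hU : IsOpen U := Metric.isOpen_thickening
  have hcU : c ∈ U := Metric.self_subset_thickening hε _ hc
  have hd : DifferentiableOn ℂ (dslope f c) U :=
    (Complex.differentiableOn_dslope (hU.mem_nhds hcU)).2 hf
  obtain ⟨G, hG⟩ := ((convex_cut a b).thickening ε).exists_forall_hasDerivWithinAt hd
  have hzero : ∫ s in (0 : ℝ)..1, dslope f c (γ s) * deriv γ s = 0 := by
    rw [(continuousOn_and_intervalIntegrable_deriv hγ.piecewiseC1).2.2 G (dslope f c), hγ.closed,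
      sub_self]
    · exact fun s hs => (hG _ (hγ.mem_tube s hs)).hasDerivAt (hU.mem_nhds (hγ.mem_tube s hs))
    · exact hd.continuousOn.mono fun ξ hξ => hγ.mem_thickening_of_mem_trace hξ
  have hinv : ContinuousOn (fun ξ : ℂ => 1 / (ξ - c)) (trace γ) := by
    refine ContinuousOn.div continuousOn_const (by fun_prop) fun ξ hξ h => ?_
    exact hγ.notMem_cut_of_mem_trace hξ (sub_eq_zero.1 h ▸ hc)
  have hwind := hγ.winding c hc
  unfold contour at hwind ⊢
  have hsplit : ∀ s ∈ uIcc (0 : ℝ) 1, f (γ s) * (1 / (γ s - c)) * deriv γ s =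
      dslope f c (γ s) * deriv γ s + f c * (1 / (γ s - c) * deriv γ s) := by
    intro s hs
    rw [uIcc_of_le zero_le_one] at hs
    have hne : γ s ≠ c := fun h => hγ.notMem_cut s hs (h ▸ hc)
    have hne' : γ s - c ≠ 0 := sub_ne_zero.2 hne
    rw [dslope_of_ne _ hne, slope_def_field]
    field_simp
    ring
  rw [intervalIntegral.integral_congr hsplit, intervalIntegral.integral_add, hzero, zero_add,
    intervalIntegral.integral_const_mul, mul_div_assoc, hwind, mul_one]
  · exact hγ.intervalIntegrable
      (hd.continuousOn.mono fun ξ hξ => hγ.mem_thickening_of_mem_trace hξ)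
  · exact (hγ.intervalIntegrable hinv).const_mul _

end IsContourAround

/-! ### Iterated contour integrals -/

/-- The Lebesgue measure on `[0, 1]^k`, as a product measure. -/
def cubeMeasure (k : ℕ) : Measure (Fin k → ℝ) :=
  Measure.pi fun _ => (volume : Measure ℝ).restrict (Ioc 0 1)

instance (k : ℕ) : IsFiniteMeasure (cubeMeasure k) := by
  unfold cubeMeasure; infer_instance

lemma cubeMeasure_eq (k : ℕ) :
    cubeMeasure k = volume.restrict (univ.pi fun _ => Ioc (0 : ℝ) 1) := by
  rw [cubeMeasure, volume_pi, Measure.restrict_pi_pi]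

lemma measurableSet_cube (k : ℕ) : MeasurableSet (univ.pi fun _ : Fin k => Ioc (0 : ℝ) 1) :=
  MeasurableSet.univ_pi fun _ => measurableSet_Ioc

lemma ae_cubeMeasure (k : ℕ) : ∀ᵐ s ∂(cubeMeasure k), ∀ r, s r ∈ Icc (0 : ℝ) 1 := by
  rw [cubeMeasure_eq]
  exact (ae_restrict_mem (measurableSet_cube k)).mono fun s hs r =>
    Ioc_subset_Icc_self (hs r trivial)

/-- The tuples of points of a contour. -/
def traceCube (γ : ℝ → ℂ) (k : ℕ) : Set (Fin k → ℂ) := univ.pi fun _ => trace γ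

/-- The density of `dξ / (2πi)` along a contour. -/
def contourWeight (γ : ℝ → ℂ) (s : ℝ) : ℂ := deriv γ s / (2 * Real.pi * Complex.I)

lemma contour_eq (γ : ℝ → ℂ) (f : ℂ → ℂ) :
    contour γ f = ∫ s in Ioc (0 : ℝ) 1, f (γ s) * contourWeight γ s := by
  rw [contour, intervalIntegral.integral_of_le zero_le_one, ← integral_div]
  simp only [contourWeight, mul_div_assoc]

lemma continuousOn_setIntegral {Ξ Λ : Type*} [TopologicalSpace Ξ] [FirstCountableTopology Ξ]
    [TopologicalSpace Λ] [MeasurableSpace Λ] [BorelSpace Λ] [SecondCountableTopology Λ]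
    {μ : Measure Λ} {A : Set Ξ} {B : Set Λ} (hA : IsCompact A) (hB : IsCompact B)
    (hBm : MeasurableSet B) (hμ : μ B ≠ ⊤) {G : Ξ → Λ → ℂ}
    (hG : ContinuousOn (Function.uncurry G) (A ×ˢ B)) :
    ContinuousOn (fun ξ => ∫ x in B, G ξ x ∂μ) A := by
  obtain ⟨C, hC⟩ := (hA.prod hB).exists_bound_of_continuousOn hG
  have : IsFiniteMeasure (μ.restrict B) := ⟨by simpa using hμ.lt_top⟩
  refine continuousOn_of_dominated (bound := fun _ => C) (fun ξ hξ => ?_) (fun ξ hξ => ?_)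
    (integrable_const C) ?_
  · exact (hG.comp (f := fun x => (ξ, x)) (by fun_prop)
      fun x hx => ⟨hξ, hx⟩).aestronglyMeasurable hBm
  · exact (ae_restrict_mem hBm).mono fun x hx => hC (ξ, x) ⟨hξ, hx⟩
  · exact (ae_restrict_mem hBm).mono fun x hx => hG.comp (f := fun ξ => (ξ, x)) (by fun_prop)
      fun ξ hξ => ⟨hξ, hx⟩

namespace IsContourAround

lemma isCompact_traceCube (hγ : IsContourAround a b ε γ) (k : ℕ) : IsCompact (traceCube γ k) :=
  isCompact_univ_pi fun _ => hγ.isCompact_trace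

lemma integrable_prod_weight (hγ : IsContourAround a b ε γ) (k : ℕ) :
    Integrable (fun s : Fin k → ℝ => ∏ r, contourWeight γ (s r)) (cubeMeasure k) := by
  have h : IntegrableOn (deriv γ) (Ioc 0 1) :=
    (intervalIntegrable_iff_integrableOn_Ioc_of_le zero_le_one).1
      (continuousOn_and_intervalIntegrable_deriv hγ.piecewiseC1).2.1
  exact Integrable.fintype_prod (f := fun _ : Fin k => contourWeight γ)
    fun _ => h.div_const _

lemma continuousOn_cube (hγ : IsContourAround a b ε γ) (k : ℕ) :
    ContinuousOn (fun s : Fin k → ℝ => γ ∘ s) (univ.pi fun _ => Ioc (0 : ℝ) 1) := by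
  refine continuousOn_pi.2 fun r => ?_
  exact hγ.continuousOn.comp (continuous_apply r).continuousOn
    fun s hs => Ioc_subset_Icc_self (hs r trivial)

lemma comp_mem_traceCube {k : ℕ} {s : Fin k → ℝ} (hs : ∀ r, s r ∈ Icc (0 : ℝ) 1) :
    γ ∘ s ∈ traceCube γ k := fun r _ => mem_image_of_mem _ (hs r)

lemma integrable_iterContour (hγ : IsContourAround a b ε γ) {k : ℕ} {F : (Fin k → ℂ) → ℂ}
    (hF : ContinuousOn F (traceCube γ k)) :
    Integrable (fun s => F (γ ∘ s) * ∏ r, contourWeight γ (s r)) (cubeMeasure k) := by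
  obtain ⟨C, hC⟩ := (hγ.isCompact_traceCube k).exists_bound_of_continuousOn hF
  refine (hγ.integrable_prod_weight k).bdd_mul (c := C) ?_ ?_
  · rw [cubeMeasure_eq]
    exact (hF.comp (hγ.continuousOn_cube k) fun s hs => comp_mem_traceCube
      fun r => Ioc_subset_Icc_self (hs r trivial)).aestronglyMeasurable (measurableSet_cube k)
  · exact (ae_cubeMeasure k).mono fun s hs => hC _ (comp_mem_traceCube hs)

/-- An iterated contour integral is an integral over a cube. -/
lemma iterContour_eq (hγ : IsContourAround a b ε γ) {k : ℕ} {F : (Fin k → ℂ) → ℂ}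
    (hF : ContinuousOn F (traceCube γ k)) :
    iterContour γ k F = ∫ s, F (γ ∘ s) * ∏ r, contourWeight γ (s r) ∂(cubeMeasure k) := by
  induction k with
  | zero =>
    have : (cubeMeasure 0) = Measure.dirac Fin.elim0 := by
      rw [cubeMeasure, Measure.pi_of_empty _ Fin.elim0]
    rw [this, integral_dirac]
    simp only [iterContour, Finset.univ_eq_empty, Finset.prod_empty, mul_one]
    congr 1
    exact Subsingleton.elim _ _
  | succ k ih =>
    have hmp := measurePreserving_piFinSuccAbove
      (fun _ : Fin (k + 1) => (volume : Measure ℝ).restrict (Ioc 0 1)) 0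
    have hint := hγ.integrable_iterContour hF
    have e := hmp.symm
    rw [cubeMeasure] at hint ⊢
    rw [← e.integral_comp' (g := fun s => F (γ ∘ s) * ∏ r, contourWeight γ (s r)),
      integral_prod]
    · rw [iterContour, contour_eq]
      refine setIntegral_congr_fun measurableSet_Ioc fun s hs => ?_
      have hs' := Ioc_subset_Icc_self hs
      rw [ih]
      · rw [← integral_mul_const, cubeMeasure]
        refine integral_congr_ae (Filter.Eventually.of_forall fun s' => ?_)
        simp only [MeasurableEquiv.piFinSuccAbove_symm_apply, Fin.insertNthEquiv_apply]
        simp only [Fin.prod_univ_succ]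
        have h1 : γ ∘ (Fin.insertNthEquiv (fun _ => ℝ) (0 : Fin (k + 1))) (s, s') =
            Fin.cons (γ s) (γ ∘ s') := by
          funext r
          refine Fin.cases ?_ (fun r => ?_) r <;> simp
        rw [h1]
        simp
        ring
      · refine hF.comp (by fun_prop) fun η hη => ?_
        intro r _
        refine Fin.cases ?_ (fun r => ?_) r
        · exact mem_image_of_mem _ hs'
        · simpa using hη r trivial
    · exact (e.integrable_comp_emb (MeasurableEquiv.measurableEmbedding _)).2 hint

lemma iterContour_sum (hγ : IsContourAround a b ε γ) {k : ℕ} {ι : Type*} (S : Finset ι)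
    {F : ι → (Fin k → ℂ) → ℂ} (hF : ∀ i ∈ S, ContinuousOn (F i) (traceCube γ k)) :
    iterContour γ k (fun ξ => ∑ i ∈ S, F i ξ) = ∑ i ∈ S, iterContour γ k (F i) := by
  rw [hγ.iterContour_eq (continuousOn_finsetSum _ hF)]
  simp_rw [Finset.sum_mul]
  rw [integral_finsetSum _ fun i hi => hγ.integrable_iterContour (hF i hi)]
  exact Finset.sum_congr rfl fun i hi => (hγ.iterContour_eq (hF i hi)).symm

/-- Fubini's theorem for a contour integral and an integral over a compact set. -/
lemma iterContour_integral (hγ : IsContourAround a b ε γ) {k : ℕ} {Λ : Type*}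
    [TopologicalSpace Λ] [MeasurableSpace Λ] [BorelSpace Λ] [SecondCountableTopology Λ]
    {μ : Measure Λ} [SFinite μ] {B : Set Λ} (hB : IsCompact B) (hBm : MeasurableSet B)
    (hμ : μ B ≠ ⊤)
    {G : (Fin k → ℂ) → Λ → ℂ} (hG : ContinuousOn (Function.uncurry G) (traceCube γ k ×ˢ B)) :
    iterContour γ k (fun ξ => ∫ x in B, G ξ x ∂μ) =
      ∫ x in B, iterContour γ k (fun ξ => G ξ x) ∂μ := by
  rw [hγ.iterContour_eq (continuousOn_setIntegral (hγ.isCompact_traceCube k) hB hBm hμ hG)]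
  have hslice : ∀ x ∈ B, ContinuousOn (fun ξ => G ξ x) (traceCube γ k) := fun x hx =>
    hG.comp (f := fun ξ => (ξ, x)) (by fun_prop) fun ξ hξ => ⟨hξ, hx⟩
  have e : ∫ x in B, iterContour γ k (fun ξ => G ξ x) ∂μ =
      ∫ x in B, ∫ s, G (γ ∘ s) x * ∏ r, contourWeight γ (s r) ∂(cubeMeasure k) ∂μ :=
    setIntegral_congr_fun hBm fun x hx => hγ.iterContour_eq (hslice x hx)
  rw [e, ← integral_integral_swap]
  · simp_rw [integral_mul_const]
  · have : IsFiniteMeasure (μ.restrict B) := ⟨by simpa using hμ.lt_top⟩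
    obtain ⟨C, hC⟩ := ((hγ.isCompact_traceCube k).prod hB).exists_bound_of_continuousOn hG
    have hw := (hγ.integrable_prod_weight k).comp_fst (μ.restrict B)
    have hset : (cubeMeasure k).prod (μ.restrict B) =
        ((volume : Measure (Fin k → ℝ)).prod μ).restrict
          ((univ.pi fun _ => Ioc (0 : ℝ) 1) ×ˢ B) := by
      rw [cubeMeasure_eq, Measure.prod_restrict]
    have hm := (measurableSet_cube k).prod hBm
    refine hw.bdd_mul (f := fun z : (Fin k → ℝ) × Λ => G (γ ∘ z.1) z.2) (c := C) ?_ ?_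
    · rw [hset]
      refine ContinuousOn.aestronglyMeasurable ?_ hm
      refine hG.comp (f := fun z : (Fin k → ℝ) × Λ => (γ ∘ z.1, z.2)) ?_ ?_
      · exact ((hγ.continuousOn_cube k).comp continuousOn_fst fun z hz => hz.1).prodMk
          continuousOn_snd
      · exact fun z hz => ⟨comp_mem_traceCube fun r => Ioc_subset_Icc_self (hz.1 r trivial), hz.2⟩
    · rw [hset]
      refine (ae_restrict_mem hm).mono fun z hz => ?_
      exact hC (γ ∘ z.1, z.2)
        ⟨comp_mem_traceCube fun r => Ioc_subset_Icc_self (hz.1 r trivial), hz.2⟩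

end IsContourAround

lemma contour_const_mul (γ : ℝ → ℂ) (c : ℂ) (f : ℂ → ℂ) :
    contour γ (fun ξ => c * f ξ) = c * contour γ f := by
  simp_rw [contour_eq, mul_assoc]
  rw [integral_const_mul]

lemma iterContour_const_mul (γ : ℝ → ℂ) {k : ℕ} (c : ℂ) (F : (Fin k → ℂ) → ℂ) :
    iterContour γ k (fun ξ => c * F ξ) = c * iterContour γ k F := by
  induction k with
  | zero => rfl
  | succ k ih =>
    simp only [iterContour, ih]
    rw [← contour_const_mul]

lemma iterContour_prod (γ : ℝ → ℂ) (k : ℕ) (g : Fin k → ℂ → ℂ) :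
    iterContour γ k (fun ξ => ∏ r, g r (ξ r)) = ∏ r, contour γ (g r) := by
  induction k with
  | zero => simp [iterContour]
  | succ k ih =>
    simp only [iterContour, Fin.prod_univ_succ, Fin.cons_zero, Fin.cons_succ,
      iterContour_const_mul, ih]
    simp_rw [mul_comm (g 0 _)]
    rw [contour_const_mul, mul_comm]

namespace IsContourAround

lemma iterContour_aeval_mul_prod (hγ : IsContourAround a b ε γ) (hε : 0 < ε) {k : ℕ}
    (P : MvPolynomial (Fin (k + 1)) ℝ) {h : ℂ → ℂ}
    (hh : DifferentiableOn ℂ h (Metric.thickening ε (cut a b))) {c : Fin (k + 1) → ℂ}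
    (hc : ∀ r, c r ∈ cut a b) :
    iterContour γ (k + 1) (fun ξ => MvPolynomial.aeval ξ P * h (ξ 0) * ∏ r, 1 / (ξ r - c r)) =
      MvPolynomial.aeval c P * h (c 0) := by
  let g : (Fin (k + 1) →₀ ℕ) → Fin (k + 1) → ℂ → ℂ := fun d r ξ =>
    (ξ ^ d r * if r = 0 then h ξ else 1) * (1 / (ξ - c r))
  have e1 : ∀ ξ : Fin (k + 1) → ℂ, MvPolynomial.aeval ξ P * h (ξ 0) * ∏ r, 1 / (ξ r - c r) =
      ∑ d ∈ P.support, (algebraMap ℝ ℂ (P.coeff d)) * ∏ r, g d r (ξ r) := by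
    intro ξ
    rw [MvPolynomial.aeval_def, MvPolynomial.eval₂_eq', Finset.sum_mul, Finset.sum_mul]
    refine Finset.sum_congr rfl fun d _ => ?_
    simp only [g, Finset.prod_mul_distrib, Finset.prod_ite_eq', Finset.mem_univ, if_true]
    ring
  have hinv : ∀ r, ContinuousOn (fun ξ : ℂ => 1 / (ξ - c r)) (trace γ) := by
    intro r
    refine ContinuousOn.div continuousOn_const (by fun_prop) fun ξ hξ h => ?_
    exact hγ.notMem_cut_of_mem_trace hξ (sub_eq_zero.1 h ▸ hc r)
  have hd : ∀ (d : Fin (k + 1) →₀ ℕ) (r : Fin (k + 1)), DifferentiableOn ℂ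
      (fun ξ : ℂ => ξ ^ d r * if r = 0 then h ξ else 1)
      (Metric.thickening ε (cut a b)) := by
    intro d r
    by_cases hr : r = 0
    · simp only [hr, if_true]
      fun_prop
    · simp only [hr, if_false]
      fun_prop
  have hg : ∀ d r, ContinuousOn (g d r) (trace γ) := fun d r =>
    ((hd d r).continuousOn.mono fun ξ hξ => hγ.mem_thickening_of_mem_trace hξ).mul (hinv r)
  simp_rw [e1]
  rw [hγ.iterContour_sum, MvPolynomial.aeval_def, MvPolynomial.eval₂_eq', Finset.sum_mul]
  · refine Finset.sum_congr rfl fun d _ => ?_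
    rw [iterContour_const_mul, iterContour_prod, mul_assoc]
    congr 1
    have : ∀ r, contour γ (g d r) = c r ^ d r * if r = 0 then h (c r) else 1 := fun r =>
      hγ.contour_div hε (hd d r) (hc r)
    simp only [this, Finset.prod_mul_distrib, Finset.prod_ite_eq', Finset.mem_univ, if_true]
  · intro d _
    refine ContinuousOn.mul continuousOn_const (continuousOn_finsetProd _ fun r _ => ?_)
    exact (hg d r).comp (continuous_apply r).continuousOn fun ξ hξ => hξ r trivial

lemma ofReal_mem_cut {r : ℝ} (h : r ∈ Icc a b) : (r : ℂ) ∈ cut a b := mem_image_of_mem _ h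

/-- Linear statistics as contour integrals of resolvents. -/
lemma iterContour_aeval_mul_resolventTrace (hγ : IsContourAround a b ε γ) (hε : 0 < ε) {k : ℕ}
    (P : MvPolynomial (Fin (k + 1)) ℝ) {h : ℂ → ℂ}
    (hh : DifferentiableOn ℂ h (Metric.thickening ε (cut a b))) {N : ℕ} {lam : Fin N → ℝ}
    (hl : ∀ i, lam i ∈ Icc a b) :
    iterContour γ (k + 1)
        (fun ξ => MvPolynomial.aeval ξ P * h (ξ 0) * ∏ r, resolventTrace (ξ r) lam) =
      ∑ i : Fin (k + 1) → Fin N,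
        MvPolynomial.aeval (fun r => (lam (i r) : ℂ)) P * h (lam (i 0)) := by
  have e1 : ∀ ξ : Fin (k + 1) → ℂ,
      MvPolynomial.aeval ξ P * h (ξ 0) * ∏ r, resolventTrace (ξ r) lam =
      ∑ i : Fin (k + 1) → Fin N,
        MvPolynomial.aeval ξ P * h (ξ 0) * ∏ r, 1 / (ξ r - (lam (i r) : ℂ)) := by
    intro ξ
    simp only [resolventTrace]
    rw [Finset.prod_univ_sum, Fintype.piFinset_univ, Finset.mul_sum]
  simp_rw [e1]
  rw [hγ.iterContour_sum]
  · exact Finset.sum_congr rfl fun i _ =>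
      hγ.iterContour_aeval_mul_prod hε P hh fun r => ofReal_mem_cut (hl (i r))
  · intro i _
    refine ContinuousOn.mul (ContinuousOn.mul ?_ ?_) (continuousOn_finsetProd _ fun r _ => ?_)
    · have : Continuous fun ξ : Fin (k + 1) → ℂ => MvPolynomial.aeval ξ P := by
        simp only [MvPolynomial.aeval_def, MvPolynomial.eval₂_eq']
        fun_prop
      exact this.continuousOn
    · exact (hh.continuousOn.mono fun ξ hξ => hγ.mem_thickening_of_mem_trace hξ).comp
        (continuous_apply 0).continuousOn fun ξ hξ => hξ 0 trivial
    · refine ContinuousOn.div continuousOn_const (by fun_prop) fun ξ hξ h => ?_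
      exact hγ.notMem_cut_of_mem_trace (hξ r trivial)
        (sub_eq_zero.1 h ▸ ofReal_mem_cut (hl (i r)))

end IsContourAround

end Contour

/-! ### Mixed derivatives of exponentially tilted integrals -/

section Tilting

variable {m : ℕ} {Ω : Type*} [MeasurableSpace Ω]

/-- The `j`-th coordinate of `ℝ^m`. -/
abbrev coordinate (j : Fin m) : (Fin m → ℝ) →L[ℝ] ℝ := ContinuousLinearMap.proj j

/-- The integral of `q` tilted by `exp (∑ j, τ j * u j)`. -/
def tiltedIntegral (μ : Measure Ω) (u : Fin m → Ω → ℂ) (q : Ω → ℂ) (τ : Fin m → ℝ) : ℂ :=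
  ∫ ω, Complex.exp (∑ j, (τ j : ℂ) * u j ω) * q ω ∂μ

/-- Differentiation under the integral sign: as the `u j` are bounded by `C`, the tilts are bounded
uniformly on the unit ball around `τ`, so the derivative is dominated by a multiple of
`∑ j, |u j * q|`. -/
lemma hasFDerivAt_tiltedIntegral {μ : Measure Ω} {u : Fin m → Ω → ℂ}
    (hu : ∀ j, AEStronglyMeasurable (u j) μ) {C : ℝ} (hC : ∀ᵐ ω ∂μ, ∀ j, ‖u j ω‖ ≤ C)
    {q : Ω → ℂ} (hq : Integrable q μ) (τ : Fin m → ℝ) :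
    HasFDerivAt (tiltedIntegral μ u q)
      (∑ j, (coordinate j).smulRight
        (tiltedIntegral μ u (fun ω => u j ω * q ω) τ)) τ := by
  let A : (Fin m → ℝ) → Ω → ℂ := fun τ ω => Complex.exp (∑ j, (τ j : ℂ) * u j ω)
  have hAm : ∀ τ, AEStronglyMeasurable (A τ) μ := fun τ =>
    Complex.continuous_exp.comp_aestronglyMeasurable
      (Finset.aestronglyMeasurable_fun_sum _ fun j _ => (hu j).const_mul _)
  let K : ℝ := Real.exp (∑ _j : Fin m, (‖τ‖ + 1) * C)
  have hA : ∀ᵐ ω ∂μ, ∀ σ ∈ Metric.ball τ 1, ‖A σ ω‖ ≤ K := by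
    filter_upwards [hC] with ω hω σ hσ
    simp only [A, K, Complex.norm_exp]
    refine Real.exp_le_exp.2 ((Complex.re_le_norm _).trans ((norm_sum_le _ _).trans ?_))
    refine Finset.sum_le_sum fun j _ => ?_
    rw [norm_mul, Complex.norm_real]
    have h1 : ‖σ j‖ ≤ ‖τ‖ + 1 := by
      have h2 : ‖σ - τ‖ ≤ 1 := by
        rw [← dist_eq_norm]; exact (Metric.mem_ball.1 hσ).le
      calc ‖σ j‖ ≤ ‖σ‖ := norm_le_pi_norm σ j
        _ = ‖τ + (σ - τ)‖ := by rw [add_sub_cancel]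
        _ ≤ ‖τ‖ + ‖σ - τ‖ := norm_add_le _ _
        _ ≤ ‖τ‖ + 1 := by linarith
    exact mul_le_mul h1 (hω j) (norm_nonneg _) (by positivity)
  have hτ : τ ∈ Metric.ball τ 1 := Metric.mem_ball_self one_pos
  have hAq : ∀ q : Ω → ℂ, Integrable q μ → Integrable (fun ω => A τ ω * q ω) μ := fun q hq =>
    hq.bdd_mul (hAm τ) (hA.mono fun ω h => h τ hτ)
  have huq : ∀ j, Integrable (fun ω => u j ω * q ω) μ := fun j =>
    hq.bdd_mul (hu j) (hC.mono fun ω h => h j)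
  let F' : (Fin m → ℝ) → Ω → (Fin m → ℝ) →L[ℝ] ℂ := fun σ ω =>
    ∑ j, (coordinate j).smulRight
      (A σ ω * (u j ω * q ω))
  have hF'int : ∀ j : Fin m, Integrable (fun ω =>
      (coordinate j).smulRight
      (A τ ω * (u j ω * q ω))) μ := fun j =>
    (ContinuousLinearMap.smulRightL ℝ (Fin m → ℝ) ℂ
      (coordinate j)).integrable_comp (hAq _ (huq j))
  have key := hasFDerivAt_integral_of_dominated_of_fderiv_le (μ := μ) (𝕜 := ℝ)
    (F := fun σ ω => A σ ω * q ω) (F' := F') (x₀ := τ) (s := Metric.ball τ 1)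
    (bound := fun ω => ∑ j : Fin m,
      ‖coordinate j‖ * (K * ‖u j ω * q ω‖))
    (Metric.ball_mem_nhds τ one_pos)
    (Filter.Eventually.of_forall fun σ => (hAm σ).mul hq.aestronglyMeasurable)
    (hAq q hq) (Finset.aestronglyMeasurable_fun_sum _ fun j _ => (hF'int j).aestronglyMeasurable)
    ?_ ?_ ?_
  · refine key.congr_fderiv ?_
    rw [integral_finsetSum _ fun j _ => hF'int j]
    refine Finset.sum_congr rfl fun j _ => ?_
    exact ((ContinuousLinearMap.smulRightL ℝ (Fin m → ℝ) ℂ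
      (coordinate j)).integral_comp_comm (hAq _ (huq j)))
  · filter_upwards [hA] with ω hω σ hσ
    refine (norm_sum_le _ _).trans (Finset.sum_le_sum fun j _ => ?_)
    rw [ContinuousLinearMap.norm_smulRight_apply, norm_mul]
    gcongr
    exact hω σ hσ
  · exact integrable_finsetSum _ fun j _ => ((huq j).norm.const_mul _).const_mul _
  · refine Filter.Eventually.of_forall fun ω σ _ => ?_
    have h1 : HasFDerivAt (fun σ : Fin m → ℝ => ∑ j, (σ j : ℂ) * u j ω)
        (∑ j, (coordinate j).smulRight
          (u j ω)) σ := by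
      refine HasFDerivAt.fun_sum fun j _ => ?_
      have := (coordinate j).hasFDerivAt
        (x := σ) |>.smul_const (u j ω)
      simpa using this
    refine (h1.cexp.mul_const (q ω)).congr_fderiv ?_
    ext v
    simp only [F', A, sum_apply, ContinuousLinearMap.smulRight_apply,
      smul_apply, ContinuousLinearMap.proj_apply, smul_eq_mul,
      Complex.real_smul, Finset.mul_sum]
    refine Finset.sum_congr rfl fun j _ => ?_
    ring

lemma contDiff_tiltedIntegral {μ : Measure Ω} {u : Fin m → Ω → ℂ}
    (hu : ∀ j, AEStronglyMeasurable (u j) μ) {C : ℝ} (hC : ∀ᵐ ω ∂μ, ∀ j, ‖u j ω‖ ≤ C)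
    {q : Ω → ℂ} (hq : Integrable q μ) : ContDiff ℝ (⊤ : ℕ∞) (tiltedIntegral μ u q) := by
  rw [contDiff_infty]
  intro n
  induction n generalizing q with
  | zero =>
    exact contDiff_zero.2 (continuous_iff_continuousAt.2 fun τ =>
      (hasFDerivAt_tiltedIntegral hu hC hq τ).continuousAt)
  | succ n ih =>
    push_cast
    rw [contDiff_succ_iff_fderiv]
    refine ⟨fun τ => (hasFDerivAt_tiltedIntegral hu hC hq τ).differentiableAt, by simp, ?_⟩
    have : fderiv ℝ (tiltedIntegral μ u q) = fun τ =>
        ∑ j, ContinuousLinearMap.smulRightL ℝ (Fin m → ℝ) ℂ (coordinate j)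
          (tiltedIntegral μ u (fun ω => u j ω * q ω) τ) :=
      funext fun τ => (hasFDerivAt_tiltedIntegral hu hC hq τ).fderiv
    rw [this]
    exact ContDiff.sum fun j _ => (ContinuousLinearMap.contDiff _).comp
      (ih (hq.bdd_mul (hu j) (hC.mono fun ω h => h j)))

/-- A family `F S` of smooth functions on `U`, indexed by sets of coordinates, such that `F S` is
the mixed derivative of `F ∅` in the coordinates of `S`. -/
structure IsDerivTower (U : Set (Fin m → ℝ)) (F : Finset (Fin m) → (Fin m → ℝ) → ℂ) : Prop where
  contDiffOn : ∀ S, ContDiffOn ℝ (⊤ : ℕ∞) (F S) U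
  fderiv_eq : ∀ S, ∀ a ∉ S, ∀ τ ∈ U, fderiv ℝ (F S) τ (Pi.single a 1) = F (insert a S) τ

/-- In a tower, the iterated derivative of `F ∅` in the directions of distinct coordinates is the
member indexed by the set of these coordinates. -/
lemma IsDerivTower.iteratedFDeriv_eq {U : Set (Fin m → ℝ)}
    {F : Finset (Fin m) → (Fin m → ℝ) → ℂ} (hF : IsDerivTower U F) (hU : IsOpen U)
    {k : ℕ} (e : Fin k → Fin m) (he : Function.Injective e) (τ : Fin m → ℝ) (hτ : τ ∈ U) :
    iteratedFDeriv ℝ k (F ∅) τ (fun j => Pi.single (e j) 1) = F (Finset.univ.image e) τ := by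
  induction k generalizing τ with
  | zero => simp
  | succ k ih =>
    rw [iteratedFDeriv_succ_apply_left]
    set v : Fin k → Fin m → ℝ := fun j => Pi.single (e j.succ) 1
    have hd : DifferentiableAt ℝ (iteratedFDeriv ℝ k (F ∅)) τ :=
      ((hF.contDiffOn ∅).contDiffAt (hU.mem_nhds hτ)).differentiableAt_iteratedFDeriv
        (by exact_mod_cast ENat.natCast_lt_top k)
    have h1 := ((ContinuousMultilinearMap.apply ℝ (fun _ : Fin k => Fin m → ℝ) ℂ v).hasFDerivAt.comp
      τ hd.hasFDerivAt).fderiv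
    have h2 : (fderiv ℝ (iteratedFDeriv ℝ k (F ∅)) τ) (Pi.single (e 0) 1) v =
        fderiv ℝ (fun y => iteratedFDeriv ℝ k (F ∅) y v) τ (Pi.single (e 0) 1) :=
      (DFunLike.congr_fun h1 (Pi.single (e 0) 1)).symm
    refine h2.trans ?_
    have h3 : (fun y => iteratedFDeriv ℝ k (F ∅) y v) =ᶠ[nhds τ]
        F (Finset.univ.image fun j : Fin k => e j.succ) := by
      filter_upwards [hU.mem_nhds hτ] with y hy
      exact ih (fun j => e j.succ) (he.comp (Fin.succ_injective k)) y hy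
    rw [h3.fderiv_eq, hF.fderiv_eq _ _ _ τ hτ]
    · congr 1
      ext i
      simp [Fin.exists_fin_succ, eq_comm]
    · simp only [Finset.mem_image, Finset.mem_univ, true_and, not_exists]
      intro j hj
      exact Fin.succ_ne_zero j (he hj)

/-- The mixed derivatives of a quotient are obtained by deconvolution, by Leibniz' rule. -/
lemma IsDerivTower.deconvolution {U : Set (Fin m → ℝ)}
    {Z F : Finset (Fin m) → (Fin m → ℝ) → ℂ} (hU : IsOpen U) (hZ : IsDerivTower U Z)
    (hF : IsDerivTower U F) (h0 : ∀ τ ∈ U, Z ∅ τ ≠ 0) :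
    IsDerivTower U fun S τ => deconvolution (fun T => Z T τ) (fun T => F T τ) S := by
  set Q : Finset (Fin m) → (Fin m → ℝ) → ℂ := fun S τ =>
    DiracEnsemble.deconvolution (fun T => Z T τ) (fun T => F T τ) S with hQ
  have hsm : ∀ S, ContDiffOn ℝ (⊤ : ℕ∞) (Q S) U := by
    intro S
    induction S using Finset.strongInduction with
    | H S ih =>
      have : Q S = fun τ => (F S τ - ∑ T ∈ S.ssubsets, Q T τ * Z (S \ T) τ) * (Z ∅ τ)⁻¹ := by
        funext τ
        simp only [hQ]
        rw [deconvolution_eq, div_eq_mul_inv]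
      rw [this]
      refine ((hF.contDiffOn S).sub (ContDiffOn.sum fun T hT => ?_)).mul
        ((hZ.contDiffOn ∅).inv h0)
      exact (ih T (Finset.mem_ssubsets.1 hT)).mul (hZ.contDiffOn _)
  have hdiff : ∀ {f : (Fin m → ℝ) → ℂ}, ContDiffOn ℝ (⊤ : ℕ∞) f U → ∀ τ ∈ U,
      DifferentiableAt ℝ f τ := fun hf τ hτ =>
    (hf.contDiffAt (hU.mem_nhds hτ)).differentiableAt (by simp)
  refine ⟨hsm, fun S a ha τ hτ => ?_⟩
  refine eq_of_convolution_eq (m := fun T => Z T τ)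
    (f := fun S => fderiv ℝ (Q S) τ (Pi.single a 1)) (g := fun S => Q (insert a S) τ)
    (h0 τ hτ) S fun R hR => ?_
  have haR : a ∉ R := fun h => ha (hR h)
  have e1 : (fun σ => ∑ T ∈ R.powerset, Q T σ * Z (R \ T) σ) =ᶠ[nhds τ] F R := by
    filter_upwards [hU.mem_nhds hτ] with σ hσ
    exact deconvolution_convolution (m := fun T => Z T σ) (h0 σ hσ) R
  have e2 : fderiv ℝ (fun σ => ∑ T ∈ R.powerset, Q T σ * Z (R \ T) σ) τ (Pi.single a 1) =
      ∑ T ∈ R.powerset, (Q T τ * Z (insert a R \ T) τ +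
        fderiv ℝ (Q T) τ (Pi.single a 1) * Z (R \ T) τ) := by
    rw [fderiv_fun_sum (A := fun T σ => Q T σ * Z (R \ T) σ) fun T _ =>
        (hdiff (hsm T) τ hτ).mul (hdiff (hZ.contDiffOn _) τ hτ),
      sum_apply]
    refine Finset.sum_congr rfl fun T hT => ?_
    have haT : a ∉ T := fun h => haR (Finset.mem_powerset.1 hT h)
    rw [fderiv_fun_mul (hdiff (hsm T) τ hτ) (hdiff (hZ.contDiffOn _) τ hτ),
      Finset.insert_sdiff_of_notMem _ haT,
      ← hZ.fderiv_eq (R \ T) a (fun h => haR (Finset.mem_sdiff.1 h).1) τ hτ]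
    simp [mul_comm]
  have e3 := deconvolution_convolution (m := fun T => Z T τ) (f := fun T => F T τ)
    (h0 τ hτ) (insert a R)
  rw [e1.fderiv_eq, hF.fderiv_eq R a haR τ hτ, ← e3, Finset.sum_powerset_insert haR,
    Finset.sum_add_distrib, add_right_inj] at e2
  rw [← e2]
  refine Finset.sum_congr rfl fun T hT => ?_
  have haT : a ∉ T := fun h => haR (Finset.mem_powerset.1 hT h)
  congr 2
  ext i
  simp only [Finset.mem_sdiff, Finset.mem_insert]
  by_cases hi : i = a
  · subst hi; simp [haR]
  · simp [hi]

lemma isDerivTower_tiltedIntegral {μ : Measure Ω} {u : Fin m → Ω → ℂ}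
    (hu : ∀ j, AEStronglyMeasurable (u j) μ) {C : ℝ} (hC : ∀ᵐ ω ∂μ, ∀ j, ‖u j ω‖ ≤ C)
    {q : Ω → ℂ} (hq : Integrable q μ) :
    IsDerivTower univ fun S => tiltedIntegral μ u fun ω => (∏ j ∈ S, u j ω) * q ω := by
  have hint : ∀ S : Finset (Fin m), Integrable (fun ω => (∏ j ∈ S, u j ω) * q ω) μ := by
    intro S
    induction S using Finset.induction with
    | empty => simpa using hq
    | insert a S ha ih =>
      simp_rw [Finset.prod_insert ha, mul_assoc]
      exact ih.bdd_mul (hu a) (hC.mono fun ω h => h a)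
  refine ⟨fun S => (contDiff_tiltedIntegral hu hC (hint S)).contDiffOn, fun S a ha τ _ => ?_⟩
  rw [(hasFDerivAt_tiltedIntegral hu hC (hint S) τ).fderiv]
  simp only [sum_apply, ContinuousLinearMap.smulRight_apply,
    ContinuousLinearMap.proj_apply, Pi.single_apply, ite_smul, one_smul, zero_smul,
    Finset.sum_ite_eq', Finset.mem_univ, if_true]
  simp_rw [Finset.prod_insert ha, mul_assoc]

lemma IsDerivTower.sum {U : Set (Fin m → ℝ)} (hU : IsOpen U) {ι : Type*} {s : Finset ι}
    {F : ι → Finset (Fin m) → (Fin m → ℝ) → ℂ} (h : ∀ i ∈ s, IsDerivTower U (F i)) :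
    IsDerivTower U fun S τ => ∑ i ∈ s, F i S τ := by
  refine ⟨fun S => ContDiffOn.sum fun i hi => (h i hi).contDiffOn S, fun S a ha τ hτ => ?_⟩
  rw [fderiv_fun_sum fun i hi => (((h i hi).contDiffOn S).contDiffAt
    (hU.mem_nhds hτ)).differentiableAt (by simp), sum_apply]
  exact Finset.sum_congr rfl fun i hi => (h i hi).fderiv_eq S a ha τ hτ

lemma IsDerivTower.sub {U : Set (Fin m → ℝ)} (hU : IsOpen U)
    {F G : Finset (Fin m) → (Fin m → ℝ) → ℂ} (hF : IsDerivTower U F) (hG : IsDerivTower U G) :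
    IsDerivTower U fun S τ => F S τ - G S τ := by
  refine ⟨fun S => (hF.contDiffOn S).sub (hG.contDiffOn S), fun S a ha τ hτ => ?_⟩
  rw [fderiv_fun_sub (((hF.contDiffOn S).contDiffAt (hU.mem_nhds hτ)).differentiableAt (by simp))
    (((hG.contDiffOn S).contDiffAt (hU.mem_nhds hτ)).differentiableAt (by simp)),
    sub_apply, hF.fderiv_eq S a ha τ hτ, hG.fderiv_eq S a ha τ hτ]

lemma IsDerivTower.mono {U V : Set (Fin m → ℝ)} {F : Finset (Fin m) → (Fin m → ℝ) → ℂ}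
    (hF : IsDerivTower V F) (h : U ⊆ V) : IsDerivTower U F :=
  ⟨fun S => (hF.contDiffOn S).mono h, fun S a ha τ hτ => hF.fderiv_eq S a ha τ (h hτ)⟩

end Tilting

/-! ### The boundary term -/

section Boundary

variable {N m : ℕ} {a b : ℝ}

lemma isCompact_box (N : ℕ) (a b : ℝ) : IsCompact (box N a b) := isCompact_Icc

lemma mem_box {lam : Fin N → ℝ} : lam ∈ box N a b ↔ ∀ i, lam i ∈ Icc a b := by
  simp only [box, Set.mem_Icc, Pi.le_def]
  exact forall_and.symm

lemma sub_ofReal_ne_zero {x : ℂ} (hx : x ∉ cut a b) {r : ℝ} (hr : r ∈ Icc a b) :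
    x - (r : ℂ) ≠ 0 := fun h => hx (sub_eq_zero.1 h ▸ IsContourAround.ofReal_mem_cut hr)

lemma continuousOn_resolventTrace_box {x : ℂ} (hx : x ∉ cut a b) :
    ContinuousOn (fun lam : Fin N → ℝ => resolventTrace x lam) (box N a b) := by
  refine continuousOn_finsetSum _ fun i _ => ?_
  refine ContinuousOn.div continuousOn_const (by fun_prop) fun lam hl => ?_
  exact sub_ofReal_ne_zero hx (mem_box.1 hl i)

lemma continuous_facePoint (i : Fin N) (c : ℝ) : Continuous (facePoint i c) := by
  refine continuous_pi fun j => ?_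
  unfold facePoint
  split_ifs <;> fun_prop

lemma facePoint_mem_box {i : Fin N} {c : ℝ} (hc : c ∈ Icc a b) {y : {j : Fin N // j ≠ i} → ℝ}
    (hy : y ∈ Icc (fun _ : {j : Fin N // j ≠ i} => a) (fun _ => b)) :
    facePoint i c y ∈ box N a b := by
  refine mem_box.2 fun j => ?_
  unfold facePoint
  split_ifs with h
  · exact hc
  · exact ⟨hy.1 ⟨j, h⟩, hy.2 ⟨j, h⟩⟩

/-- Tilted integrals over a compact set on which everything is continuous. -/
lemma isDerivTower_setIntegral {Λ : Type*} [TopologicalSpace Λ] [MeasurableSpace Λ]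
    [BorelSpace Λ] [SecondCountableTopology Λ] [T2Space Λ] {μ : Measure Λ}
    [IsFiniteMeasureOnCompacts μ] {B : Set Λ}
    (hB : IsCompact B) {u : Fin m → Λ → ℂ} (hu : ∀ j, ContinuousOn (u j) B) {q : Λ → ℂ}
    (hq : ContinuousOn q B) :
    IsDerivTower univ fun S τ =>
      ∫ x in B, Complex.exp (∑ j, (τ j : ℂ) * u j x) * ((∏ j ∈ S, u j x) * q x) ∂μ := by
  choose C hC using fun j => hB.exists_bound_of_continuousOn (hu j)
  refine isDerivTower_tiltedIntegral (C := ∑ j, |C j|)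
    (fun j => (hu j).aestronglyMeasurable hB.measurableSet) ?_ (hq.integrableOn_compact hB)
  filter_upwards [ae_restrict_mem hB.measurableSet] with x hx j
  exact (hC j x hx).trans ((le_abs_self _).trans
    (Finset.single_le_sum (f := fun j => |C j|) (fun j _ => abs_nonneg _) (Finset.mem_univ j)))

/-- The boundary term is obtained by deconvolution from the fluxes of `Ψ ∏_{j ∈ S} X_{z_j}`. -/
lemma boundaryTerm_eq (p : Params) (hcont : Continuous (density p)) (hab : a < b) {x : ℂ}
    {z : Fin m → ℂ} (hz : ∀ j, z j ∉ cut a b)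
    (hpos : (∫ lam in box p.N a b, (density p lam : ℂ)) ≠ 0) :
    boundaryTerm p a b x z = deconvolution
      (fun S => ∫ lam in box p.N a b, (∏ j ∈ S, resolventTrace (z j) lam) * (density p lam : ℂ))
      (fun S => boundaryFlux a b x fun lam =>
        (∏ j ∈ S, resolventTrace (z j) lam) * (density p lam : ℂ)) Finset.univ := by
  have hdc : Continuous fun lam => (density p lam : ℂ) := Complex.continuous_ofReal.comp hcont
  set Z : Finset (Fin m) → (Fin m → ℝ) → ℂ := fun S τ => ∫ lam in box p.N a b,
    Complex.exp (∑ j, (τ j : ℂ) * resolventTrace (z j) lam) *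
      ((∏ j ∈ S, resolventTrace (z j) lam) * (density p lam : ℂ)) with hZdef
  have hZ : IsDerivTower univ Z := isDerivTower_setIntegral (isCompact_box _ _ _)
    (u := fun j lam => resolventTrace (z j) lam)
    (fun j => continuousOn_resolventTrace_box (hz j)) hdc.continuousOn
  have hface : ∀ (i : Fin p.N) (c : ℝ), c ∈ Icc a b → IsDerivTower univ fun S τ =>
      faceIntegral a b x (fun lam => Complex.exp (∑ j, (τ j : ℂ) * resolventTrace (z j) lam) *
        ((∏ j ∈ S, resolventTrace (z j) lam) * (density p lam : ℂ))) i c := by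
    intro i c hc
    have hmaps : MapsTo (facePoint i c)
      (Icc (fun _ : {j : Fin p.N // j ≠ i} => a) (fun _ => b)) (box p.N a b) :=
      fun y hy => facePoint_mem_box hc hy
    have := isDerivTower_setIntegral (μ := volume) (m := m)
      (B := Icc (fun _ : {j : Fin p.N // j ≠ i} => a) (fun _ => b)) isCompact_Icc
      (u := fun j y => resolventTrace (z j) (facePoint i c y))
      (q := fun y => (density p (facePoint i c y) : ℂ) / (x - c))
      (fun j => (continuousOn_resolventTrace_box (hz j)).comp
        (continuous_facePoint i c).continuousOn hmaps)
      ((hdc.comp (continuous_facePoint i c)).div_const _).continuousOn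
    simpa only [faceIntegral, mul_div_assoc] using this
  set Fl : Finset (Fin m) → (Fin m → ℝ) → ℂ := fun S τ => boundaryFlux a b x fun lam =>
    Complex.exp (∑ j, (τ j : ℂ) * resolventTrace (z j) lam) *
        ((∏ j ∈ S, resolventTrace (z j) lam) * (density p lam : ℂ)) with hFldef
  have hFl : IsDerivTower univ Fl := IsDerivTower.sum isOpen_univ fun i _ =>
    IsDerivTower.sub isOpen_univ (hface i b (right_mem_Icc.2 hab.le))
      (hface i a (left_mem_Icc.2 hab.le))
  set U : Set (Fin m → ℝ) := {τ | Z ∅ τ ≠ 0}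
  have hU : IsOpen U := by
    have : Continuous (Z ∅) := (contDiffOn_univ.1 (hZ.contDiffOn ∅)).continuous
    exact isOpen_ne_fun this continuous_const
  have h0 : (0 : Fin m → ℝ) ∈ U := by simpa [U, hZdef] using hpos
  have hQ := IsDerivTower.deconvolution hU (hZ.mono (subset_univ _)) (hFl.mono (subset_univ _))
    fun τ hτ => hτ
  have := hQ.iteratedFDeriv_eq hU id Function.injective_id 0 h0
  simp only [Finset.image_id, id] at this
  rw [boundaryTerm]
  have e : (fun τ : Fin m → ℝ => boundaryFlux a b x (tiltedDensity p z τ) /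
      ∫ lam in box p.N a b, tiltedDensity p z τ lam) =
      fun τ => DiracEnsemble.deconvolution (fun T => Z T τ) (fun T => Fl T τ) ∅ := by
    funext τ
    rw [deconvolution_eq]
    rw [show (∅ : Finset (Fin m)).ssubsets = ∅ from rfl, Finset.sum_empty, sub_zero]
    simp only [hZdef, hFldef, Finset.prod_empty, one_mul]
    rfl
  rw [e, this]
  simp [hZdef, hFldef]

end Boundary

/-! ### The action as a sum of interactions over the eigenvalues -/

section Action

/-- The power sum `∑_i λ_i^l`. -/
def powerSum {N : ℕ} (lam : Fin N → ℝ) (l : ℕ) : ℝ := ∑ i, lam i ^ l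

variable {N : ℕ}

lemma diracOp_diagonal_pow (lam : Fin N → ℝ) (n : ℕ) (B : Matrix (Fin N) (Fin N) ℂ)
    (i j : Fin N) :
    ((diracOp (Matrix.diagonal fun i => (lam i : ℂ)) ^ n) B) i j =
      ((lam i : ℂ) + lam j) ^ n * B i j := by
  induction n generalizing B with
  | zero => simp
  | succ n ih =>
    rw [pow_succ, Module.End.mul_apply, ih]
    simp only [diracOp, LinearMap.add_apply, LinearMap.mulLeft_apply, LinearMap.mulRight_apply,
      Matrix.add_apply, Matrix.diagonal_mul, Matrix.mul_diagonal]
    ring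

lemma trDirac_diagonal (lam : Fin N → ℝ) (n : ℕ) :
    trDirac (Matrix.diagonal fun i => (lam i : ℂ)) n = ∑ i, ∑ j, (lam i + lam j) ^ n := by
  have : LinearMap.trace ℂ (Matrix (Fin N) (Fin N) ℂ)
      (diracOp (Matrix.diagonal fun i => (lam i : ℂ)) ^ n) =
      ((∑ i, ∑ j, (lam i + lam j) ^ n : ℝ) : ℂ) := by
    rw [LinearMap.trace_eq_matrix_trace ℂ (Matrix.stdBasis ℂ (Fin N) (Fin N)), Matrix.trace,
      Fintype.sum_prod_type]
    push_cast
    refine Finset.sum_congr rfl fun i _ => Finset.sum_congr rfl fun j _ => ?_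
    rw [Matrix.diag_apply, LinearMap.toMatrix_apply]
    have h : (diracOp (Matrix.diagonal fun i => (lam i : ℂ)) ^ n)
        (Matrix.stdBasis ℂ (Fin N) (Fin N) (i, j)) =
        ((lam i : ℂ) + lam j) ^ n • Matrix.stdBasis ℂ (Fin N) (Fin N) (i, j) := by
      ext i' j'
      rw [diracOp_diagonal_pow, Matrix.smul_apply, Matrix.stdBasis_eq_single, Matrix.single_apply]
      split_ifs with h
      · rw [h.1, h.2, smul_eq_mul]
      · simp
    rw [h, map_smul, Module.Basis.repr_self]
    simp
  rw [trDirac, this, Complex.ofReal_re]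

lemma powerSum_zero (lam : Fin N → ℝ) : powerSum lam 0 = N := by simp [powerSum]

lemma trDirac_diagonal_eq_powerSum (lam : Fin N → ℝ) {n : ℕ} (hn : 1 ≤ n) :
    trDirac (Matrix.diagonal fun i => (lam i : ℂ)) n =
      2 * N * powerSum lam n + ∑ r ∈ Finset.Icc 1 (n - 1),
        (n.choose r : ℝ) * (powerSum lam (n - r) * powerSum lam r) := by
  have h1 : trDirac (Matrix.diagonal fun i => (lam i : ℂ)) n =
      ∑ r ∈ Finset.range (n + 1), (n.choose r : ℝ) * (powerSum lam (n - r) * powerSum lam r) := by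
    rw [trDirac_diagonal]
    simp_rw [add_pow]
    simp_rw [Finset.sum_comm (s := Finset.univ) (t := Finset.range (n + 1))]
    refine Finset.sum_congr rfl fun r _ => ?_
    rw [mul_comm (powerSum lam (n - r)), powerSum, powerSum, Finset.sum_mul_sum, Finset.mul_sum]
    refine Finset.sum_congr rfl fun i _ => ?_
    rw [Finset.mul_sum]
    exact Finset.sum_congr rfl fun j _ => by ring
  obtain ⟨k, rfl⟩ := Nat.exists_eq_add_of_le' hn
  rw [h1, Finset.sum_range_succ, Finset.range_eq_Ico, Finset.sum_eq_sum_Ico_succ_bot (by omega)]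
  have : Finset.Icc 1 (k + 1 - 1) = Finset.Ico (0 + 1) (k + 1) := by
    ext; simp
  rw [this]
  simp only [Nat.choose_zero_right, Nat.choose_self, Nat.cast_one, one_mul, Nat.sub_zero,
    Nat.sub_self, powerSum_zero]
  ring

/-! ### Interactions evaluated on the eigenvalues -/

lemma sum_eval_rename {k : ℕ} (lam : Fin N → ℝ) (P : MvPolynomial (Fin k) ℝ)
    (σ : Equiv.Perm (Fin k)) :
    ∑ i : Fin k → Fin N, MvPolynomial.eval (fun r => lam (i r)) (MvPolynomial.rename σ P) =
      ∑ i : Fin k → Fin N, MvPolynomial.eval (fun r => lam (i r)) P := by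
  simp_rw [MvPolynomial.eval_rename]
  exact Fintype.sum_equiv (Equiv.arrowCongr σ.symm (Equiv.refl _)) _ _ fun i => rfl

/-- The symmetrization in `T_k` disappears after summation over all `k`-tuples of eigenvalues. -/
lemma sum_eval_interaction (p : Params) (k : ℕ) (lam : Fin N → ℝ) :
    ∑ i : Fin k → Fin N, MvPolynomial.eval (fun r => lam (i r)) (interaction p k) =
      ∑ i : Fin k → Fin N, MvPolynomial.eval (fun r => lam (i r)) (interactionPre p k) := by
  simp only [interaction, map_mul, MvPolynomial.eval_C, map_sum]
  rw [← Finset.mul_sum, Finset.sum_comm]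
  simp_rw [sum_eval_rename]
  rw [Finset.sum_const, Finset.card_univ, Fintype.card_perm, Fintype.card_fin, nsmul_eq_mul]
  have : (k.factorial : ℝ) ≠ 0 := by positivity
  field_simp

lemma sum_eval_monomialOf {k : ℕ} (lam : Fin N → ℝ) {l : Multiset ℕ} (hl : l.card = k) :
    ∑ i : Fin k → Fin N, MvPolynomial.eval (fun r => lam (i r)) (monomialOf k l) =
      (l.map (powerSum lam)).prod := by
  subst hl
  simp only [monomialOf, map_prod, map_pow, MvPolynomial.eval_X]
  have h := Finset.prod_univ_sum (fun _ : Fin l.card => (Finset.univ : Finset (Fin N)))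
    (fun j i => lam i ^ ((l.sort (· ≤ ·)).getD j 0))
  rw [Fintype.piFinset_univ] at h
  rw [← h]
  set L := l.sort (· ≤ ·) with hL
  have hlen : L.length = l.card := Multiset.length_sort _
  have hl : (L : Multiset ℕ) = l := Multiset.sort_eq _ _
  have e : (l.map (powerSum lam)).prod = (L.map (powerSum lam)).prod := by
    rw [← Multiset.prod_coe, ← Multiset.map_coe, hl]
  rw [e, ← Fin.prod_univ_getElem]
  refine Fintype.prod_equiv (finCongr (by simp [hlen])) _ _ fun j => ?_
  have hj : (j : ℕ) < L.length := by rw [hlen]; exact j.2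
  simp [powerSum, hj]

/-- The contribution to `-S(D)` of a cell `(g; ℓ)` of unit Boltzmann weight, namely
`(N/t)^(2-2g-k) / k! * ∏ᵢ P_{ℓᵢ}` where `P_l` is `powerSum lam l / l`. -/
def cellValue (p : Params) (lam : Fin N → ℝ) (c : Cell) : ℝ :=
  1 / (c.2.card.factorial : ℝ) * (((p.N : ℝ) / p.t) ^ (2 - 2 * (c.1 : ℤ) - (c.2.card : ℤ)) /
    (c.2.prod : ℝ)) * (c.2.map (powerSum lam)).prod

lemma sum_eval_interactionPre (p : Params) (k : ℕ) (lam : Fin N → ℝ) :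
    1 / (k.factorial : ℝ) *
      ∑ i : Fin k → Fin N, MvPolynomial.eval (fun r => lam (i r)) (interactionPre p k) =
      (if k = 1 then - ((p.N : ℝ) / (2 * p.t) * powerSum lam 2) else 0) +
        ∑ c ∈ (boltzmann p).support with c.2.card = k, boltzmann p c * cellValue p lam c := by
  simp only [interactionPre, map_add, map_sum, map_mul, MvPolynomial.eval_C,
    Finset.sum_add_distrib, mul_add]
  congr 1
  · split_ifs with hk
    · subst hk
      simp only [map_neg, map_mul, MvPolynomial.eval_C, map_pow, MvPolynomial.eval_X,
        Nat.factorial_one, Nat.cast_one, Finset.univ_unique, Finset.sum_singleton, powerSum,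
        Finset.sum_neg_distrib]
      rw [← Finset.mul_sum, Fintype.sum_equiv (Equiv.funUnique (Fin 1) (Fin N))
        (fun i => lam (i default) ^ 2) (fun i => lam i ^ 2) fun i => rfl]
      ring
    · simp
  · rw [Finset.sum_comm, Finset.mul_sum]
    refine Finset.sum_congr rfl fun c hc => ?_
    have hk := (Finset.mem_filter.1 hc).2
    rw [← Finset.mul_sum, sum_eval_monomialOf lam hk, cellValue, hk]
    ring

lemma card_stablePerimeters {s : ℕ} (n : Fin s → ℕ) (J : Finset (Fin s)) (r : Fin s → ℕ) :
    (stablePerimeters n J r).card = s + J.card := by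
  rw [stablePerimeters, Multiset.card_sum]
  have : ∀ i, (if i ∈ J then ({r i, n i - r i} : Multiset ℕ) else {n i}).card =
      1 + if i ∈ J then 1 else 0 := by
    intro i; split_ifs <;> simp
  simp_rw [this]
  simp [Finset.sum_add_distrib]

lemma prod_map_stablePerimeters {s : ℕ} (n : Fin s → ℕ) (J : Finset (Fin s)) (r : Fin s → ℕ)
    (f : ℕ → ℝ) : ((stablePerimeters n J r).map f).prod =
      ∏ i, if i ∈ J then f (r i) * f (n i - r i) else f (n i) := by
  have : (stablePerimeters n J r).map f =
      ∑ i, (if i ∈ J then ({r i, n i - r i} : Multiset ℕ) else {n i}).map f :=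
    map_sum (Multiset.mapAddMonoidHom f) _ _
  rw [this, Multiset.prod_sum]
  refine Finset.prod_congr rfl fun i _ => ?_
  split_ifs <;> simp

/-- Only cells with between `1` and `2𝔤` boundaries carry a Boltzmann weight, so that the functions
`T_k` with `1 ≤ k ≤ 2𝔤` account for all of them. -/
lemma boltzmann_mem_supported (p : Params) :
    boltzmann p ∈ Finsupp.supported ℝ ℝ {c : Cell | 1 ≤ c.2.card ∧ c.2.card ≤ 2 * p.𝔤} := by
  have hg := p.𝔤_pos
  refine add_mem (add_mem (add_mem (sum_mem fun l _ => ?_) ?_)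
    (sum_mem fun n _ => sum_mem fun r _ => ?_)) (sum_mem fun s hs => sum_mem fun nI _ =>
    sum_mem fun J _ => sum_mem fun r _ => ?_) <;> refine Finsupp.single_mem_supported ℝ _ ?_
  · simp; omega
  · simp; omega
  · simp; omega
  · have h1 : J.card ≤ s := by simpa using J.card_le_univ
    have h2 := Finset.mem_Icc.1 hs
    simp only [Set.mem_ofPred_eq, card_stablePerimeters]
    omega

lemma sum_interaction_eq (p : Params) (lam : Fin N → ℝ) :
    ∑ k ∈ Finset.range (2 * p.𝔤), 1 / ((k + 1).factorial : ℝ) *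
      ∑ i : Fin (k + 1) → Fin N, MvPolynomial.eval (fun r => lam (i r)) (interaction p (k + 1)) =
      - ((p.N : ℝ) / (2 * p.t) * powerSum lam 2) +
        Finsupp.linearCombination ℝ (cellValue p lam) (boltzmann p) := by
  have hg := p.𝔤_pos
  simp_rw [sum_eval_interaction, sum_eval_interactionPre]
  rw [Finset.sum_add_distrib]
  congr 1
  · rw [Finset.sum_eq_single_of_mem 0 (Finset.mem_range.2 (by omega))]
    · simp
    · intro k _ hk
      simp [hk]
  · have hsupp := (Finsupp.mem_supported ℝ _).1 (boltzmann_mem_supported p)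
    rw [Finsupp.linearCombination_apply, Finsupp.sum]
    have hmaps : ∀ c ∈ (boltzmann p).support, c.2.card - 1 ∈ Finset.range (2 * p.𝔤) := by
      intro c hc
      have := hsupp hc
      simp only [Set.mem_ofPred_eq] at this
      exact Finset.mem_range.2 (by omega)
    rw [← Finset.sum_fiberwise_of_maps_to hmaps]
    refine Finset.sum_congr rfl fun k _ => ?_
    refine Finset.sum_congr ?_ fun c _ => rfl
    refine Finset.filter_congr fun c hc => ?_
    have := hsupp hc
    simp only [Set.mem_ofPred_eq] at this
    omega

/-! ### The expansion of the action -/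

/-- Expanding a product of traces: for `i ∉ J` the term `2N Tr(H^{n_i})` is taken from the `i`-th
factor, for `i ∈ J` one of the terms with `1 ≤ r_i ≤ n_i - 1`. -/
lemma prod_trDirac_diagonal (lam : Fin N → ℝ) {s : ℕ} (n : Fin s → ℕ) (hn : ∀ i, 1 ≤ n i) :
    ∏ i, trDirac (Matrix.diagonal fun i => (lam i : ℂ)) (n i) =
      ∑ J : Finset (Fin s), ∑ r ∈ splittings n J, (2 * N : ℝ) ^ (s - J.card) *
        (∏ j ∈ J, ((n j).choose (r j) : ℝ)) *
          ((stablePerimeters n J r).map (powerSum lam)).prod := by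
  simp_rw [fun i => trDirac_diagonal_eq_powerSum lam (hn i)]
  simp_rw [add_comm (2 * (N : ℝ) * _)]
  rw [Fintype.prod_add]
  refine Finset.sum_congr rfl fun J _ => ?_
  have h1 : (∏ i ∈ J, ∑ r ∈ Finset.Icc 1 (n i - 1),
      ((n i).choose r : ℝ) * (powerSum lam (n i - r) * powerSum lam r)) *
      ∏ i ∈ Jᶜ, 2 * (N : ℝ) * powerSum lam (n i) =
      ∏ i, ∑ r ∈ (if i ∈ J then Finset.Icc 1 (n i - 1) else {0}),
        if i ∈ J then ((n i).choose r : ℝ) * (powerSum lam (n i - r) * powerSum lam r)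
        else 2 * (N : ℝ) * powerSum lam (n i) := by
    rw [← Finset.prod_mul_prod_compl J]
    congr 1
    · exact Finset.prod_congr rfl fun i hi => by simp [hi]
    · exact Finset.prod_congr rfl fun i hi => by simp [Finset.mem_compl.1 hi]
  rw [h1, Finset.prod_univ_sum]
  refine Finset.sum_congr rfl fun r _ => ?_
  rw [prod_map_stablePerimeters, ← Finset.prod_mul_prod_compl J, ← Finset.prod_mul_prod_compl J
    (fun i => if i ∈ J then powerSum lam (r i) * powerSum lam (n i - r i)
      else powerSum lam (n i))]
  have h2 : (2 * N : ℝ) ^ (s - J.card) = ∏ _i ∈ Jᶜ, (2 * N : ℝ) := by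
    rw [Finset.prod_const, Finset.card_compl, Fintype.card_fin]
  have hA : (∏ i ∈ J, if i ∈ J then
      ((n i).choose (r i) : ℝ) * (powerSum lam (n i - r i) * powerSum lam (r i))
      else 2 * (N : ℝ) * powerSum lam (n i)) = (∏ i ∈ J, ((n i).choose (r i) : ℝ)) *
      ∏ i ∈ J, if i ∈ J then powerSum lam (r i) * powerSum lam (n i - r i)
      else powerSum lam (n i) := by
    rw [← Finset.prod_mul_distrib]
    refine Finset.prod_congr rfl fun i hi => ?_
    simp only [hi, if_true]
    ring
  have hB : (∏ i ∈ Jᶜ, if i ∈ J then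
      ((n i).choose (r i) : ℝ) * (powerSum lam (n i - r i) * powerSum lam (r i))
      else 2 * (N : ℝ) * powerSum lam (n i)) = (∏ _i ∈ Jᶜ, (2 * N : ℝ)) *
      ∏ i ∈ Jᶜ, if i ∈ J then powerSum lam (r i) * powerSum lam (n i - r i)
      else powerSum lam (n i) := by
    rw [← Finset.prod_mul_distrib]
    refine Finset.prod_congr rfl fun i hi => ?_
    simp only [Finset.mem_compl.1 hi, if_false]
  rw [h2, hA, hB]
  ring

/-- The single-trace part of `-S(D)`. The quadratic term `Tr(D²) = 2N Tr(H²) + 2 Tr(H)²` gives the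
Gaussian weight and the cell `(0; 1, 1)`. -/
lemma neg_actionUnstable_diagonal (p : Params) (lam : Fin p.N → ℝ) :
    - actionUnstable p (Matrix.diagonal fun i => (lam i : ℂ)) =
      - ((p.N : ℝ) / (2 * p.t) * powerSum lam 2) +
        Finsupp.linearCombination ℝ (cellValue p lam)
          ((∑ l ∈ Finset.Icc 3 p.d, Finsupp.single (0, {l}) (p.α l))
            + Finsupp.single (0, {1, 1}) (-1 / p.t)
            + ∑ n ∈ Finset.Icc 3 p.d, ∑ r ∈ Finset.Icc 1 (n - 1),
                Finsupp.single (0, {n - r, r})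
                  (p.α n / (n * p.t) * n.choose r * (((n - r : ℕ) : ℝ) * r))) := by
  have ht := p.t_pos.ne'
  have hN : (p.N : ℝ) ≠ 0 := by have := p.N_pos; positivity
  simp only [map_add, map_sum, Finsupp.linearCombination_single, smul_eq_mul]
  have e1 : ∀ l ∈ Finset.Icc 3 p.d, p.α l * cellValue p lam (0, {l}) =
      1 / (2 * p.t) * (p.α l * (2 * p.N * powerSum lam l / l)) := by
    intro l hl
    have : (l : ℝ) ≠ 0 := by
      have := (Finset.mem_Icc.1 hl).1
      positivity
    simp only [cellValue, Multiset.card_singleton, Multiset.prod_singleton,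
      Multiset.map_singleton]
    norm_num
    field_simp
  have e2 : -1 / p.t * cellValue p lam (0, {1, 1}) =
      - (1 / (2 * p.t) * (powerSum lam 1 * powerSum lam 1)) := by
    simp only [cellValue]
    norm_num
    field_simp
  have e3 : ∀ n ∈ Finset.Icc 3 p.d, ∀ r ∈ Finset.Icc 1 (n - 1),
      p.α n / (n * p.t) * n.choose r * (((n - r : ℕ) : ℝ) * r) *
        cellValue p lam (0, {n - r, r}) = 1 / (2 * p.t) * (p.α n * (((n.choose r : ℝ) *
          (powerSum lam (n - r) * powerSum lam r)) / n)) := by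
    intro n hn r hr
    have h3 := (Finset.mem_Icc.1 hn).1
    have h4 := Finset.mem_Icc.1 hr
    have hn0 : (n : ℝ) ≠ 0 := by positivity
    have hr0 : (r : ℝ) ≠ 0 := by have := h4.1; positivity
    have hnr0 : ((n - r : ℕ) : ℝ) ≠ 0 := Nat.cast_ne_zero.2 (by omega)
    simp only [cellValue, Multiset.insert_eq_cons, Multiset.card_cons, Multiset.card_singleton,
      Multiset.prod_cons, Multiset.prod_singleton, Multiset.map_cons, Multiset.map_singleton,
      Nat.cast_mul]
    norm_num
    field_simp
  rw [Finset.sum_congr rfl e1, e2,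
    Finset.sum_congr rfl fun n hn => Finset.sum_congr rfl (e3 n hn)]
  simp_rw [← Finset.mul_sum, ← Finset.sum_div]
  rw [actionUnstable, trDirac_diagonal_eq_powerSum lam (by norm_num : 1 ≤ 2)]
  have e4 : ∑ n ∈ Finset.Icc 3 p.d,
      p.α n * (trDirac (Matrix.diagonal fun i => (lam i : ℂ)) n / n) =
      ∑ n ∈ Finset.Icc 3 p.d, p.α n * (2 * p.N * powerSum lam n / n) +
      ∑ n ∈ Finset.Icc 3 p.d, p.α n * ((∑ r ∈ Finset.Icc 1 (n - 1), (n.choose r : ℝ) *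
          (powerSum lam (n - r) * powerSum lam r)) / n) := by
    rw [← Finset.sum_add_distrib]
    refine Finset.sum_congr rfl fun n hn => ?_
    rw [trDirac_diagonal_eq_powerSum lam (by have := (Finset.mem_Icc.1 hn).1; omega)]
    ring
  rw [e4]
  norm_num
  field_simp
  ring

/-- The part of `-S(D)` made of products of `s` traces. A cell of genus `s + 1` with `s + |J|`
boundaries carries the power `2 - 2(s + 1) - (s + |J|) = -4s + (s - |J|)` of `N/t`, whence the
factor `t^(s - |J|)` in the Boltzmann weight. -/
lemma neg_actionStable_diagonal (p : Params) (lam : Fin p.N → ℝ) :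
    - actionStable p (Matrix.diagonal fun i => (lam i : ℂ)) =
      Finsupp.linearCombination ℝ (cellValue p lam)
        (∑ s ∈ Finset.Icc 1 p.𝔤, (p.αhat s).sum fun nI c =>
          ∑ J : Finset (Fin s), ∑ r ∈ splittings nI.1 J,
            Finsupp.single (s + 1, stablePerimeters nI.1 J r)
              (p.t ^ (s - J.card) * 2 ^ (s - J.card) * (s + J.card).factorial * c *
                (∏ j ∈ J, ((nI.1 j).choose (r j) : ℝ)) *
                ((stablePerimeters nI.1 J r).prod : ℝ))) := by
  have ht := p.t_pos.ne'
  have hN : (p.N : ℝ) ≠ 0 := by have := p.N_pos; positivity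
  rw [actionStable, neg_neg]
  simp only [map_sum, Finsupp.sum, Finsupp.linearCombination_single, smul_eq_mul]
  refine Finset.sum_congr rfl fun s _ => ?_
  rw [Finset.mul_sum]
  refine Finset.sum_congr rfl fun nI _ => ?_
  rw [prod_trDirac_diagonal lam nI.1 nI.2.2, Finset.mul_sum, Finset.mul_sum]
  refine Finset.sum_congr rfl fun J _ => ?_
  rw [Finset.mul_sum, Finset.mul_sum]
  refine Finset.sum_congr rfl fun r hr => ?_
  have hprod : ((stablePerimeters nI.1 J r).prod : ℝ) ≠ 0 := by
    have h := prod_map_stablePerimeters nI.1 J r fun l => (l : ℝ)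
    have h' : ((stablePerimeters nI.1 J r).map fun l : ℕ => (l : ℝ)).prod =
        ((stablePerimeters nI.1 J r).prod : ℝ) := by
      rw [Nat.cast_multiset_prod]
    rw [← h', h]
    refine Finset.prod_ne_zero_iff.2 fun i _ => ?_
    have hi := nI.2.2 i
    have hri := Fintype.mem_piFinset.1 hr i
    split_ifs with hJ
    · rw [if_pos hJ, Finset.mem_Icc] at hri
      exact mul_ne_zero (Nat.cast_ne_zero.2 (by omega)) (Nat.cast_ne_zero.2 (by omega))
    · exact Nat.cast_ne_zero.2 (by omega)
  have hJs : J.card ≤ s := by simpa using J.card_le_univ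
  obtain ⟨q, hq⟩ := Nat.exists_eq_add_of_le hJs
  have hfac : ((s + J.card).factorial : ℝ) ≠ 0 := by positivity
  simp only [cellValue, card_stablePerimeters]
  have hsq : s - J.card = q := by omega
  rw [hsq]
  have hpow : ((p.N : ℝ) / p.t) ^ (2 - 2 * ((s + 1 : ℕ) : ℤ) - ((s + J.card : ℕ) : ℤ)) =
      ((p.N : ℝ) / p.t) ^ (-4 * (s : ℤ)) * ((p.N : ℝ) / p.t) ^ q := by
    rw [← zpow_natCast, ← zpow_add₀ (div_ne_zero hN ht)]
    congr 1
    push_cast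
    have : (s : ℤ) = J.card + q := by exact_mod_cast hq
    linarith
  rw [hpow, div_pow, mul_pow]
  generalize ((p.N : ℝ) / p.t) ^ (-4 * (s : ℤ)) = A
  field_simp

/-- `-S(D)` is the sum over `k` of `1/k!` times the sum of `T_k` over the `k`-tuples of
eigenvalues. -/
lemma neg_action_diagonal (p : Params) (lam : Fin p.N → ℝ) :
    - action p (Matrix.diagonal fun i => (lam i : ℂ)) =
      ∑ k ∈ Finset.range (2 * p.𝔤), 1 / ((k + 1).factorial : ℝ) *
        ∑ i : Fin (k + 1) → Fin p.N,
          MvPolynomial.eval (fun r => lam (i r)) (interaction p (k + 1)) := by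
  rw [sum_interaction_eq, action, neg_add, neg_actionUnstable_diagonal,
    neg_actionStable_diagonal, add_assoc, ← map_add, boltzmann]

/-- The functions `T_k` are symmetric. -/
lemma rename_interaction (p : Params) (k : ℕ) (σ : Equiv.Perm (Fin k)) :
    MvPolynomial.rename σ (interaction p k) = interaction p k := by
  simp only [interaction, map_mul, map_sum, MvPolynomial.rename_C, MvPolynomial.rename_rename]
  congr 1
  exact Fintype.sum_equiv (Equiv.mulLeft σ) _ _ fun τ => rfl

/-- The chain rule for a polynomial along a curve. -/
lemma hasDerivAt_eval {k : ℕ} (P : MvPolynomial (Fin k) ℝ) {f : ℝ → Fin k → ℝ} {f' : Fin k → ℝ}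
    {t : ℝ} (hf : ∀ r, HasDerivAt (fun t => f t r) (f' r) t) :
    HasDerivAt (fun t => MvPolynomial.eval (f t) P)
      (∑ r, MvPolynomial.eval (f t) (MvPolynomial.pderiv r P) * f' r) t := by
  induction P using MvPolynomial.induction_on with
  | C c => simpa using hasDerivAt_const t c
  | add P Q hP hQ =>
    simpa only [map_add, add_mul, Finset.sum_add_distrib] using hP.fun_add hQ
  | mul_X P i hP =>
    have := hP.mul (hf i)
    simp only [map_mul, MvPolynomial.eval_X]
    refine this.congr_deriv ?_
    simp only [Derivation.leibniz, MvPolynomial.pderiv_X, map_add, smul_eq_mul, map_mul,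
      MvPolynomial.eval_X, add_mul, Finset.sum_add_distrib]
    rw [add_comm, Finset.sum_mul]
    congr 1
    · rw [Finset.sum_eq_single_of_mem i (Finset.mem_univ i)]
      · simp
      · intro j _ hj
        simp [hj.symm]
    · exact Finset.sum_congr rfl fun r _ => by ring

end Action

/-! ### The divergence theorem on the box -/

section Divergence

variable {N : ℕ} {a b : ℝ}

/-- Separating the `i`-th coordinate. -/
lemma measurePreserving_facePoint (i : Fin N) :
    ∃ e : (ℝ × ({j : Fin N // j ≠ i} → ℝ)) ≃ᵐ (Fin N → ℝ),
      (∀ q, e q = facePoint i q.1 q.2) ∧ MeasurePreserving e (volume.prod volume) volume := by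
  refine ⟨((MeasurableEquiv.funUnique {j : Fin N // j = i} ℝ).symm.prodCongr
    (MeasurableEquiv.refl _)).trans
      (MeasurableEquiv.piEquivPiSubtypeProd (fun _ : Fin N => ℝ) (· = i)).symm, ?_, ?_⟩
  · rintro ⟨t, y⟩
    rfl
  · have h := (volume_preserving_funUnique {j : Fin N // j = i} ℝ).symm
    have h' : MeasurePreserving (MeasurableEquiv.funUnique {j : Fin N // j = i} ℝ).symm
        volume (@volume _ (@MeasureSpace.pi _ (Subtype.fintype (· = i)) _ _)) := by convert h
    have h2 := (volume_preserving_piEquivPiSubtypeProd (fun _ : Fin N => ℝ) (· = i)).symm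
    rw [Measure.volume_eq_prod] at h2
    refine MeasurePreserving.trans ?_ h2
    exact h'.prod (MeasurePreserving.id (volume : Measure ({j : Fin N // j ≠ i} → ℝ)))

lemma update_facePoint (i : Fin N) (s t : ℝ) (y : {j : Fin N // j ≠ i} → ℝ) :
    Function.update (facePoint i t y) i s = facePoint i s y := by
  funext j
  by_cases h : j = i
  · subst h; simp [facePoint]
  · simp [facePoint, h]

lemma facePoint_mem_box_iff {i : Fin N} {c : ℝ} {y : {j : Fin N // j ≠ i} → ℝ} :
    facePoint i c y ∈ box N a b ↔ c ∈ Icc a b ∧ y ∈ Icc (fun _ => a) (fun _ => b) := by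
  constructor
  · intro h
    rw [mem_box] at h
    refine ⟨by simpa [facePoint] using h i, fun j => ?_, fun j => ?_⟩
    · have := (h j).1
      simpa [facePoint, j.2] using this
    · have := (h j).2
      simpa [facePoint, j.2] using this
  · exact fun h => facePoint_mem_box h.1 h.2

lemma setIntegral_box_partial (hab : a < b) (i : Fin N) {h g : (Fin N → ℝ) → ℂ}
    (hg : ContinuousOn g (box N a b)) (hh : ∀ lam ∈ box N a b,
      HasDerivAt (fun t => h (Function.update lam i t)) (g lam) (lam i)) :
    ∫ lam in box N a b, g lam =
      ∫ y in Icc (fun _ : {j : Fin N // j ≠ i} => a) (fun _ => b),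
        (h (facePoint i b y) - h (facePoint i a y)) := by
  obtain ⟨e, he, hmp⟩ := measurePreserving_facePoint i
  have hpre : e ⁻¹' (box N a b) =
      Icc a b ×ˢ Icc (fun _ : {j : Fin N // j ≠ i} => a) (fun _ => b) := by
    ext ⟨t, y⟩
    rw [mem_preimage, he, facePoint_mem_box_iff, mem_prod]
  have hint : IntegrableOn (fun q => g (e q)) (e ⁻¹' (box N a b)) (volume.prod volume) :=
    (hmp.integrableOn_comp_preimage e.measurableEmbedding).2
      (hg.integrableOn_compact (isCompact_box N a b))
  rw [← hmp.setIntegral_preimage_emb e.measurableEmbedding, hpre, ← Measure.prod_restrict]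
  rw [IntegrableOn, hpre, ← Measure.prod_restrict] at hint
  rw [integral_prod_symm _ hint]
  refine setIntegral_congr_fun measurableSet_Icc fun y hy => ?_
  simp only [he]
  rw [integral_Icc_eq_integral_Ioc, ← intervalIntegral.integral_of_le hab.le,
    intervalIntegral.integral_eq_sub_of_hasDerivAt (f := fun t => h (facePoint i t y))]
  · intro t ht
    rw [uIcc_of_le hab.le] at ht
    have := hh (facePoint i t y) (facePoint_mem_box ht hy)
    simp only [update_facePoint] at this
    simpa [facePoint] using this
  · refine ContinuousOn.intervalIntegrable ?_
    rw [uIcc_of_le hab.le]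
    refine hg.comp (Continuous.continuousOn ?_) fun t ht => facePoint_mem_box ht hy
    refine continuous_pi fun j => ?_
    unfold facePoint
    split_ifs <;> fun_prop

lemma boundaryFlux_eq (hab : a < b) (x : ℂ) {Ψ : (Fin N → ℝ) → ℂ}
    {g : Fin N → (Fin N → ℝ) → ℂ} (hΨ : ContinuousOn Ψ (box N a b))
    (hg : ∀ i, ContinuousOn (g i) (box N a b)) (hh : ∀ i, ∀ lam ∈ box N a b,
      HasDerivAt (fun t : ℝ => Ψ (Function.update lam i t) / (x - (t : ℂ))) (g i lam) (lam i)) :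
    boundaryFlux a b x Ψ = ∫ lam in box N a b, ∑ i, g i lam := by
  rw [integral_finsetSum _ fun i _ => (hg i).integrableOn_compact (isCompact_box N a b),
    boundaryFlux]
  refine Finset.sum_congr rfl fun i _ => ?_
  rw [setIntegral_box_partial hab i (h := fun lam => Ψ lam / (x - (lam i : ℂ))) (hg i)
    fun lam hl => by simpa using hh i lam hl]
  have hface : ∀ c ∈ Icc a b, IntegrableOn (fun y => Ψ (facePoint i c y) / (x - (c : ℂ)))
      (Icc (fun _ : {j : Fin N // j ≠ i} => a) (fun _ => b)) := fun c hc =>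
    ((hΨ.comp (continuous_facePoint i c).continuousOn fun y hy =>
      facePoint_mem_box hc hy).div_const _).integrableOn_compact isCompact_Icc
  have hi : ∀ c y, facePoint i c y i = c := fun c y => by simp [facePoint]
  simp only [faceIntegral, hi]
  rw [integral_sub (hface b (right_mem_Icc.2 hab.le)) (hface a (left_mem_Icc.2 hab.le))]

end Divergence

/-! ### Derivatives of the density -/

section Density

variable {N : ℕ}

/-- The pairs `i < j` of indices. -/
def pairs (N : ℕ) : Finset (Σ _ : Fin N, Fin N) := Finset.univ.sigma fun i => Finset.Ioi i

/-- The Vandermonde product. -/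
def vandermonde (lam : Fin N → ℝ) : ℝ := ∏ q ∈ pairs N, (lam q.2 - lam q.1)

/-- The partial derivatives of the Vandermonde product. -/
def vandermondeDeriv (l : Fin N) (lam : Fin N → ℝ) : ℝ :=
  ∑ q ∈ pairs N, (∏ q' ∈ (pairs N).erase q, (lam q'.2 - lam q'.1)) *
    ((if q.2 = l then 1 else 0) - if q.1 = l then 1 else 0)

lemma hasDerivAt_update_apply (lam : Fin N → ℝ) (l j : Fin N) :
    HasDerivAt (fun t => Function.update lam l t j) (if j = l then 1 else 0) (lam l) := by
  have := hasDerivAt_pi.1 (hasDerivAt_update lam l (lam l)) j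
  simpa [Pi.single_apply] using this

lemma hasDerivAt_vandermonde (l : Fin N) (lam : Fin N → ℝ) :
    HasDerivAt (fun t => vandermonde (Function.update lam l t)) (vandermondeDeriv l lam)
      (lam l) := by
  have := HasDerivAt.fun_finsetProd (u := pairs N)
    (f := fun q t => Function.update lam l t q.2 - Function.update lam l t q.1)
    (x := lam l) fun q _ =>
      (hasDerivAt_update_apply lam l q.2).sub (hasDerivAt_update_apply lam l q.1)
  simpa [vandermonde, vandermondeDeriv] using this

lemma density_eq (p : Params) (lam : Fin p.N → ℝ) :
    density p lam = vandermonde lam ^ 2 *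
      Real.exp (- action p (Matrix.diagonal fun i => (lam i : ℂ))) := by
  rw [density, vandermonde, pairs, Finset.prod_sigma]
  congr 1
  simp_rw [← Finset.abs_prod]
  rw [sq_abs]

/-- The partial derivatives of `-S(D)`. -/
def driftDeriv (p : Params) (l : Fin p.N) (lam : Fin p.N → ℝ) : ℝ :=
  ∑ k ∈ Finset.range (2 * p.𝔤), 1 / ((k + 1).factorial : ℝ) *
    ∑ i : Fin (k + 1) → Fin p.N, ∑ r, MvPolynomial.eval (fun r => lam (i r))
      (MvPolynomial.pderiv r (interaction p (k + 1))) * if i r = l then 1 else 0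

lemma hasDerivAt_neg_action (p : Params) (l : Fin p.N) (lam : Fin p.N → ℝ) :
    HasDerivAt (fun t => - action p (Matrix.diagonal fun i => (Function.update lam l t i : ℂ)))
      (driftDeriv p l lam) (lam l) := by
  simp_rw [neg_action_diagonal]
  refine HasDerivAt.fun_sum fun k _ => HasDerivAt.const_mul _ (HasDerivAt.fun_sum fun i _ => ?_)
  have := hasDerivAt_eval (interaction p (k + 1))
    (f := fun t r => Function.update lam l t (i r)) (t := lam l)
    fun r => hasDerivAt_update_apply lam l (i r)
  simpa using this

/-- The partial derivatives of the density. -/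
def densityDeriv (p : Params) (l : Fin p.N) (lam : Fin p.N → ℝ) : ℝ :=
  2 * vandermonde lam * vandermondeDeriv l lam *
      Real.exp (- action p (Matrix.diagonal fun i => (lam i : ℂ))) +
    density p lam * driftDeriv p l lam

lemma hasDerivAt_density (p : Params) (l : Fin p.N) (lam : Fin p.N → ℝ) :
    HasDerivAt (fun t => density p (Function.update lam l t)) (densityDeriv p l lam) (lam l) := by
  simp_rw [density_eq]
  refine (((hasDerivAt_vandermonde l lam).fun_pow 2).fun_mul
    (hasDerivAt_neg_action p l lam).exp).congr_deriv ?_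
  simp only [Function.update_eq_self, densityDeriv, density_eq]
  ring

lemma continuous_eval_comp {k : ℕ} (P : MvPolynomial (Fin k) ℝ) (i : Fin k → Fin N) :
    Continuous fun lam : Fin N → ℝ => MvPolynomial.eval (fun r => lam (i r)) P :=
  (MvPolynomial.continuous_eval P).comp (by fun_prop)

lemma continuous_vandermonde : Continuous (vandermonde (N := N)) := by
  unfold vandermonde; fun_prop

lemma continuous_neg_action (p : Params) : Continuous fun lam : Fin p.N → ℝ =>
    - action p (Matrix.diagonal fun i => (lam i : ℂ)) := by
  simp_rw [neg_action_diagonal]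
  exact continuous_finsetSum _ fun k _ => continuous_const.mul
    (continuous_finsetSum _ fun i _ => continuous_eval_comp _ _)

lemma continuous_density (p : Params) : Continuous (density p) := by
  rw [show density p = _ from funext (density_eq p)]
  exact (continuous_vandermonde.pow 2).mul (Real.continuous_exp.comp (continuous_neg_action p))

lemma continuous_driftDeriv (p : Params) (l : Fin p.N) : Continuous (driftDeriv p l) := by
  unfold driftDeriv
  exact continuous_finsetSum _ fun k _ => continuous_const.mul
    (continuous_finsetSum _ fun i _ => continuous_finsetSum _ fun r _ =>
      (continuous_eval_comp _ _).mul continuous_const)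

lemma continuous_densityDeriv (p : Params) (l : Fin p.N) : Continuous (densityDeriv p l) := by
  have h1 : Continuous (vandermondeDeriv l (N := p.N)) := by unfold vandermondeDeriv; fun_prop
  exact (((continuous_const.mul continuous_vandermonde).mul h1).mul
    (Real.continuous_exp.comp (continuous_neg_action p))).add
      ((continuous_density p).mul (continuous_driftDeriv p l))

lemma sum_sq_eq_add_sum_pairs (f : Fin N → ℂ) :
    (∑ i, f i) ^ 2 = ∑ i, f i ^ 2 + 2 * ∑ q ∈ pairs N, f q.1 * f q.2 := by
  have h := Finset.sum_sum_Ioi_add_eq_sum_sum_off_diag fun i j : Fin N => f i * f j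
  have h2 : 2 * ∑ q ∈ pairs N, f q.1 * f q.2 =
      ∑ i, ∑ j ∈ Finset.Ioi i, (f j * f i + f i * f j) := by
    rw [pairs, Finset.sum_sigma, Finset.mul_sum]
    refine Finset.sum_congr rfl fun i _ => ?_
    rw [Finset.mul_sum]
    exact Finset.sum_congr rfl fun j _ => by ring
  rw [h2, h, ← Finset.sum_add_distrib, sq, Finset.sum_mul_sum, Finset.sum_comm]
  refine Finset.sum_congr rfl fun i _ => ?_
  rw [← Finset.add_sum_erase _ _ (Finset.mem_univ i), sq]
  congr 1
  refine Finset.sum_congr ?_ fun _ _ => rfl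
  ext j; simp

/-- The contribution of the repulsion of the eigenvalues: the double poles combine with the
Vandermonde factor to the square of the resolvent trace. -/
lemma sum_vandermondeDeriv (lam : Fin N → ℝ) (x : ℂ) (hx : ∀ i, x - (lam i : ℂ) ≠ 0) :
    ∑ l, ((2 * vandermonde lam * vandermondeDeriv l lam : ℝ) : ℂ) / (x - lam l) +
      ∑ l, ((vandermonde lam ^ 2 : ℝ) : ℂ) / (x - lam l) ^ 2 =
    ((vandermonde lam ^ 2 : ℝ) : ℂ) * resolventTrace x lam ^ 2 := by
  have h1 : ∑ l, ((2 * vandermonde lam * vandermondeDeriv l lam : ℝ) : ℂ) / (x - lam l) =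
      ∑ q ∈ pairs N, 2 * (vandermonde lam : ℂ) *
        ((∏ q' ∈ (pairs N).erase q, (lam q'.2 - lam q'.1) : ℝ) : ℂ) *
          (1 / (x - lam q.2) - 1 / (x - lam q.1)) := by
    have : ∀ l, ((2 * vandermonde lam * vandermondeDeriv l lam : ℝ) : ℂ) / (x - lam l) =
        ∑ q ∈ pairs N, 2 * (vandermonde lam : ℂ) *
          ((∏ q' ∈ (pairs N).erase q, (lam q'.2 - lam q'.1) : ℝ) : ℂ) *
          ((if q.2 = l then 1 / (x - lam l) else 0) -
            if q.1 = l then 1 / (x - lam l) else 0) := by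
      intro l
      rw [vandermondeDeriv, Complex.ofReal_mul, Complex.ofReal_sum, Finset.mul_sum,
        Finset.sum_div]
      refine Finset.sum_congr rfl fun q _ => ?_
      split_ifs <;> push_cast <;> ring
    simp_rw [this]
    rw [Finset.sum_comm]
    refine Finset.sum_congr rfl fun q _ => ?_
    rw [← Finset.mul_sum, Finset.sum_sub_distrib]
    simp
  have h2 : ∀ q ∈ pairs N, 2 * (vandermonde lam : ℂ) *
        ((∏ q' ∈ (pairs N).erase q, (lam q'.2 - lam q'.1) : ℝ) : ℂ) *
          (1 / (x - lam q.2) - 1 / (x - lam q.1)) =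
      ((vandermonde lam ^ 2 : ℝ) : ℂ) * (2 * (1 / (x - lam q.1) * (1 / (x - lam q.2)))) := by
    intro q hq
    have e : vandermonde lam = (lam q.2 - lam q.1) *
        ∏ q' ∈ (pairs N).erase q, (lam q'.2 - lam q'.1) :=
      (Finset.mul_prod_erase _ _ hq).symm
    have e' : (1 / (x - lam q.2) - 1 / (x - lam q.1)) =
        ((lam q.2 : ℂ) - lam q.1) * (1 / (x - lam q.1) * (1 / (x - lam q.2))) := by
      have := hx q.1
      have := hx q.2
      field_simp
      ring
    have e'' : ((vandermonde lam ^ 2 : ℝ) : ℂ) = (vandermonde lam : ℂ) *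
        (((lam q.2 : ℂ) - lam q.1) *
          ((∏ q' ∈ (pairs N).erase q, (lam q'.2 - lam q'.1) : ℝ) : ℂ)) := by
      rw [sq, Complex.ofReal_mul]
      congr 1
      conv_lhs => rw [e]
      push_cast
      ring
    rw [e', e'']
    ring
  rw [h1, Finset.sum_congr rfl h2, resolventTrace, sum_sq_eq_add_sum_pairs, ← Finset.mul_sum,
    ← Finset.mul_sum]
  simp_rw [div_pow, one_pow]
  rw [mul_add, add_comm]
  congr 1
  rw [Finset.mul_sum]
  exact Finset.sum_congr rfl fun l _ => by ring

/-- The linear statistic through which the interactions enter the loop equation, which is the sum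
`∑_i ∂_i(-S(D)) / (x - λ_i)` by `sum_driftDeriv`. -/
def driftStatistic (p : Params) (x : ℂ) (lam : Fin p.N → ℝ) : ℂ :=
  ∑ k ∈ Finset.range (2 * p.𝔤), ∑ i : Fin (k + 1) → Fin p.N,
    MvPolynomial.aeval (fun r => (lam (i r) : ℂ))
      (MvPolynomial.pderiv 0 (interaction p (k + 1))) *
        (1 / ((k.factorial : ℂ) * (x - lam (i 0))))

lemma aeval_ofReal {k : ℕ} (P : MvPolynomial (Fin k) ℝ) (v : Fin k → ℝ) :
    MvPolynomial.aeval (fun r => (v r : ℂ)) P = ((MvPolynomial.eval v P : ℝ) : ℂ) := by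
  have := MvPolynomial.aeval_algebraMap_apply ℂ v P
  simpa [MvPolynomial.aeval_eq_eval, Function.comp_def] using this

/-- By symmetry of `T_k`, its `k` partial derivatives contribute equally. -/
lemma sum_driftDeriv (p : Params) (x : ℂ) (lam : Fin p.N → ℝ) :
    ∑ l, (driftDeriv p l lam : ℂ) / (x - lam l) = driftStatistic p x lam := by
  have h1 : ∀ k, ∀ r : Fin (k + 1), ∑ i : Fin (k + 1) → Fin p.N,
      MvPolynomial.aeval (fun r => (lam (i r) : ℂ))
        (MvPolynomial.pderiv r (interaction p (k + 1))) / (x - lam (i r)) =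
      ∑ i : Fin (k + 1) → Fin p.N, MvPolynomial.aeval (fun r => (lam (i r) : ℂ))
        (MvPolynomial.pderiv 0 (interaction p (k + 1))) / (x - lam (i 0)) := by
    intro k r
    have e := MvPolynomial.pderiv_rename (Equiv.swap 0 r).injective 0 (interaction p (k + 1))
    rw [rename_interaction, Equiv.swap_apply_left] at e
    rw [e]
    simp_rw [MvPolynomial.aeval_rename]
    refine Fintype.sum_equiv (Equiv.arrowCongr (Equiv.swap 0 r) (Equiv.refl _)) _ _ fun i => ?_
    have hr : ((Equiv.swap 0 r).arrowCongr (Equiv.refl (Fin p.N))) i 0 = i r := by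
      simp [Equiv.arrowCongr]
    rw [hr]
    congr 2
  simp_rw [driftDeriv, driftStatistic, Complex.ofReal_sum, Finset.sum_div]
  rw [Finset.sum_comm]
  refine Finset.sum_congr rfl fun k _ => ?_
  have h2 : ∀ l, ((1 / ((k + 1).factorial : ℝ) * ∑ i : Fin (k + 1) → Fin p.N, ∑ r,
      MvPolynomial.eval (fun r => lam (i r)) (MvPolynomial.pderiv r (interaction p (k + 1))) *
        (if i r = l then 1 else 0) : ℝ) : ℂ) / (x - lam l) =
      1 / ((k + 1).factorial : ℂ) * ∑ r, ∑ i : Fin (k + 1) → Fin p.N, if i r = l then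
        MvPolynomial.aeval (fun r => (lam (i r) : ℂ))
          (MvPolynomial.pderiv r (interaction p (k + 1))) / (x - lam l) else 0 := by
    intro l
    rw [Finset.sum_comm]
    push_cast
    rw [mul_div_assoc, Finset.sum_div]
    congr 1
    refine Finset.sum_congr rfl fun r _ => ?_
    rw [Finset.sum_div]
    refine Finset.sum_congr rfl fun i _ => ?_
    rw [aeval_ofReal]
    split_ifs <;> simp
  simp_rw [h2]
  rw [← Finset.mul_sum, Finset.sum_comm]
  have h3 : ∀ r : Fin (k + 1), ∑ l, ∑ i : Fin (k + 1) → Fin p.N, (if i r = l then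
        MvPolynomial.aeval (fun r => (lam (i r) : ℂ))
          (MvPolynomial.pderiv r (interaction p (k + 1))) / (x - lam l) else 0) =
      ∑ i : Fin (k + 1) → Fin p.N, MvPolynomial.aeval (fun r => (lam (i r) : ℂ))
        (MvPolynomial.pderiv 0 (interaction p (k + 1))) / (x - lam (i 0)) := by
    intro r
    rw [Finset.sum_comm, ← h1 k r]
    simp
  rw [Finset.sum_congr rfl fun r _ => h3 r, Finset.sum_const, Finset.card_univ, Fintype.card_fin,
    nsmul_eq_mul, ← mul_assoc, Finset.mul_sum]
  refine Finset.sum_congr rfl fun i _ => ?_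
  rw [Nat.factorial_succ]
  have hk : (k.factorial : ℂ) ≠ 0 := Nat.cast_ne_zero.2 (Nat.factorial_ne_zero k)
  have hk1 : ((k : ℂ) + 1) ≠ 0 := by exact_mod_cast Nat.succ_ne_zero k
  push_cast
  field_simp

/-! ### The loop equation for moments -/

variable {m : ℕ} {a b : ℝ}

lemma hasDerivAt_resolventTrace {z : ℂ} (lam : Fin N → ℝ) (hz : ∀ i, z - (lam i : ℂ) ≠ 0)
    (l : Fin N) :
    HasDerivAt (fun t => resolventTrace z (Function.update lam l t)) (1 / (z - lam l) ^ 2)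
      (lam l) := by
  unfold resolventTrace
  have h : ∀ i, HasDerivAt (fun t => 1 / (z - (Function.update lam l t i : ℂ)))
      (if i = l then 1 / (z - lam l) ^ 2 else 0) (lam l) := by
    intro i
    have h1 := ((hasDerivAt_update_apply lam l i).ofReal_comp.const_sub z).fun_inv
      (by simpa using hz i)
    simp_rw [one_div]
    refine h1.congr_deriv ?_
    split_ifs with hi
    · subst hi; simp
    · simp
  refine (HasDerivAt.fun_sum fun i (_ : i ∈ Finset.univ) => h i).congr_deriv ?_
  simp

/-- The linear statistic `∑_i 1 / ((x - λ_i) (y - λ_i)²)`. -/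
def mixedStatistic (x y : ℂ) (lam : Fin N → ℝ) : ℂ :=
  ∑ i, 1 / ((x - (lam i : ℂ)) * (y - lam i) ^ 2)

/-- The divergence theorem for the vector field with components
`Ψ ∏_{j ∈ S} X_{z_j} / (x - λ_i)`. -/
lemma boundaryFlux_moment (p : Params) (hab : a < b) {x : ℂ} {z : Fin m → ℂ} (hx : x ∉ cut a b)
    (hz : ∀ j, z j ∉ cut a b) (S : Finset (Fin m)) :
    boundaryFlux a b x (fun lam => (∏ j ∈ S, resolventTrace (z j) lam) * (density p lam : ℂ)) =
      ∫ lam in box p.N a b, ((∏ j ∈ S, resolventTrace (z j) lam) *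
          (resolventTrace x lam ^ 2 + driftStatistic p x lam) +
        ∑ j ∈ S, (∏ i ∈ S.erase j, resolventTrace (z i) lam) * mixedStatistic x (z j) lam) *
          (density p lam : ℂ) := by
  have hdc : Continuous fun lam => (density p lam : ℂ) :=
    Complex.continuous_ofReal.comp (continuous_density p)
  have hdd : ∀ l, Continuous fun lam => (densityDeriv p l lam : ℂ) := fun l =>
    Complex.continuous_ofReal.comp (continuous_densityDeriv p l)
  have hX : ∀ S : Finset (Fin m), ContinuousOn
      (fun lam : Fin p.N → ℝ => ∏ j ∈ S, resolventTrace (z j) lam) (box p.N a b) := fun S =>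
    continuousOn_finsetProd _ fun j _ => continuousOn_resolventTrace_box (hz j)
  have hne : ∀ {y : ℂ}, y ∉ cut a b → ∀ lam ∈ box p.N a b, ∀ i, y - (lam i : ℂ) ≠ 0 :=
    fun hy lam hl i => sub_ofReal_ne_zero hy (mem_box.1 hl i)
  let g : Fin p.N → (Fin p.N → ℝ) → ℂ := fun l lam =>
    ((∑ j ∈ S, (∏ i ∈ S.erase j, resolventTrace (z i) lam) * (1 / (z j - lam l) ^ 2)) *
        (density p lam : ℂ) +
      (∏ j ∈ S, resolventTrace (z j) lam) * (densityDeriv p l lam : ℂ)) / (x - lam l) +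
      (∏ j ∈ S, resolventTrace (z j) lam) * (density p lam : ℂ) / (x - lam l) ^ 2
  rw [boundaryFlux_eq hab x (g := g) (Ψ := fun lam =>
    (∏ j ∈ S, resolventTrace (z j) lam) * (density p lam : ℂ)) ((hX S).mul hdc.continuousOn)]
  · refine setIntegral_congr_fun (isCompact_box _ _ _).measurableSet fun lam hl => ?_
    have hV := sum_vandermondeDeriv lam x (hne hx lam hl)
    have hD := sum_driftDeriv p x lam
    have e1 : ∑ l, (densityDeriv p l lam : ℂ) / (x - lam l) +
        ∑ l, (density p lam : ℂ) / (x - lam l) ^ 2 =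
        (density p lam : ℂ) * (resolventTrace x lam ^ 2 + driftStatistic p x lam) := by
      set E : ℝ := Real.exp (- action p (Matrix.diagonal fun i => (lam i : ℂ)))
      have h1 : ∀ l, (densityDeriv p l lam : ℂ) / (x - lam l) =
          ((2 * vandermonde lam * vandermondeDeriv l lam : ℝ) : ℂ) / (x - lam l) * (E : ℂ) +
            (density p lam : ℂ) * ((driftDeriv p l lam : ℂ) / (x - lam l)) := by
        intro l
        rw [densityDeriv, Complex.ofReal_add, Complex.ofReal_mul _ E,
          Complex.ofReal_mul (density p lam)]
        ring
      have h2 : ∀ l, (density p lam : ℂ) / (x - lam l) ^ 2 =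
          ((vandermonde lam ^ 2 : ℝ) : ℂ) / (x - lam l) ^ 2 * (E : ℂ) := by
        intro l
        rw [density_eq, Complex.ofReal_mul]
        ring
      simp_rw [h1, h2]
      rw [Finset.sum_add_distrib, ← Finset.sum_mul, ← Finset.sum_mul, ← Finset.mul_sum, hD,
        add_right_comm, ← add_mul, hV, density_eq, Complex.ofReal_mul]
      ring
    have e2 : ∀ l, g l lam = (∏ j ∈ S, resolventTrace (z j) lam) *
        ((densityDeriv p l lam : ℂ) / (x - lam l) + (density p lam : ℂ) / (x - lam l) ^ 2) +
        ∑ j ∈ S, (∏ i ∈ S.erase j, resolventTrace (z i) lam) * (density p lam : ℂ) *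
          (1 / ((x - lam l) * (z j - lam l) ^ 2)) := by
      intro l
      have : ∀ j, (∏ i ∈ S.erase j, resolventTrace (z i) lam) * (density p lam : ℂ) *
          (1 / ((x - lam l) * (z j - lam l) ^ 2)) =
          (∏ i ∈ S.erase j, resolventTrace (z i) lam) * (1 / (z j - lam l) ^ 2) *
          (density p lam : ℂ) / (x - lam l) := by
        intro j
        rw [one_div, mul_inv]
        ring
      simp_rw [this, ← Finset.sum_div, ← Finset.sum_mul]
      simp only [g]
      ring
    simp_rw [e2]
    rw [Finset.sum_add_distrib, ← Finset.mul_sum, Finset.sum_add_distrib, e1, Finset.sum_comm]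
    simp_rw [← Finset.mul_sum, mixedStatistic, add_mul, Finset.sum_mul]
    congr 1
    · ring
    · exact Finset.sum_congr rfl fun j _ => by ring
  · intro l
    have hx' : ContinuousOn (fun lam : Fin p.N → ℝ => x - (lam l : ℂ)) (box p.N a b) := by fun_prop
    refine ContinuousOn.add (ContinuousOn.div (ContinuousOn.add (ContinuousOn.mul
      (continuousOn_finsetSum _ fun j _ => (hX _).mul (ContinuousOn.div continuousOn_const
        (by fun_prop) fun lam hl => pow_ne_zero 2 (hne (hz j) lam hl l)))
        hdc.continuousOn) ((hX S).mul (hdd l).continuousOn)) hx' fun lam hl => hne hx lam hl l)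
      (ContinuousOn.div ((hX S).mul hdc.continuousOn) (hx'.pow 2)
        fun lam hl => pow_ne_zero 2 (hne hx lam hl l))
  · intro l lam hl
    have h1 := HasDerivAt.fun_finsetProd (u := S) (x := lam l)
      (f := fun j t => resolventTrace (z j) (Function.update lam l t))
      fun j _ => hasDerivAt_resolventTrace lam (hne (hz j) lam hl) l
    have h2 := (hasDerivAt_density p l lam).ofReal_comp
    have h3 : HasDerivAt (fun t : ℝ => x - (t : ℂ)) (-1) (lam l) := by
      simpa using ((hasDerivAt_id (lam l)).ofReal_comp).const_sub x
    have hxl := hne hx lam hl l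
    refine ((h1.fun_mul h2).fun_div h3 hxl).congr_deriv ?_
    simp only [Function.update_eq_self, smul_eq_mul, g]
    field_simp
    ring

end Density

/-! ### Moments and cumulants of the eigenvalue measure -/

section Moments

variable (p : Params) {a b : ℝ}

lemma density_nonneg (lam : Fin p.N → ℝ) : 0 ≤ density p lam := by
  unfold density; positivity

lemma integrableOn_density (a b : ℝ) : IntegrableOn (density p) (box p.N a b) :=
  (continuous_density p).continuousOn.integrableOn_compact (isCompact_box _ _ _)

/-- The partition function is positive: the density is nonnegative, continuous, and positive at a
configuration of distinct points inside the box. -/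
lemma setIntegral_density_pos (hab : a < b) : 0 < ∫ lam in box p.N a b, density p lam := by
  rw [setIntegral_pos_iff_support_of_nonneg_ae
    (Filter.Eventually.of_forall fun lam => density_nonneg p lam) (integrableOn_density p a b)]
  have hopen : IsOpen (Function.support (density p) ∩ univ.pi fun _ => Ioo a b) :=
    ((continuous_density p).isOpen_support).inter
      (isOpen_set_pi finite_univ fun _ _ => isOpen_Ioo)
  have hsub : (Function.support (density p) ∩ univ.pi fun _ => Ioo a b) ⊆
      Function.support (density p) ∩ box p.N a b := fun lam hl =>
    ⟨hl.1, mem_box.2 fun i => Ioo_subset_Icc_self (hl.2 i trivial)⟩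
  refine (hopen.measure_pos volume ?_).trans_le (measure_mono hsub)
  -- equally spaced eigenvalues are distinct
  refine ⟨fun i => a + (b - a) * ((i + 1 : ℝ) / (p.N + 1)), ?_, fun i _ => ?_⟩
  · rw [Function.mem_support, density_eq]
    refine mul_ne_zero (pow_ne_zero 2 (Finset.prod_ne_zero_iff.2 fun q hq => ?_))
      (Real.exp_pos _).ne'
    have hlt : q.1 < q.2 := by simpa [pairs] using hq
    have hlt' : ((q.1 : ℕ) : ℝ) < ((q.2 : ℕ) : ℝ) := by exact_mod_cast hlt
    have h1 : 0 < b - a := sub_pos.2 hab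
    have h2 : (0 : ℝ) < p.N + 1 := by positivity
    have h3 : (b - a) * (((q.1 : ℕ) + 1 : ℝ) / (p.N + 1)) <
        (b - a) * (((q.2 : ℕ) + 1 : ℝ) / (p.N + 1)) := by gcongr
    simp only
    linarith
  · have h1 : 0 < b - a := sub_pos.2 hab
    have h2 : (0 : ℝ) < p.N + 1 := by positivity
    have h3 : ((i : ℕ) : ℝ) < p.N := by exact_mod_cast i.2
    have h4 : 0 < ((i : ℕ) + 1 : ℝ) / (p.N + 1) := by positivity
    have h5 : ((i : ℕ) + 1 : ℝ) / (p.N + 1) < 1 := by rw [div_lt_one h2]; linarith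
    constructor <;> nlinarith

/-- The partition function `∫_Ω Ψ`. -/
def partitionFunction (p : Params) (a b : ℝ) : ℂ := ∫ lam in box p.N a b, (density p lam : ℂ)

lemma partitionFunction_eq (a b : ℝ) : partitionFunction p a b =
    ((∫ lam in box p.N a b, density p lam : ℝ) : ℂ) := integral_ofReal

lemma partitionFunction_ne_zero (hab : a < b) : partitionFunction p a b ≠ 0 := by
  rw [partitionFunction_eq]
  exact_mod_cast (setIntegral_density_pos p hab).ne'

lemma integral_probMeasure (a b : ℝ) (f : (Fin p.N → ℝ) → ℂ) :
    ∫ lam, f lam ∂(probMeasure p a b) =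
      (partitionFunction p a b)⁻¹ * ∫ lam in box p.N a b, f lam * (density p lam : ℂ) := by
  have h1 : rhoMeasure p a b univ =
      ENNReal.ofReal (∫ lam in box p.N a b, density p lam) := by
    rw [rhoMeasure, withDensity_apply _ MeasurableSet.univ, Measure.restrict_univ,
      ofReal_integral_eq_lintegral_ofReal (integrableOn_density p a b)
        (Filter.Eventually.of_forall fun lam => density_nonneg p lam)]
  have h2 : 0 ≤ ∫ lam in box p.N a b, density p lam :=
    integral_nonneg fun lam => density_nonneg p lam
  rw [probMeasure, integral_smul_measure, h1, ENNReal.toReal_inv, ENNReal.toReal_ofReal h2,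
    rhoMeasure, integral_withDensity_eq_integral_toReal_smul
      (f := fun lam => ENNReal.ofReal (density p lam))
      (ENNReal.measurable_ofReal.comp (continuous_density p).measurable)
      (Filter.Eventually.of_forall fun _ => ENNReal.ofReal_lt_top), partitionFunction_eq]
  rw [Complex.real_smul, Complex.ofReal_inv]
  congr 1
  refine integral_congr_ae (Filter.Eventually.of_forall fun lam => ?_)
  simp only [ENNReal.toReal_ofReal (density_nonneg p lam), Complex.real_smul]
  ring

lemma disconnected_empty (hab : a < b) {ι : Type} (z : ι → ℂ) :
    disconnected p a b z ∅ = 1 := by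
  simp only [disconnected, Finset.prod_empty]
  rw [integral_probMeasure]
  simp only [one_mul]
  exact inv_mul_cancel₀ (partitionFunction_ne_zero p hab)

lemma disconnected_map {ι κ : Type} (f : ι ↪ κ) (z : κ → ℂ) (B : Finset ι) :
    disconnected p a b (fun i => z (f i)) B = disconnected p a b z (B.map f) := by
  simp [disconnected]

/-- The connected correlators are cumulants over subsets of a common index type. -/
lemma W_eq_cumulant {ι κ : Type} [Fintype ι] [DecidableEq ι] [DecidableEq κ] (f : ι ↪ κ)
    (z : κ → ℂ) : W p a b (fun i => z (f i)) =
      cumulant (disconnected p a b z) (Finset.univ.map f) := by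
  rw [cumulant_map, W, cumulant]
  simp_rw [← disconnected_map]
  exact sum_finpartition_eq Finset.univ fun P => (-1) ^ (P.card - 1) *
    ((P.card - 1).factorial : ℂ) * ∏ B ∈ P, disconnected p a b (fun i => z (f i)) B

lemma W_sumElim_eq_cumulant {ι κ ρ σ : Type} [Fintype ι] [DecidableEq ι] [DecidableEq κ]
    [Fintype ρ] [DecidableEq ρ] [DecidableEq σ] (f : ρ ↪ σ) (g : ι ↪ κ) (ξ : σ → ℂ) (z : κ → ℂ) :
    W p a b (Sum.elim (fun r => ξ (f r)) (fun j => z (g j))) =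
      cumulant (disconnected p a b (Sum.elim ξ z))
        ((Finset.univ.map f).disjSum (Finset.univ.map g)) := by
  have h : (Sum.elim (fun r => ξ (f r)) (fun j => z (g j))) =
      fun i => Sum.elim ξ z (Function.Embedding.sumMap f g i) := by
    funext i
    rcases i with i | i <;> rfl
  rw [h, W_eq_cumulant]
  congr 1
  ext (i | i) <;> simp

/-! ### Joint cumulants of the resolvent traces -/

variable {m : ℕ}

/-- The cumulants of the resolvent traces at `ξ` and `z`. -/
def jointCumulant (p : Params) (a b : ℝ) (z : Fin m → ℂ) {k : ℕ} (ξ : Fin k → ℂ)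
    (A : Finset (Fin k)) (T : Finset (Fin m)) : ℂ :=
  cumulant (disconnected p a b (Sum.elim ξ z)) (A.disjSum T)

lemma disconnected_sumElim (z : Fin m → ℂ) {k : ℕ} (ξ : Fin k → ℂ) (A : Finset (Fin k))
    (T : Finset (Fin m)) : disconnected p a b (Sum.elim ξ z) (A.disjSum T) =
      (partitionFunction p a b)⁻¹ * ∫ lam in box p.N a b,
        (∏ r ∈ A, resolventTrace (ξ r) lam) * (∏ j ∈ T, resolventTrace (z j) lam) *
          (density p lam : ℂ) := by
  rw [disconnected, integral_probMeasure]
  simp [Finset.prod_disjSum]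

/-- The unnormalized moments of the resolvent traces at `z`. -/
def weightedMoment (p : Params) (a b : ℝ) (z : Fin m → ℂ) (T : Finset (Fin m)) : ℂ :=
  ∫ lam in box p.N a b, (∏ j ∈ T, resolventTrace (z j) lam) * (density p lam : ℂ)

lemma blockSum_jointCumulant (hab : a < b) (z : Fin m → ℂ) {k : ℕ} (ξ : Fin k → ℂ)
    (T : Finset (Fin m)) :
    ∑ V ∈ T.powerset, blockSum (jointCumulant p a b z ξ) Finset.univ V *
        weightedMoment p a b z (T \ V) =
      ∫ lam in box p.N a b, (∏ r, resolventTrace (ξ r) lam) *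
        (∏ j ∈ T, resolventTrace (z j) lam) * (density p lam : ℂ) := by
  have h := blockSum_convolution (jointCumulant p a b z ξ)
    (fun A T => disconnected p a b (Sum.elim ξ z) (A.disjSum T))
    (fun A i hi T => cumulant_disjSum_recursion _ (disconnected_empty p hab _) A i hi T)
    Finset.univ T
  simp_rw [disconnected_sumElim] at h
  simp only [Finset.prod_empty, one_mul] at h
  have hZ := partitionFunction_ne_zero p hab
  rw [← mul_right_inj' (inv_ne_zero hZ), ← h, Finset.mul_sum]
  refine Finset.sum_congr rfl fun V _ => ?_
  rw [weightedMoment]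
  ring

lemma continuousOn_disconnected {ε : ℝ} {γ : ℝ → ℂ} (hγ : IsContourAround a b ε γ)
    {z : Fin m → ℂ} (hz : ∀ j, z j ∉ cut a b) {k : ℕ} (S : Finset (Fin k ⊕ Fin m)) :
    ContinuousOn (fun ξ => disconnected p a b (Sum.elim ξ z) S) (traceCube γ k) := by
  simp only [disconnected, integral_probMeasure]
  refine continuousOn_const.mul (continuousOn_setIntegral (hγ.isCompact_traceCube k)
    (isCompact_box p.N a b) (isCompact_box p.N a b).measurableSet
    (isCompact_box p.N a b).measure_lt_top.ne ?_)
  have hd : Continuous fun lam => (density p lam : ℂ) :=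
    Complex.continuous_ofReal.comp (continuous_density p)
  refine ContinuousOn.mul (continuousOn_finsetProd _ fun j _ => ?_)
    (hd.comp continuous_snd).continuousOn
  refine continuousOn_finsetSum _ fun i _ => ContinuousOn.div continuousOn_const ?_ ?_
  · rcases j with j | j <;> simp only [Sum.elim_inl, Sum.elim_inr] <;> fun_prop
  · rintro ⟨ξ, lam⟩ ⟨hξ, hl⟩
    refine sub_ofReal_ne_zero ?_ (mem_box.1 hl i)
    rcases j with j | j
    · exact hγ.notMem_cut_of_mem_trace (hξ j trivial)
    · exact hz j

lemma continuousOn_jointCumulant {ε : ℝ} {γ : ℝ → ℂ} (hγ : IsContourAround a b ε γ)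
    {z : Fin m → ℂ} (hz : ∀ j, z j ∉ cut a b) {k : ℕ} (A : Finset (Fin k))
    (T : Finset (Fin m)) :
    ContinuousOn (fun ξ => jointCumulant p a b z ξ A T) (traceCube γ k) :=
  continuousOn_finsetSum _ fun _ _ => continuousOn_const.mul
    (continuousOn_finsetProd _ fun B _ => continuousOn_disconnected p hγ hz B)

lemma continuousOn_blockSum_jointCumulant {ε : ℝ} {γ : ℝ → ℂ} (hγ : IsContourAround a b ε γ)
    {z : Fin m → ℂ} (hz : ∀ j, z j ∉ cut a b) {k : ℕ} (T : Finset (Fin m)) :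
    ContinuousOn (fun ξ => blockSum (jointCumulant p a b z ξ) Finset.univ T) (traceCube γ k) :=
  continuousOn_finsetSum _ fun _ _ => continuousOn_finsetSum _ fun _ _ =>
    continuousOn_finsetProd _ fun B _ => continuousOn_jointCumulant p hγ hz B _

lemma continuousOn_aeval_mul {ε : ℝ} {γ : ℝ → ℂ} (hγ : IsContourAround a b ε γ) {k : ℕ}
    (P : MvPolynomial (Fin (k + 1)) ℝ) {h : ℂ → ℂ}
    (hh : DifferentiableOn ℂ h (Metric.thickening ε (cut a b))) :
    ContinuousOn (fun ξ : Fin (k + 1) → ℂ => MvPolynomial.aeval ξ P * h (ξ 0))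
      (traceCube γ (k + 1)) := by
  refine ContinuousOn.mul ?_ ?_
  · have : Continuous fun ξ : Fin (k + 1) → ℂ => MvPolynomial.aeval ξ P := by
      simp only [MvPolynomial.aeval_def, MvPolynomial.eval₂_eq']
      fun_prop
    exact this.continuousOn
  · exact (hh.continuousOn.mono fun ξ hξ => hγ.mem_thickening_of_mem_trace hξ).comp
      (continuous_apply 0).continuousOn fun ξ hξ => hξ 0 trivial

/-- The convolution of the contour integral of the `blockSum`s with the moments is the moment of a
linear statistic. -/
lemma iterContour_blockSum_convolution {ε : ℝ} {γ : ℝ → ℂ} (hγ : IsContourAround a b ε γ)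
    (hab : a < b) (hε : 0 < ε) {z : Fin m → ℂ} (hz : ∀ j, z j ∉ cut a b) {k : ℕ}
    (P : MvPolynomial (Fin (k + 1)) ℝ) {h : ℂ → ℂ}
    (hh : DifferentiableOn ℂ h (Metric.thickening ε (cut a b))) (T : Finset (Fin m)) :
    ∑ V ∈ T.powerset, iterContour γ (k + 1) (fun ξ => MvPolynomial.aeval ξ P * h (ξ 0) *
        blockSum (jointCumulant p a b z ξ) Finset.univ V) * weightedMoment p a b z (T \ V) =
      ∫ lam in box p.N a b, (∏ j ∈ T, resolventTrace (z j) lam) *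
        (∑ i : Fin (k + 1) → Fin p.N,
          MvPolynomial.aeval (fun r => (lam (i r) : ℂ)) P * h (lam (i 0))) *
        (density p lam : ℂ) := by
  have hPc := continuousOn_aeval_mul hγ P hh
  have hc := fun V => hPc.mul (continuousOn_blockSum_jointCumulant p hγ hz V)
  have hbox := isCompact_box p.N a b
  have e1 : ∑ V ∈ T.powerset, iterContour γ (k + 1) (fun ξ => MvPolynomial.aeval ξ P * h (ξ 0) *
        blockSum (jointCumulant p a b z ξ) Finset.univ V) * weightedMoment p a b z (T \ V) =
      iterContour γ (k + 1) fun ξ => ∫ lam in box p.N a b,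
        ((∏ j ∈ T, resolventTrace (z j) lam) * (density p lam : ℂ)) *
        (MvPolynomial.aeval ξ P * h (ξ 0) * ∏ r, resolventTrace (ξ r) lam) := by
    have : ∀ ξ : Fin (k + 1) → ℂ, (∫ lam in box p.N a b,
        ((∏ j ∈ T, resolventTrace (z j) lam) * (density p lam : ℂ)) *
        (MvPolynomial.aeval ξ P * h (ξ 0) * ∏ r, resolventTrace (ξ r) lam)) =
        ∑ V ∈ T.powerset, weightedMoment p a b z (T \ V) * (MvPolynomial.aeval ξ P * h (ξ 0) *
        blockSum (jointCumulant p a b z ξ) Finset.univ V) := by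
      intro ξ
      have e : ∀ V, weightedMoment p a b z (T \ V) * (MvPolynomial.aeval ξ P * h (ξ 0) *
        blockSum (jointCumulant p a b z ξ) Finset.univ V) =
        (MvPolynomial.aeval ξ P * h (ξ 0)) * (blockSum (jointCumulant p a b z ξ) Finset.univ V *
          weightedMoment p a b z (T \ V)) := fun V => by ring
      simp_rw [e]
      rw [← Finset.mul_sum, blockSum_jointCumulant p hab, ← integral_const_mul]
      refine integral_congr_ae (Filter.Eventually.of_forall fun lam => ?_)
      simp only
      ring
    simp_rw [this]
    rw [hγ.iterContour_sum T.powerset (F := fun V ξ => weightedMoment p a b z (T \ V) *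
      (MvPolynomial.aeval ξ P * h (ξ 0) * blockSum (jointCumulant p a b z ξ) Finset.univ V))
      fun V _ => continuousOn_const.mul (hc V)]
    refine Finset.sum_congr rfl fun V _ => ?_
    rw [iterContour_const_mul, mul_comm]
  rw [e1, hγ.iterContour_integral hbox hbox.measurableSet hbox.measure_lt_top.ne]
  · refine setIntegral_congr_fun hbox.measurableSet fun lam hl => ?_
    rw [iterContour_const_mul, hγ.iterContour_aeval_mul_resolventTrace hε P hh (mem_box.1 hl)]
    ring
  · have hd : Continuous fun lam => (density p lam : ℂ) :=
      Complex.continuous_ofReal.comp (continuous_density p)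
    refine ContinuousOn.mul (ContinuousOn.comp (ContinuousOn.mul
      (continuousOn_finsetProd _ fun j _ => continuousOn_resolventTrace_box (hz j))
      hd.continuousOn) continuousOn_snd fun q hq => hq.2)
      ((hPc.comp continuousOn_fst fun q hq => hq.1).mul
        (continuousOn_finsetProd _ fun r _ => ?_))
    refine continuousOn_finsetSum _ fun i _ => ContinuousOn.div continuousOn_const (by fun_prop) ?_
    rintro ⟨ξ, lam⟩ ⟨hξ, hl⟩
    exact sub_ofReal_ne_zero (hγ.notMem_cut_of_mem_trace (hξ r trivial)) (mem_box.1 hl i)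

/-! ### The sums over partitions in terms of correlators -/

lemma blockSum_singleton {ρ ι : Type*} [DecidableEq ρ] [DecidableEq ι] [Fintype ι]
    (k : Finset ρ → Finset ι → ℂ) (r : ρ) (T : Finset ι) : blockSum k {r} T = k {r} T := by
  rw [blockSum_eq k {r} r (Finset.mem_singleton_self r)]
  have : ({r} : Finset ρ).powerset.filter (r ∈ ·) = {{r}} := by
    ext B
    simp only [Finset.mem_filter, Finset.mem_powerset, Finset.mem_singleton,
      Finset.subset_singleton_iff]
    constructor
    · rintro ⟨rfl | rfl, h⟩
      · simp at h
      · rfl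
    · rintro rfl; simp
  rw [this, Finset.sum_singleton, Finset.sum_eq_single_of_mem T (Finset.mem_powerset_self T)]
  · simp [blockSum_empty]
  · intro U hU hne
    have : T \ U ≠ ∅ := fun h => hne (Finset.Subset.antisymm (Finset.mem_powerset.1 hU)
      (Finset.sdiff_eq_empty_iff_subset.1 h))
    simp [blockSum_empty, this]

lemma blockSum_pair {ι : Type*} [DecidableEq ι] [Fintype ι]
    (k : Finset (Fin 2) → Finset ι → ℂ) (T : Finset ι) : blockSum k Finset.univ T =
      k Finset.univ T + ∑ U ∈ T.powerset, k {0} U * k {1} (T \ U) := by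
  rw [blockSum_eq k Finset.univ 0 (Finset.mem_univ _)]
  have : (Finset.univ : Finset (Fin 2)).powerset.filter (0 ∈ ·) = {Finset.univ, {0}} := by decide
  rw [this, Finset.sum_insert (by decide), Finset.sum_singleton]
  congr 1
  · rw [Finset.sum_eq_single_of_mem T (Finset.mem_powerset_self T)]
    · simp [blockSum_empty]
    · intro U hU hne
      have : T \ U ≠ ∅ := fun h => hne (Finset.Subset.antisymm (Finset.mem_powerset.1 hU)
        (Finset.sdiff_eq_empty_iff_subset.1 h))
      simp [blockSum_empty, this]
  · have : (Finset.univ : Finset (Fin 2)) \ {0} = {1} := by decide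
    simp_rw [this, blockSum_singleton]

lemma distributionSum_univ {ρ ι : Type*} [DecidableEq ρ] [DecidableEq ι] [Fintype ι]
    (k : Finset ρ → Finset ι → ℂ) (P : Finset (Finset ρ)) :
    distributionSum k P Finset.univ = ∑ f : ι → {B // B ∈ P},
      ∏ B : {B // B ∈ P}, k B.1 (Finset.univ.filter (f · = B)) := by
  rw [distributionSum]
  symm
  refine Finset.sum_bij (fun f _ i => (f i).1) ?_ ?_ ?_ ?_
  · intro f _
    simp
  · intro f _ g _ h
    funext i
    exact Subtype.ext (congrFun h i)
  · intro c hc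
    simp only [Finset.mem_univ, if_true, Fintype.mem_piFinset] at hc
    exact ⟨fun i => ⟨c i, hc i⟩, Finset.mem_univ _, rfl⟩
  · intro f _
    rw [← Finset.prod_coe_sort P]
    refine Finset.prod_congr rfl fun B _ => ?_
    simp only [Subtype.ext_iff]

lemma blockSum_jointCumulant_univ (z : Fin m → ℂ) {k : ℕ} (ξ : Fin k → ℂ) :
    blockSum (jointCumulant p a b z ξ) Finset.univ Finset.univ =
      ∑ K : Finpartition (Finset.univ : Finset (Fin k)), ∑ f : Fin m → {B // B ∈ K.parts},
        ∏ B : {B // B ∈ K.parts}, W p a b (Sum.elim (fun r : {r // r ∈ B.1} => ξ r)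
          (fun j : {j // f j = B} => z j)) := by
  rw [blockSum, ← sum_finpartition_eq]
  refine Finset.sum_congr rfl fun K _ => ?_
  rw [distributionSum_univ]
  refine Finset.sum_congr rfl fun f _ => Finset.prod_congr rfl fun B _ => ?_
  rw [jointCumulant]
  have := W_sumElim_eq_cumulant p (a := a) (b := b) (Function.Embedding.subtype (· ∈ B.1))
    (Function.Embedding.subtype (f · = B)) ξ z
  refine Eq.trans ?_ this.symm
  congr 1
  ext (i | i) <;> simp

end Moments

/-! ### The Schwinger-Dyson equation -/

section LoopEquation

variable (p : Params) {a b ε : ℝ} {m : ℕ} {γ : ℝ → ℂ}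

/-- The left hand side of the equation, restricted to the points `z j`, `j ∈ T`. -/
def loopSum (p : Params) (a b : ℝ) (γ : ℝ → ℂ) (x : ℂ) (z : Fin m → ℂ)
    (T : Finset (Fin m)) : ℂ :=
  blockSum (jointCumulant p a b z fun _ : Fin 2 => x) Finset.univ T
  + ∑ i ∈ T, iterContour γ 1 (fun ξ => MvPolynomial.aeval ξ (1 : MvPolynomial (Fin 1) ℝ) *
      (1 / ((x - ξ 0) * (z i - ξ 0) ^ 2)) *
        blockSum (jointCumulant p a b z ξ) Finset.univ (T.erase i))
  + ∑ k ∈ Finset.range (2 * p.𝔤), iterContour γ (k + 1) (fun ξ =>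
      MvPolynomial.aeval ξ (MvPolynomial.pderiv 0 (interaction p (k + 1))) *
        (1 / ((k.factorial : ℂ) * (x - ξ 0))) *
          blockSum (jointCumulant p a b z ξ) Finset.univ T)

lemma differentiableOn_one_div_sub {x : ℂ} {U : Set ℂ} (hx : x ∉ U) {c : ℂ} (hc : c ≠ 0) :
    DifferentiableOn ℂ (fun ξ => 1 / (c * (x - ξ))) U := by
  refine DifferentiableOn.div (by fun_prop) (by fun_prop) fun ξ hξ => mul_ne_zero hc ?_
  exact fun h => hx (sub_eq_zero.1 h ▸ hξ)

lemma differentiableOn_one_div_sub_mul_sq {x y : ℂ} {U : Set ℂ} (hx : x ∉ U) (hy : y ∉ U) :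
    DifferentiableOn ℂ (fun ξ => 1 / ((x - ξ) * (y - ξ) ^ 2)) U := by
  refine DifferentiableOn.div (by fun_prop) (by fun_prop) fun ξ hξ =>
    mul_ne_zero (fun h => hx (sub_eq_zero.1 h ▸ hξ))
      (pow_ne_zero 2 fun h => hy (sub_eq_zero.1 h ▸ hξ))

/-- The terms of `loopSum` which involve one of the marked points. -/
lemma sum_powerset_sum_erase {ι : Type*} [DecidableEq ι] (T : Finset ι)
    (F : ι → Finset ι → ℂ) (E : Finset ι → ℂ) :
    ∑ V ∈ T.powerset, (∑ i ∈ V, F i (V.erase i)) * E (T \ V) =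
      ∑ i ∈ T, ∑ V ∈ (T.erase i).powerset, F i V * E (T.erase i \ V) := by
  simp_rw [Finset.sum_mul]
  rw [Finset.sum_sigma', Finset.sum_sigma']
  refine Finset.sum_bij' (fun x _ => ⟨x.2, x.1.erase x.2⟩) (fun y _ => ⟨insert y.1 y.2, y.1⟩)
    ?_ ?_ ?_ ?_ ?_
  · rintro ⟨V, i⟩ h
    simp only [Finset.mem_sigma, Finset.mem_powerset] at h ⊢
    exact ⟨h.1 h.2, Finset.erase_subset_erase i h.1⟩
  · rintro ⟨i, V⟩ h
    simp only [Finset.mem_sigma, Finset.mem_powerset] at h ⊢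
    exact ⟨Finset.insert_subset h.1 (h.2.trans (Finset.erase_subset i T)),
      Finset.mem_insert_self i V⟩
  · rintro ⟨V, i⟩ h
    simp only [Finset.mem_sigma] at h
    simp [Finset.insert_erase h.2]
  · rintro ⟨i, V⟩ h
    simp only [Finset.mem_sigma, Finset.mem_powerset] at h
    have : i ∉ V := fun hi => Finset.notMem_erase i T (h.2 hi)
    simp [Finset.erase_insert this]
  · rintro ⟨V, i⟩ h
    simp only [Finset.mem_sigma, Finset.mem_powerset] at h
    simp only
    congr 2
    ext j
    simp only [Finset.mem_sdiff, Finset.mem_erase]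
    by_cases hj : j = i
    · subst hj; simp [h.2]
    · simp [hj]

/-- The convolution of `loopSum` with the moments is the flux of `Ψ ∏_{j ∈ T} X_{z_j}`. -/
lemma loopSum_convolution (hab : a < b) (hε : 0 < ε) (hγ : IsContourAround a b ε γ) {x : ℂ}
    {z : Fin m → ℂ} (hx : x ∉ Metric.thickening ε (cut a b))
    (hz : ∀ i, z i ∉ Metric.thickening ε (cut a b)) (T : Finset (Fin m)) :
    ∑ V ∈ T.powerset, loopSum p a b γ x z V * weightedMoment p a b z (T \ V) =
      boundaryFlux a b x fun lam =>
        (∏ j ∈ T, resolventTrace (z j) lam) * (density p lam : ℂ) := by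
  have hcut : cut a b ⊆ Metric.thickening ε (cut a b) := Metric.self_subset_thickening hε _
  have hx' : x ∉ cut a b := fun h => hx (hcut h)
  have hz' : ∀ i, z i ∉ cut a b := fun i h => hz i (hcut h)
  have hbox := isCompact_box p.N a b
  have hd : Continuous fun lam => (density p lam : ℂ) :=
    Complex.continuous_ofReal.comp (continuous_density p)
  have hX : ∀ S : Finset (Fin m), ContinuousOn
      (fun lam : Fin p.N → ℝ => ∏ j ∈ S, resolventTrace (z j) lam) (box p.N a b) := fun S =>
    continuousOn_finsetProd _ fun j _ => continuousOn_resolventTrace_box (hz' j)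
  have hne : ∀ {y : ℂ}, y ∉ cut a b → ∀ lam ∈ box p.N a b, ∀ i, y - (lam i : ℂ) ≠ 0 :=
    fun hy lam hl i => sub_ofReal_ne_zero hy (mem_box.1 hl i)
  -- the three kinds of terms
  have e1 := blockSum_jointCumulant p hab z (fun _ : Fin 2 => x) T
  have e2 : ∑ V ∈ T.powerset, (∑ i ∈ V, iterContour γ 1 (fun ξ =>
        MvPolynomial.aeval ξ (1 : MvPolynomial (Fin 1) ℝ) *
        (1 / ((x - ξ 0) * (z i - ξ 0) ^ 2)) *
          blockSum (jointCumulant p a b z ξ) Finset.univ (V.erase i))) *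
            weightedMoment p a b z (T \ V) =
      ∑ i ∈ T, ∫ lam in box p.N a b, (∏ j ∈ T.erase i, resolventTrace (z j) lam) *
        mixedStatistic x (z i) lam * (density p lam : ℂ) := by
    rw [sum_powerset_sum_erase T (fun i V => iterContour γ 1 (fun ξ =>
        MvPolynomial.aeval ξ (1 : MvPolynomial (Fin 1) ℝ) *
        (1 / ((x - ξ 0) * (z i - ξ 0) ^ 2)) *
          blockSum (jointCumulant p a b z ξ) Finset.univ V)) (weightedMoment p a b z)]
    refine Finset.sum_congr rfl fun i _ => ?_
    rw [iterContour_blockSum_convolution p hγ hab hε hz' 1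
      (h := fun ξ => 1 / ((x - ξ) * (z i - ξ) ^ 2))
      (differentiableOn_one_div_sub_mul_sq hx (hz i)) (T.erase i)]
    refine integral_congr_ae (Filter.Eventually.of_forall fun lam => ?_)
    simp only [map_one, one_mul, mixedStatistic]
    congr 2
    exact Fintype.sum_equiv (Equiv.funUnique (Fin 1) (Fin p.N)) _ _ fun i => rfl
  have e3 : ∀ k, ∑ V ∈ T.powerset, iterContour γ (k + 1) (fun ξ =>
      MvPolynomial.aeval ξ (MvPolynomial.pderiv 0 (interaction p (k + 1))) *
        (1 / ((k.factorial : ℂ) * (x - ξ 0))) *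
          blockSum (jointCumulant p a b z ξ) Finset.univ V) * weightedMoment p a b z (T \ V) =
      ∫ lam in box p.N a b, (∏ j ∈ T, resolventTrace (z j) lam) *
        (∑ i : Fin (k + 1) → Fin p.N, MvPolynomial.aeval (fun r => (lam (i r) : ℂ))
          (MvPolynomial.pderiv 0 (interaction p (k + 1))) *
            (1 / ((k.factorial : ℂ) * (x - lam (i 0))))) * (density p lam : ℂ) := fun k =>
    iterContour_blockSum_convolution p hγ hab hε hz' _
      (h := fun ξ => 1 / ((k.factorial : ℂ) * (x - ξ)))
      (differentiableOn_one_div_sub hx (Nat.cast_ne_zero.2 k.factorial_ne_zero)) T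
  simp only [loopSum, add_mul, Finset.sum_add_distrib]
  rw [e1, e2]
  simp_rw [Finset.sum_mul]
  rw [Finset.sum_comm (s := T.powerset)]
  simp_rw [e3]
  have i1 : IntegrableOn (fun lam : Fin p.N → ℝ => (∏ _r : Fin 2, resolventTrace x lam) *
      (∏ j ∈ T, resolventTrace (z j) lam) * (density p lam : ℂ)) (box p.N a b) :=
    (((continuousOn_finsetProd _ fun _ _ => continuousOn_resolventTrace_box hx').mul (hX T)).mul
      hd.continuousOn).integrableOn_compact hbox
  have i2 : ∀ i ∈ T, IntegrableOn (fun lam : Fin p.N → ℝ =>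
      (∏ j ∈ T.erase i, resolventTrace (z j) lam) *
        mixedStatistic x (z i) lam * (density p lam : ℂ)) (box p.N a b) := by
    refine fun i _ => (((hX _).mul (continuousOn_finsetSum _ fun l _ =>
      ContinuousOn.div continuousOn_const (by fun_prop) fun lam hl => ?_)).mul
      hd.continuousOn).integrableOn_compact hbox
    exact mul_ne_zero (hne hx' lam hl l) (pow_ne_zero 2 (hne (hz' i) lam hl l))
  have i3 : ∀ k ∈ Finset.range (2 * p.𝔤), IntegrableOn (fun lam : Fin p.N → ℝ =>
      (∏ j ∈ T, resolventTrace (z j) lam) *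
        (∑ i : Fin (k + 1) → Fin p.N, MvPolynomial.aeval (fun r => (lam (i r) : ℂ))
          (MvPolynomial.pderiv 0 (interaction p (k + 1))) *
            (1 / ((k.factorial : ℂ) * (x - lam (i 0))))) * (density p lam : ℂ)) (box p.N a b) := by
    refine fun k _ => (((hX T).mul (continuousOn_finsetSum _ fun i _ => ContinuousOn.mul ?_
      (ContinuousOn.div continuousOn_const (by fun_prop) fun lam hl => ?_))).mul
        hd.continuousOn).integrableOn_compact hbox
    · simp_rw [aeval_ofReal]
      exact (Complex.continuous_ofReal.comp (continuous_eval_comp _ i)).continuousOn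
    · exact mul_ne_zero (Nat.cast_ne_zero.2 k.factorial_ne_zero) (hne hx' lam hl (i 0))
  have i12 := (i1.add (integrable_finsetSum T i2)).congr
    (Filter.Eventually.of_forall fun lam => Pi.add_apply _ _ lam)
  rw [boundaryFlux_moment p hab hx' hz' T, ← integral_finsetSum T i2, ← integral_finsetSum _ i3,
    ← integral_add i1 (integrable_finsetSum T i2),
    ← integral_add i12 (integrable_finsetSum _ i3)]
  refine integral_congr_ae (Filter.Eventually.of_forall fun lam => ?_)
  simp only [Finset.prod_const, Finset.card_univ, Fintype.card_fin, driftStatistic]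
  simp_rw [← Finset.sum_mul, ← Finset.mul_sum]
  ring

/-- Both sides have the same convolution with the moments, namely the fluxes. -/
lemma loopSum_univ_eq_boundaryTerm (hab : a < b) (hε : 0 < ε) (hγ : IsContourAround a b ε γ)
    {x : ℂ} {z : Fin m → ℂ} (hx : x ∉ Metric.thickening ε (cut a b))
    (hz : ∀ i, z i ∉ Metric.thickening ε (cut a b)) :
    loopSum p a b γ x z Finset.univ = boundaryTerm p a b x z := by
  have hcut : cut a b ⊆ Metric.thickening ε (cut a b) := Metric.self_subset_thickening hε _
  have hZ := partitionFunction_ne_zero p hab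
  have h0 : weightedMoment p a b z ∅ ≠ 0 := by
    simpa [weightedMoment, partitionFunction] using hZ
  rw [boundaryTerm_eq p (continuous_density p) hab (fun i h => hz i (hcut h)) hZ]
  refine eq_of_convolution_eq (m := weightedMoment p a b z) h0 Finset.univ fun S _ => ?_
  rw [loopSum_convolution p hab hε hγ hx hz S]
  exact (deconvolution_convolution (m := weightedMoment p a b z)
    (f := fun S => boundaryFlux a b x fun lam =>
      (∏ j ∈ S, resolventTrace (z j) lam) * (density p lam : ℂ)) h0 S).symm

lemma W_sumElim_eq_jointCumulant {ρ ι : Type} [Fintype ρ] [DecidableEq ρ] [Fintype ι]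
    [DecidableEq ι] {k : ℕ} (f : ρ ↪ Fin k) (g : ι ↪ Fin m) (ξ : Fin k → ℂ) (z : Fin m → ℂ)
    {A : Finset (Fin k)} {T : Finset (Fin m)} (hA : Finset.univ.map f = A)
    (hT : Finset.univ.map g = T) :
    W p a b (Sum.elim (fun r => ξ (f r)) (fun j => z (g j))) = jointCumulant p a b z ξ A T := by
  subst hA hT
  exact W_sumElim_eq_cumulant p f g ξ z

lemma blockSum_jointCumulant_pair (x : ℂ) (z : Fin m → ℂ) :
    blockSum (jointCumulant p a b z fun _ : Fin 2 => x) Finset.univ Finset.univ =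
      W p a b (Sum.elim (fun _ : Fin 2 => x) z) + ∑ J : Finset (Fin m),
        W p a b (Sum.elim (fun _ : Fin 1 => x) (fun j : {j // j ∈ J} => z j))
          * W p a b (Sum.elim (fun _ : Fin 1 => x) (fun j : {j // j ∉ J} => z j)) := by
  have hpt : ∀ r : Fin 2, ∃ f : Fin 1 ↪ Fin 2, Finset.univ.map f = {r} := fun r =>
    ⟨⟨fun _ => r, fun _ _ _ => Subsingleton.elim _ _⟩, by
      rw [Finset.univ_unique, Finset.map_singleton]; rfl⟩
  obtain ⟨f₀, h₀⟩ := hpt 0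
  obtain ⟨f₁, h₁⟩ := hpt 1
  rw [blockSum_pair, Finset.powerset_univ]
  have h₂ := W_sumElim_eq_jointCumulant p (a := a) (b := b) (Function.Embedding.refl (Fin 2))
    (Function.Embedding.refl (Fin m)) (fun _ => x) z Finset.map_refl Finset.map_refl
  simp only [Function.Embedding.refl_apply] at h₂
  rw [← h₂]
  refine congrArg (W p a b (Sum.elim (fun _ : Fin 2 => x) z) + ·)
    (Finset.sum_congr rfl fun J _ => ?_)
  have hJ : Finset.univ.map (Function.Embedding.subtype (· ∈ J)) = J := by ext; simp
  have hJ' : Finset.univ.map (Function.Embedding.subtype (· ∉ J)) = Finset.univ \ J := by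
    ext; simp
  rw [← W_sumElim_eq_jointCumulant p f₀ _ (fun _ => x) z h₀ hJ,
    ← W_sumElim_eq_jointCumulant p f₁ _ (fun _ => x) z h₁ hJ']
  rfl

lemma blockSum_jointCumulant_erase (z : Fin m → ℂ) (ξ : Fin 1 → ℂ) (i : Fin m) :
    blockSum (jointCumulant p a b z ξ) Finset.univ (Finset.univ.erase i) =
      W p a b (Sum.elim (fun _ : Fin 1 => ξ 0) (fun j : {j // j ≠ i} => z j)) := by
  have hi : Finset.univ.map (Function.Embedding.subtype (· ≠ i)) = Finset.univ.erase i := by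
    ext; simp
  have h := W_sumElim_eq_jointCumulant p (a := a) (b := b) (Function.Embedding.refl (Fin 1))
    _ ξ z Finset.map_refl hi
  have hξ : (fun _ : Fin 1 => ξ 0) = ξ := funext fun r => congrArg ξ (Subsingleton.elim _ _)
  rw [hξ, Finset.univ_unique, blockSum_singleton]
  rw [Finset.univ_unique] at h
  exact h.symm

lemma iterContour_blockSum_erase (x : ℂ) (z : Fin m → ℂ) (i : Fin m) :
    iterContour γ 1 (fun ξ => MvPolynomial.aeval ξ (1 : MvPolynomial (Fin 1) ℝ) *
      (1 / ((x - ξ 0) * (z i - ξ 0) ^ 2)) *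
        blockSum (jointCumulant p a b z ξ) Finset.univ (Finset.univ.erase i)) =
    contour γ (fun ξ => W p a b (Sum.elim (fun _ : Fin 1 => ξ) (fun j : {j // j ≠ i} => z j))
            / ((x - ξ) * (z i - ξ) ^ 2)) := by
  simp_rw [blockSum_jointCumulant_erase]
  simp only [iterContour, Fin.cons_zero, map_one, one_mul, one_div_mul_eq_div]

lemma continuousOn_W_sumElim (hγ : IsContourAround a b ε γ) {z : Fin m → ℂ}
    (hz : ∀ i, z i ∉ cut a b) {ρ ι : Type} [Fintype ρ] [DecidableEq ρ] [Fintype ι]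
    [DecidableEq ι] {k : ℕ} (f : ρ ↪ Fin k) (g : ι ↪ Fin m) :
    ContinuousOn (fun ξ : Fin k → ℂ =>
      W p a b (Sum.elim (fun r => ξ (f r)) (fun j => z (g j)))) (traceCube γ k) :=
  (continuousOn_jointCumulant p hγ hz (Finset.univ.map f) (Finset.univ.map g)).congr fun ξ _ =>
    W_sumElim_eq_jointCumulant p f g ξ z rfl rfl

lemma iterContour_blockSum_univ (hγ : IsContourAround a b ε γ) {x : ℂ}
    (hx : x ∉ Metric.thickening ε (cut a b)) {z : Fin m → ℂ} (hz : ∀ i, z i ∉ cut a b) (k : ℕ)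
    (P : MvPolynomial (Fin (k + 1)) ℝ) :
    iterContour γ (k + 1) (fun ξ => MvPolynomial.aeval ξ P *
        (1 / ((k.factorial : ℂ) * (x - ξ 0))) *
          blockSum (jointCumulant p a b z ξ) Finset.univ Finset.univ) =
    ∑ K : Finpartition (Finset.univ : Finset (Fin (k + 1))),
      ∑ f : Fin m → {B // B ∈ K.parts},
        iterContour γ (k + 1) (fun ξ =>
          MvPolynomial.aeval ξ P / ((k.factorial : ℂ) * (x - ξ 0))
          * ∏ B : {B // B ∈ K.parts}, W p a b (Sum.elim (fun r : {r // r ∈ B.1} => ξ r)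
              (fun j : {j // f j = B} => z j))) := by
  have hc : ∀ (K : Finpartition (Finset.univ : Finset (Fin (k + 1))))
      (f : Fin m → {B // B ∈ K.parts}), ContinuousOn (fun ξ : Fin (k + 1) → ℂ =>
        MvPolynomial.aeval ξ P * (1 / ((k.factorial : ℂ) * (x - ξ 0))) *
          ∏ B : {B // B ∈ K.parts}, W p a b (Sum.elim (fun r : {r // r ∈ B.1} => ξ r)
            (fun j : {j // f j = B} => z j))) (traceCube γ (k + 1)) := by
    intro K f
    refine (continuousOn_aeval_mul hγ P (h := fun ξ => 1 / ((k.factorial : ℂ) * (x - ξ)))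
      (differentiableOn_one_div_sub hx
      (Nat.cast_ne_zero.2 k.factorial_ne_zero))).mul (continuousOn_finsetProd _ fun B _ => ?_)
    exact continuousOn_W_sumElim p hγ hz
      (Function.Embedding.subtype (· ∈ B.1)) (Function.Embedding.subtype (f · = B))
  simp_rw [blockSum_jointCumulant_univ, Finset.mul_sum]
  rw [hγ.iterContour_sum _ fun K _ => continuousOn_finsetSum _ fun f _ => hc K f]
  refine Finset.sum_congr rfl fun K _ => ?_
  rw [hγ.iterContour_sum _ fun f _ => hc K f]
  simp only [mul_one_div]
end LoopEquation

end DiracEnsemble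

end

open DiracEnsemble in
theorem mainTheorem2 (p : Params) (a b : ℝ) (hab : a < b)
    (n : ℕ) (hn : 1 ≤ n) (x : ℂ) (z : Fin (n - 1) → ℂ)
    (ε : ℝ) (hε : 0 < ε)
    (hx : x ∉ Metric.thickening ε (cut a b))
    (hz : ∀ i, z i ∉ Metric.thickening ε (cut a b))
    (γ : ℝ → ℂ) (hγ : IsContourAround a b ε γ) :
    (W p a b (Sum.elim (fun _ : Fin 2 => x) z)
      + ∑ J : Finset (Fin (n - 1)),
          W p a b (Sum.elim (fun _ : Fin 1 => x) (fun j : {j // j ∈ J} => z j))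
            * W p a b (Sum.elim (fun _ : Fin 1 => x) (fun j : {j // j ∉ J} => z j)))
    + ∑ i : Fin (n - 1), contour γ (fun ξ =>
          W p a b (Sum.elim (fun _ : Fin 1 => ξ) (fun j : {j // j ≠ i} => z j))
            / ((x - ξ) * (z i - ξ) ^ 2))
    + ∑ k ∈ Finset.range (2 * p.𝔤),
        ∑ K : Finpartition (Finset.univ : Finset (Fin (k + 1))),
        ∑ φ : Fin (n - 1) → {B // B ∈ K.parts},
          iterContour γ (k + 1) (fun ξ =>
            MvPolynomial.aeval ξ (MvPolynomial.pderiv 0 (interaction p (k + 1)))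
              / ((k.factorial : ℂ) * (x - ξ 0))
            * ∏ B : {B // B ∈ K.parts},
                W p a b (Sum.elim (fun r : {r // r ∈ B.1} => ξ r)
                  (fun j : {j // φ j = B} => z j)))
    = boundaryTerm p a b x z := by
  rw [← loopSum_univ_eq_boundaryTerm p hab hε hγ hx hz, loopSum, blockSum_jointCumulant_pair]
  refine congrArg₂ (· + ·) (congrArg₂ (· + ·) rfl ?_) ?_
  · exact Finset.sum_congr rfl fun i _ => (iterContour_blockSum_erase p x z i).symm
  · exact Finset.sum_congr rfl fun k _ => (iterContour_blockSum_univ p hγ hx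
      (fun i h => hz i (Metric.self_subset_thickening hε _ h)) k _).symm
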